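/- **Setting.** Let $\Theta\subset\mathbb R^d$ be compact and convex, $q(z,\cdot)$ twice differentiable at every point of $\Theta$, and let $z_1,\dots,z_n$ be a sample with law $\mathbb P_n$. Put $Q_n(\theta)=\frac1n\sum_i q(z_i,\theta)$, $G_n=\nabla Q_n$, $H_n=\nabla^2Q_n$; $\hat\theta_n$ minimizes $Q_n$ over $\Theta$ and $G_n(\hat\theta_n)=0$; $\theta^\dagger\in\Theta$. For each iteration $b\ge1$ let $Q_m^{(b)}(\theta)=\frac1n\sum_i w_i^{(b)}q(z_i,\theta)$ be either the objective of $m\le n$ observations drawn independently and uniformly with replacement from $(z_1,\dots,z_n)$, or the reweighted objective with $m=n$ and iid weights of mean and variance one; $G_m^{(b)},H_m^{(b)}$ are its gradient and Hessian. Given the sample, let $\mathbb P^\star$ be the probability under resampling/reweighting ($\mathbb E^\star$, $\mathrm{var}^\star$ its expectation and variance); the perturbations of iteration $b+1$ are independent of all randomness before them. For $\gamma\in(0,1]$ let $\theta_{b+1}=\theta_b-\gamma P_bG_m^{(b+1)}(\theta_b)$, where $P_b$ may depend on $\theta_0$, on the perturbations up to iteration $b+1$, and on extra randomness independent of later perturbations;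 all draws $\theta_b$ lie in $\Theta$. Put $d_{0,n}=[\mathbb E^\star\|\theta_0-\hat\theta_n\|^p]^{1/p}$, $\Sigma_n=m\,\mathrm{var}^\star[G_m^{(b)}(\hat\theta_n)]$, $V_n=H_n(\hat\theta_n)^{-1}\Sigma_nH_n(\hat\theta_n)^{-1}$, $\phi(\gamma)=\gamma^2/(1-(1-\gamma)^2)$. Conditions on the sample below (including those above on $\hat\theta_n$ and $\theta_b\in\Theta$) are required for samples in sets $S_n$ with $\mathbb P_n(S_n)\to1$, with constants that do not depend on $n$, $m$, $b$ or the sample. **Coupling conditions in $L_p$** (with $\overline P_m=[H_n(\hat\theta_n)]^{-1}$). There are constants $0<\underline\lambda_H\le\overline\lambda_H$, $0<\underline\lambda_P\le\overline\lambda_P$, $C_1,C_2,C_3,C_5$, $\rho\in[0,1)$ such that: for all $\theta\in\Theta$ the eigenvalues of $H_n(\theta)$ and, $\mathbb P^\star$-a.s., of $H_m^{(b)}(\theta)$ ($b\ge1$) lie in $[\underline\lambda_H,\overline\lambda_H]$; $\|H_n(\theta)-H_n(\hat\theta_n)\|_2\le C_1\|\theta-\hat\theta_n\|_2$ on $\Theta$;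 $[\mathbb E^\star\sup_{\theta\in\Theta}\|G_m^{(b)}(\theta)-G_n(\theta)\|^p]^{1/p}\le C_2m^{-1/2}$ and $[\mathbb E^\star\sup_{\theta\in\Theta}\|H_m^{(b)}(\theta)-H_n(\theta)\|_2^p]^{1/p}\le C_3m^{-1/2}$; $P_b$ is symmetric with eigenvalues in $[\underline\lambda_P,\overline\lambda_P]$ $\mathbb P^\star$-a.s. for $b\ge1$; $A(\gamma)=1-2\gamma\underline\lambda_P\underline\lambda_H+\gamma^2(\overline\lambda_P\overline\lambda_H)^2\in[0,1)$; $\overline P_m$ is symmetric positive definite; the largest eigenvalue of $I-\gamma\overline P_mH_n(\hat\theta_n)$ is in $[0,1)$; and $[\mathbb E^\star\|I-P_b\overline P_m^{-1}\|_2^p]^{1/p}\le C_5(\rho^bd_{0,n}+m^{-1/2})$ for all $b\ge0$. **Theorem.** Suppose that (a) the coupling conditions hold with $p=2$; (b) the eigenvalues of $\Sigma_n$ are bounded and bounded away from zero; (c) there are $\beta\in(0,1/2]$, $\kappa>0$, $C_\psi$ such that for every $T$, all large $n$ and all $\|\tau\|\le T$, $$\mathbb E^\star\exp\bigl[\mathbf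 i\sqrt m\,\tau'V_n^{-1/2}H_n(\hat\theta_n)^{-1}G_m^{(b)}(\hat\theta_n)\bigr]=e^{-\|\tau\|^2/2}\Bigl(1+\frac{r_m(\tau)}{m^\beta}\Bigr),\qquad |r_m(\tau)|\le C_\psi\|\tau\|^\kappa;$$ (d) $V_n\to V$ in probability and $\sqrt n(\hat\theta_n-\theta^\dagger)\to N(0,V)$ in distribution; (e) $h$ is real-valued, continuously differentiable on a neighbourhood of $\Theta$, $\nabla h$ is Lipschitz on $\Theta$, and $\nabla h(\theta^\dagger)\ne0$. Let $m=m_n\to\infty$ and $b=b_n\to\infty$ with $\log(m)/b\to0$ as $n\to\infty$. (i) Let $\tilde\theta_b=\hat\theta_n+\sqrt{m/(n\phi(\gamma))}\,(\theta_b-\hat\theta_n)$ and let $c_{h,b}(\alpha)$ be the $\alpha$-quantile, under $\mathbb P^\star$, of $h(\tilde\theta_b)-h(\hat\theta_n)$. For every $\alpha\in(0,1)$, $$\lim_{n\to\infty}\mathbb P_n\bigl[c_{h,b}(\alpha/2)\le h(\theta^\dagger)-h(\hat\theta_n)\le c_{h,b}(1-\alpha/2)\bigr]=1-\alpha .$$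 (ii) If the coupling conditions also hold with $p=4$, then $$\frac{m}{\phi(\gamma)}\mathrm{var}^\star[h(\theta_b)]=\nabla h(\hat\theta_n)V_n\nabla h(\hat\theta_n)'+o(1),$$ uniformly over the samples in $S_n$ (hence in probability, and almost surely if each $S_n$ has probability one). -/

import Mathlib

open MeasureTheory ProbabilityTheory Filter Topology
open scoped ENNReal MatrixOrder

noncomputable section

namespace ResampledOpt

/-- Parameter vectors, with the Euclidean norm. -/
abbrev Vec (d : ℕ) := EuclideanSpace ℝ (Fin d)

/-- The Hessian matrix of `f` at `θ`: the matrix of the derivative of the gradient. -/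
def hess {d : ℕ} (f : Vec d → ℝ) (θ : Vec d) : Matrix (Fin d) (Fin d) ℝ :=
  (Matrix.toEuclideanCLM (n := Fin d) (𝕜 := ℝ)).symm (fderiv ℝ (gradient f) θ)

/-- `f` is twice differentiable at `θ`. -/
def TwiceDifferentiableAt {d : ℕ} (f : Vec d → ℝ) (θ : Vec d) : Prop :=
  (∀ᶠ η in 𝓝 θ, DifferentiableAt ℝ f η) ∧ DifferentiableAt ℝ (gradient f) θ

/-- The action `A v` of a matrix on a vector. -/
def act {d : ℕ} (A : Matrix (Fin d) (Fin d) ℝ) (v : Vec d) : Vec d :=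
  Matrix.toEuclideanCLM (n := Fin d) (𝕜 := ℝ) A v

/-- The quadratic form `u' A u`. -/
def quad {d : ℕ} (A : Matrix (Fin d) (Fin d) ℝ) (u : Vec d) : ℝ := inner ℝ u (act A u)

/-- The matrix `A` seen as an operator; its norm is the spectral norm `‖A‖₂`. -/
abbrev op {d : ℕ} (A : Matrix (Fin d) (Fin d) ℝ) : Vec d →L[ℝ] Vec d :=
  Matrix.toEuclideanCLM (n := Fin d) (𝕜 := ℝ) A

/-- `A` is symmetric and `l ≤ λ_min(A) ≤ λ_max(A) ≤ L`. -/
def EigBounds {d : ℕ} (A : Matrix (Fin d) (Fin d) ℝ) (l L : ℝ) : Prop :=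
  A.IsSymm ∧ ∀ u : Vec d, l * ‖u‖ ^ 2 ≤ quad A u ∧ quad A u ≤ L * ‖u‖ ^ 2

section Objective

variable {d n : ℕ} {Z : Type*}

/-- The weighted objective `(1/n) ∑ wᵢ q(zᵢ, θ)`. -/
def wObj (q : Z → Vec d → ℝ) (x : Fin n → Z) (w : Fin n → ℝ) (θ : Vec d) : ℝ :=
  (n : ℝ)⁻¹ * ∑ i, w i * q (x i) θ

/-- The weighted gradient `(1/n) ∑ wᵢ ∇q(zᵢ, θ)`. -/
def wGrad (q : Z → Vec d → ℝ) (x : Fin n → Z) (w : Fin n → ℝ) (θ : Vec d) : Vec d :=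
  (n : ℝ)⁻¹ • ∑ i, w i • gradient (q (x i)) θ

/-- The weighted Hessian `(1/n) ∑ wᵢ ∇²q(zᵢ, θ)`. -/
def wHess (q : Z → Vec d → ℝ) (x : Fin n → Z) (w : Fin n → ℝ) (θ : Vec d) :
    Matrix (Fin d) (Fin d) ℝ :=
  (n : ℝ)⁻¹ • ∑ i, w i • hess (q (x i)) θ

/-- The sample objective `Q_n` (all weights equal to one). -/
def sampleObj (q : Z → Vec d → ℝ) (x : Fin n → Z) (θ : Vec d) : ℝ := wObj q x (fun _ => 1) θ

/-- The sample gradient `G_n`. -/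
def sampleGrad (q : Z → Vec d → ℝ) (x : Fin n → Z) (θ : Vec d) : Vec d :=
  wGrad q x (fun _ => 1) θ

/-- The sample Hessian `H_n`. -/
def sampleHess (q : Z → Vec d → ℝ) (x : Fin n → Z) (θ : Vec d) : Matrix (Fin d) (Fin d) ℝ :=
  wHess q x (fun _ => 1) θ

end Objective

/-- The two ways of perturbing the objective: resampling `m` out of `n` observations with
replacement, or random reweighting with iid weights of law `ν`. -/
inductive Scheme where
  | resample : Scheme
  | reweight (ν : Measure ℝ) : Scheme

/-- Requirements on the scheme with batch size `m` and sample size `n`: reweighting uses `m = n`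
observations and weights with mean and variance one. -/
def Scheme.Valid : Scheme → ℕ → ℕ → Prop
  | .resample, m, n => m ≤ n
  | .reweight ν, m, n =>
      m = n ∧ IsProbabilityMeasure ν ∧ MemLp id 2 ν ∧ ∫ t, t ∂ν = 1 ∧ Var[id; ν] = 1

/-- The law of the weight vector of one iteration. For resampling, `I j` is the index of the
`j`-th of `m` independent uniform draws, and observation `i` receives the weight
`(n/m) #{j | I j = i}`, so that `(1/n) ∑ᵢ wᵢ q(zᵢ, θ) = (1/m) ∑ⱼ q(z_{I j}, θ)`. -/
def Scheme.law : Scheme → (m n : ℕ) → Measure (Fin n → ℝ)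
  | .resample, m, n =>
      (Measure.pi (fun _ : Fin m => uniformOn (Set.univ : Set (Fin n)))).map
        (fun I i => ((n : ℝ) / m) * ((Finset.univ.filter (fun j => I j = i)).card : ℝ))
  | .reweight ν, _, n => Measure.pi (fun _ : Fin n => ν)

/-- The randomness of the algorithm, conditional on a sample of size `n`: a probability measure
`ℙ⋆`, weights of the iterations `1, 2, …` with the given law, each drawn independently of the past,
an initial value, and conditioning matrices `P_b` which may depend on the initial value, on the
weights of the iterations `1, …, b + 1`, and on extra randomness that is independent of later
weights. -/
structure BootstrapRun (Ωs : Type*) [mΩ : MeasurableSpace Ωs] (d : ℕ) {n : ℕ}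
    (law : Measure (Fin n → ℝ)) where
  /-- the bootstrap probability, conditional on the sample -/
  Pstar : Measure Ωs
  isProb : IsProbabilityMeasure Pstar
  /-- `hist b` is the information available before the draw of iteration `b + 1` -/
  hist : Filtration ℕ mΩ
  /-- the weights of iteration `b` (used for `b ≥ 1`) -/
  w : ℕ → Ωs → Fin n → ℝ
  w_meas : ∀ b, Measurable[hist (b + 1)] (w (b + 1))
  w_law : ∀ b, Pstar.map (w (b + 1)) = law
  w_indep : ∀ b, Indep (MeasurableSpace.comap (w (b + 1)) inferInstance) (hist b) Pstar
  /-- the initial value `θ₀` -/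
  init : Ωs → Vec d
  init_meas : Measurable[hist 0] init
  /-- the conditioning matrices `P_b` -/
  cond : ℕ → Ωs → Matrix (Fin d) (Fin d) ℝ
  cond_meas : ∀ b i j, Measurable[hist (b + 1)] (fun ω => cond b ω i j)

/-- The iterates `θ_{b+1} = θ_b - γ P_b G_m^{(b+1)}(θ_b)`. -/
def BootstrapRun.iter {Ωs : Type*} [MeasurableSpace Ωs] {d n : ℕ} {law : Measure (Fin n → ℝ)}
    {Z : Type*} (R : BootstrapRun Ωs d law) (q : Z → Vec d → ℝ) (x : Fin n → Z) (γ : ℝ) :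
    ℕ → Ωs → Vec d
  | 0, ω => R.init ω
  | b + 1, ω =>
      R.iter q x γ b ω - γ • act (R.cond b ω) (wGrad q x (R.w (b + 1) ω) (R.iter q x γ b ω))

/-- The factor `φ(γ) = γ² / (1 - (1 - γ)²)`. -/
def phi (γ : ℝ) : ℝ := γ ^ 2 / (1 - (1 - γ) ^ 2)

/-- The `α`-th quantile of the real random variable `X` under `μ`. -/
def quantile {Ω : Type*} [MeasurableSpace Ω] (μ : Measure Ω) (X : Ω → ℝ) (α : ℝ) : ℝ :=
  sInf {t : ℝ | α ≤ μ.real {ω | X ω ≤ t}}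

/-- The objects of the problem. A sample of size `n` is a vector `x : Fin n → Z`. -/
structure Setting (d : ℕ) (Z Ωs : Type*) [MeasurableSpace Z] [MeasurableSpace Ωs] where
  /-- the parameter space -/
  Θ : Set (Vec d)
  /-- the contribution `q(z, θ)` of one observation to the objective -/
  q : Z → Vec d → ℝ
  /-- the law of the sample of size `n` -/
  P : (n : ℕ) → Measure (Fin n → Z)
  /-- the estimator computed from the sample of size `n` -/
  θhat : (n : ℕ) → (Fin n → Z) → Vec d
  /-- the true value -/
  θdag : Vec d
  /-- the learning rate -/
  γ : ℝ
  scheme : Scheme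
  /-- the batch size `m` for the sample size `n` -/
  m : ℕ → ℕ
  /-- the algorithm run on each sample -/
  run : (n : ℕ) → (Fin n → Z) → BootstrapRun Ωs d (scheme.law (m n) n)
  /-- the samples on which the conditions hold; their probability has to tend to one -/
  S : (n : ℕ) → Set (Fin n → Z)

namespace Setting

variable {d : ℕ} {Z Ωs : Type*} [MeasurableSpace Z] [MeasurableSpace Ωs] (M : Setting d Z Ωs)

/-- The bootstrap probability `ℙ⋆` given the sample `x`. -/
def Pstar {n : ℕ} (x : Fin n → Z) : Measure Ωs := (M.run n x).Pstar

/-- The draws `θ_b` given the sample `x`. -/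
def draw {n : ℕ} (x : Fin n → Z) (b : ℕ) (ω : Ωs) : Vec d := (M.run n x).iter M.q x M.γ b ω

/-- The perturbed gradient `G_m^{(b)}(θ)`. -/
def Gb {n : ℕ} (x : Fin n → Z) (b : ℕ) (ω : Ωs) (θ : Vec d) : Vec d :=
  wGrad M.q x ((M.run n x).w b ω) θ

/-- The perturbed Hessian `H_m^{(b)}(θ)`. -/
def Hb {n : ℕ} (x : Fin n → Z) (b : ℕ) (ω : Ωs) (θ : Vec d) : Matrix (Fin d) (Fin d) ℝ :=
  wHess M.q x ((M.run n x).w b ω) θ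

/-- `H_n(θ̂_n)`. -/
def Hhat {n : ℕ} (x : Fin n → Z) : Matrix (Fin d) (Fin d) ℝ := sampleHess M.q x (M.θhat n x)

/-- `Σ_n = m var⋆[G_m^{(b)}(θ̂_n)]`; the law of `G_m^{(b)}(θ̂_n)` is the same for all `b ≥ 1`. -/
def SigmaN {n : ℕ} (x : Fin n → Z) : Matrix (Fin d) (Fin d) ℝ :=
  Matrix.of fun i j => (M.m n : ℝ) *
    cov[fun ω => M.Gb x 1 ω (M.θhat n x) i, fun ω => M.Gb x 1 ω (M.θhat n x) j; M.Pstar x]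

/-- `V_n = H_n(θ̂_n)⁻¹ Σ_n H_n(θ̂_n)⁻¹`. -/
def VN {n : ℕ} (x : Fin n → Z) : Matrix (Fin d) (Fin d) ℝ :=
  (M.Hhat x)⁻¹ * M.SigmaN x * (M.Hhat x)⁻¹

/-- The adjusted draws `θ̃_b = θ̂_n + √(m / (n φ(γ))) (θ_b - θ̂_n)`. -/
def adjDraw {n : ℕ} (x : Fin n → Z) (b : ℕ) (ω : Ωs) : Vec d :=
  M.θhat n x + Real.sqrt ((M.m n : ℝ) / (n * phi M.γ)) • (M.draw x b ω - M.θhat n x)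

/-- `c_{h,b}(α)`: the `α`-th quantile of `h(θ̃_b) - h(θ̂_n)` under `ℙ⋆`. -/
def critValue (h : Vec d → ℝ) {n : ℕ} (x : Fin n → Z) (b : ℕ) (α : ℝ) : ℝ :=
  quantile (M.Pstar x) (fun ω => h (M.adjDraw x b ω) - h (M.θhat n x)) α

/-- The standing assumptions: compact convex parameter space, twice differentiable objective,
learning rate in `(0, 1]`, batch size `m ≤ n`; with probability tending to one, `θ̂_n` minimizes
`Q_n` over `Θ` and satisfies the first-order condition, and all draws lie in `Θ`. -/
structure Standing : Prop where
  compact : IsCompact M.Θ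
  convex : Convex ℝ M.Θ
  smooth : ∀ z, ∀ θ ∈ M.Θ, TwiceDifferentiableAt (M.q z) θ
  θdag_mem : M.θdag ∈ M.Θ
  γ_pos : 0 < M.γ
  γ_le : M.γ ≤ 1
  m_le : ∀ n, M.m n ≤ n
  scheme_valid : ∀ n, M.scheme.Valid (M.m n) n
  S_prob : Tendsto (fun n => M.P n (M.S n)ᶜ) atTop (𝓝 0)
  θhat_mem : ∀ n, ∀ x ∈ M.S n, M.θhat n x ∈ M.Θ
  θhat_min : ∀ n, ∀ x ∈ M.S n, IsMinOn (sampleObj M.q x) M.Θ (M.θhat n x)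
  θhat_foc : ∀ n, ∀ x ∈ M.S n, sampleGrad M.q x (M.θhat n x) = 0
  draw_mem : ∀ n, ∀ x ∈ M.S n, ∀ᵐ ω ∂(M.Pstar x), ∀ b, M.draw x b ω ∈ M.Θ

/-- The constants of the coupling conditions. -/
structure Consts where
  /-- lower bound for the eigenvalues of the Hessians -/
  lamH : ℝ
  /-- upper bound for the eigenvalues of the Hessians -/
  LamH : ℝ
  /-- lower bound for the eigenvalues of `P_b` -/
  lamP : ℝ
  /-- upper bound for the eigenvalues of `P_b` -/
  LamP : ℝ
  C1 : ℝ
  C2 : ℝ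
  C3 : ℝ
  C5 : ℝ
  ρ : ℝ

/-- `A(γ) = 1 - 2 γ λ_P λ_H + γ² (Λ_P Λ_H)²`. -/
def Consts.A (c : Consts) (γ : ℝ) : ℝ :=
  1 - 2 * γ * c.lamP * c.lamH + γ ^ 2 * (c.LamP * c.LamH) ^ 2

/-- Admissible constants: positive eigenvalue bounds, `ρ ∈ [0, 1)`, and `γ` such that
`A(γ) ∈ [0, 1)`. -/
structure Consts.Admissible (c : Consts) (γ : ℝ) : Prop where
  lamH_pos : 0 < c.lamH
  lamP_pos : 0 < c.lamP
  ρ_nonneg : 0 ≤ c.ρ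
  ρ_lt : c.ρ < 1
  A_nonneg : 0 ≤ c.A γ
  A_lt : c.A γ < 1

/-- The coupling conditions in `L_p`, for one sample `x` and a matrix `Pbar`. -/
structure CouplingAt (p : ℝ≥0∞) (c : Consts) {n : ℕ} (x : Fin n → Z)
    (Pbar : Matrix (Fin d) (Fin d) ℝ) : Prop where
  /-- bounds for the eigenvalues of `H_n` -/
  hess_bounds : ∀ θ ∈ M.Θ, EigBounds (sampleHess M.q x θ) c.lamH c.LamH
  /-- `H_n` is Lipschitz at `θ̂_n` -/
  hess_lip : ∀ θ ∈ M.Θ,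
    ‖op (sampleHess M.q x θ - M.Hhat x)‖ ≤ c.C1 * ‖θ - M.θhat n x‖
  /-- `[𝔼⋆ sup_θ ‖G_m^{(b)}(θ) - G_n(θ)‖^p]^{1/p} ≤ C₂ m^{-1/2}` -/
  grad_dev : ∀ b, 1 ≤ b →
    eLpNorm (fun ω => ⨆ θ ∈ M.Θ, ‖M.Gb x b ω θ - sampleGrad M.q x θ‖ₑ) p (M.Pstar x)
      ≤ ENNReal.ofReal (c.C2 / Real.sqrt (M.m n))
  /-- `[𝔼⋆ sup_θ ‖H_m^{(b)}(θ) - H_n(θ)‖₂^p]^{1/p} ≤ C₃ m^{-1/2}` -/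
  hess_dev : ∀ b, 1 ≤ b →
    eLpNorm (fun ω => ⨆ θ ∈ M.Θ, ‖op (M.Hb x b ω θ - sampleHess M.q x θ)‖ₑ) p (M.Pstar x)
      ≤ ENNReal.ofReal (c.C3 / Real.sqrt (M.m n))
  /-- bounds for the eigenvalues of `H_m^{(b)}` -/
  hess_star_bounds : ∀ b, 1 ≤ b → ∀ᵐ ω ∂(M.Pstar x),
    ∀ θ ∈ M.Θ, EigBounds (M.Hb x b ω θ) c.lamH c.LamH
  /-- bounds for the eigenvalues of the conditioning matrices -/
  cond_bounds : ∀ b, 1 ≤ b → ∀ᵐ ω ∂(M.Pstar x),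
    EigBounds ((M.run n x).cond b ω) c.lamP c.LamP
  pbar_posDef : Pbar.PosDef
  /-- `0 ≤ λ_max(Ψ_n) < 1` for `Ψ_n = I - γ Pbar H_n(θ̂_n)` -/
  psi : ∃ lam : ℝ, IsGreatest (spectrum ℝ (1 - M.γ • (Pbar * M.Hhat x))) lam ∧ 0 ≤ lam ∧ lam < 1
  /-- `[𝔼⋆ ‖I - P_b Pbar⁻¹‖₂^p]^{1/p} ≤ C₅ (ρ^b d_{0,n} + m^{-1/2})`,
  with `d_{0,n} = [𝔼⋆ ‖θ₀ - θ̂_n‖^p]^{1/p}` -/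
  cond_dev : ∀ b : ℕ,
    eLpNorm (fun ω => op (1 - (M.run n x).cond b ω * Pbar⁻¹)) p (M.Pstar x)
      ≤ ENNReal.ofReal (c.C5 *
          (c.ρ ^ b * (eLpNorm (fun ω => (M.run n x).init ω - M.θhat n x) p (M.Pstar x)).toReal
            + 1 / Real.sqrt (M.m n)))

/-- The coupling conditions in `L_p` with the matrices `Pbar`: they hold, with constants that do not
depend on `n`, `m`, `b` or the sample, for the samples in `S n`. -/
def CouplingConditions (p : ℝ≥0∞)
    (Pbar : (n : ℕ) → (Fin n → Z) → Matrix (Fin d) (Fin d) ℝ) : Prop :=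
  ∃ c : Consts, c.Admissible M.γ ∧ ∀ n, ∀ x ∈ M.S n, M.CouplingAt p c x (Pbar n x)

/-- `Σ_n` is bounded and non-singular: its eigenvalues are bounded and bounded away from zero. -/
def SigmaRegular : Prop :=
  ∃ l L : ℝ, 0 < l ∧ ∀ n, ∀ x ∈ M.S n, EigBounds (M.SigmaN x) l L

/-- The expansion of the characteristic function of `√m V_n^{-1/2} H_n(θ̂_n)⁻¹ G_m^{(b)}(θ̂_n)`
under `ℙ⋆`: it equals `exp(-‖τ‖²/2) (1 + r_m(τ) / m^β)` with `‖r_m(τ)‖ ≤ C ‖τ‖^κ`, for `τ` in a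
bounded set and all large `n`. -/
def CharFunExpansion : Prop :=
  ∃ β κ C : ℝ, 0 < β ∧ β ≤ 1 / 2 ∧ 0 < κ ∧
    ∀ T : ℝ, ∀ᶠ n in atTop, ∀ x ∈ M.S n, ∀ b, 1 ≤ b → ∃ r : Vec d → ℂ,
      ∀ τ : Vec d, ‖τ‖ ≤ T → ‖r τ‖ ≤ C * ‖τ‖ ^ κ ∧
        ∫ ω, Complex.exp (Complex.I * ((Real.sqrt (M.m n) *
            inner ℝ τ (act ((CFC.sqrt (M.VN x))⁻¹ * (M.Hhat x)⁻¹)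
              (M.Gb x b ω (M.θhat n x))) : ℝ) : ℂ)) ∂(M.Pstar x)
          = (Real.exp (-‖τ‖ ^ 2 / 2) : ℂ) * (1 + r τ / (((M.m n : ℝ) ^ β : ℝ) : ℂ))

/-- Asymptotic normality, `V_n → V` in probability and `√n (θ̂_n - θ†) → N(0, V)` in distribution,
together with the smoothness of `h` needed for the delta method. -/
structure NormalDelta [∀ n, IsProbabilityMeasure (M.P n)] (V : Matrix (Fin d) (Fin d) ℝ)
    (h : Vec d → ℝ) : Prop where
  VN_tendsto : ∀ i j, ∀ ε : ℝ, 0 < ε →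
    Tendsto (fun n => M.P n {x | ε ≤ |M.VN x i j - V i j|}) atTop (𝓝 0)
  clt : TendstoInDistribution
    (fun (n : ℕ) (x : Fin n → Z) => Real.sqrt n • (M.θhat n x - M.θdag)) atTop
    (id : Vec d → Vec d) M.P (multivariateGaussian 0 V)
  h_meas : Measurable h
  h_C1 : ∀ θ ∈ M.Θ, ContDiffAt ℝ 1 h θ
  h_lip : ∃ K : NNReal, LipschitzOnWith K (gradient h) M.Θ
  h_grad : gradient h M.θdag ≠ 0

end Setting

end ResampledOpt

end

/-!
Write `Y_b = θ_b - θ̂_n` and `H = H_n(θ̂_n)`. The proof compares the algorithm with the linear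
process `u_{b+1} = (1 - γ) u_b - γ H⁻¹ G_m^{(b+1)}(θ̂_n)`, `u_0 = 0` (`Setting.lin`), which is what the
algorithm becomes when the conditioning matrix is `H⁻¹` and the objective is quadratic.

*The algorithm.* Linearize the perturbed gradient between `θ̂_n` and `θ_b`. With conditioning matrix
`H⁻¹`, one step contracts the norm `‖H^{1/2} y‖`, because `A(γ) < 1` and because `H⁻¹`, which the
matrices `P_b` approach, inherits their upper eigenvalue bound (`exists_contraction`). Replacing `H⁻¹`
by `P_b` costs `‖I - P_b H‖` times a distance in the bounded set `Θ`, and the noise at `θ̂_n` is of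
order `m^{-1/2}`; hence `Y_b` is of order `r^b + m^{-1/2}` in `L_p`
(`exists_eLpNorm_draw_sub_le`). In `Y_b - u_b` only products of two such small terms are left, and
Hölder's inequality makes it of order `r^b + m^{-1}` in `L_{p/2}`
(`exists_eLpNorm_draw_sub_lin_le`). As `log m = o(b)`, the geometric terms vanish even after
multiplication by `√m`.

*The linear process.* Its innovations are independent and identically distributed, so its variance is
explicit (`CouplingAt.variance_inner_lin`): `φ(γ) V_n / m` up to the factor `1 - (1 - γ)^{2b}`. Its
characteristic function is a product of those of the innovations; multiplying the expansions of the
factors gives a Gaussian limit (`exists_charFun_inner_lin_expansion`, `tendsto_charFun_lin`).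

*Coverage.* By the delta method, `√n (h(θ̃_b) - h(θ̂_n))` under the bootstrap and
`√n (h(θ†) - h(θ̂_n))` under sampling both converge to the centred normal law with variance
`∇h(θ†) V ∇h(θ†)'` (`tendsto_bootstrap_real_le`, `NormalDelta.tendsto_real_le`). Its distribution
function is continuous and strictly increasing, so the bootstrap quantiles converge in probability to
its quantiles, and the coverage probability converges to the mass between them
(`tendsto_coverage`). Bootstrap statements hold along a filter on pairs of a sample size and a
sample; "in probability" is convergence along `Setting.whpFilter`. No measurability in the sample of
`V_n` or of the critical values is needed, since only outer measures of exceptional sets occur.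

*Variance.* A second-order Taylor bound gives `h(θ_b) - h(θ̂_n) = ∇h(θ̂_n) u_b` up to an error of order
`r^b + m^{-1}` in `L_2`, by the `L_4` bounds; the variance of the right-hand side is known
(`eventually_abs_variance_sub_quad_le`).
-/

namespace ResampledOpt

/-! ### Symmetric matrices with bounded eigenvalues -/

section Linear

variable {d : ℕ} {A B : Matrix (Fin d) (Fin d) ℝ} {l L : ℝ}

lemma act_eq_op (A : Matrix (Fin d) (Fin d) ℝ) (v : Vec d) : act A v = op A v := rfl

lemma act_add (A : Matrix (Fin d) (Fin d) ℝ) (u v : Vec d) : act A (u + v) = act A u + act A v :=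
  map_add (op A) u v

lemma act_sub (A : Matrix (Fin d) (Fin d) ℝ) (u v : Vec d) : act A (u - v) = act A u - act A v :=
  map_sub (op A) u v

lemma act_smul (A : Matrix (Fin d) (Fin d) ℝ) (c : ℝ) (v : Vec d) : act A (c • v) = c • act A v :=
  map_smul (op A) c v

lemma act_mul (A B : Matrix (Fin d) (Fin d) ℝ) (v : Vec d) : act (A * B) v = act A (act B v) := by
  simp [act]

lemma act_one (v : Vec d) : act (1 : Matrix (Fin d) (Fin d) ℝ) v = v := by simp [act]

lemma sub_act (A B : Matrix (Fin d) (Fin d) ℝ) (v : Vec d) :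
    act (A - B) v = act A v - act B v := by simp [act]

lemma norm_act_le (A : Matrix (Fin d) (Fin d) ℝ) (v : Vec d) : ‖act A v‖ ≤ ‖op A‖ * ‖v‖ :=
  (op A).le_opNorm v

lemma inner_act (A : Matrix (Fin d) (Fin d) ℝ) (hA : A.IsSymm) (u v : Vec d) :
    inner ℝ u (act A v) = inner ℝ (act A u) v := by
  have h : star (op A) = op A := by
    rw [op, ← map_star]
    exact congrArg _ ((Matrix.conjTranspose_eq_transpose_of_trivial A).trans hA)
  rw [ContinuousLinearMap.star_eq_adjoint] at h
  conv_rhs => rw [act_eq_op, ← h, ContinuousLinearMap.adjoint_inner_left]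
  rfl

lemma quad_sub_smul (hA : A.IsSymm) (u w : Vec d) (t : ℝ) :
    quad A (u - t • w) = quad A u - 2 * t * inner ℝ (act A u) w + t ^ 2 * quad A w := by
  have h1 : inner ℝ w (act A u) = inner ℝ (act A u) w := real_inner_comm _ _
  simp only [quad, act_sub, act_smul, inner_sub_left, inner_sub_right, inner_smul_left,
    inner_smul_right, inner_act A hA u w, h1]
  simp
  ring

lemma EigBounds.quad_nonneg (h : EigBounds A l L) (hl : 0 < l) (u : Vec d) : 0 ≤ quad A u :=
  le_trans (by positivity) (h.2 u).1

lemma EigBounds.norm_act_sq_le (h : EigBounds A l L) (hl : 0 < l) (hL : 0 < L) (u : Vec d) :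
    ‖act A u‖ ^ 2 ≤ L * quad A u := by
  have h0 := h.quad_nonneg hl (u - L⁻¹ • act A u)
  rw [quad_sub_smul h.1, real_inner_self_eq_norm_sq] at h0
  have h1 := (h.2 (act A u)).2
  have h2 : (L⁻¹) ^ 2 * quad A (act A u) ≤ L⁻¹ * ‖act A u‖ ^ 2 := by
    calc (L⁻¹) ^ 2 * quad A (act A u) ≤ (L⁻¹) ^ 2 * (L * ‖act A u‖ ^ 2) := by gcongr
      _ = _ := by field_simp
  have h3 : L⁻¹ * ‖act A u‖ ^ 2 ≤ quad A u := by linarith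
  calc ‖act A u‖ ^ 2 = L * (L⁻¹ * ‖act A u‖ ^ 2) := by field_simp
    _ ≤ _ := by gcongr

lemma EigBounds.norm_act_le (h : EigBounds A l L) (hl : 0 < l) (hL : 0 < L) (u : Vec d) :
    ‖act A u‖ ≤ L * ‖u‖ := by
  refine le_of_sq_le_sq ?_ (by positivity)
  calc ‖act A u‖ ^ 2 ≤ L * quad A u := h.norm_act_sq_le hl hL u
    _ ≤ L * (L * ‖u‖ ^ 2) := by gcongr; exact (h.2 u).2
    _ = _ := by ring

lemma EigBounds.le_norm_act (h : EigBounds A l L) (u : Vec d) :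
    l * ‖u‖ ≤ ‖act A u‖ := by
  rcases eq_or_ne u 0 with rfl | hu
  · simp
  have hu' : 0 < ‖u‖ := norm_pos_iff.2 hu
  have h1 : quad A u ≤ ‖u‖ * ‖act A u‖ := real_inner_le_norm _ _
  have h2 := (h.2 u).1
  have : ‖u‖ * (l * ‖u‖) ≤ ‖u‖ * ‖act A u‖ := by nlinarith
  exact le_of_mul_le_mul_left this hu'

lemma EigBounds.isUnit_det (h : EigBounds A l L) (hl : 0 < l) : IsUnit A.det := by
  rw [isUnit_iff_ne_zero]
  intro h0
  obtain ⟨v, hv, hv0⟩ := Matrix.exists_mulVec_eq_zero_iff.2 h0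
  have h1 := h.le_norm_act (WithLp.toLp 2 v)
  have h2 : act A (WithLp.toLp 2 v) = 0 := by
    rw [act, Matrix.toEuclideanCLM_toLp, hv0]; rfl
  rw [h2, norm_zero] at h1
  have h3 : ‖WithLp.toLp 2 v‖ ≤ 0 := by nlinarith [norm_nonneg (WithLp.toLp 2 v)]
  exact hv (by simpa using h3)

lemma EigBounds.act_act_inv (h : EigBounds A l L) (hl : 0 < l) (v : Vec d) :
    act A (act A⁻¹ v) = v := by
  rw [← act_mul, Matrix.mul_nonsing_inv _ (h.isUnit_det hl), act_one]

lemma EigBounds.isSymm_inv (h : EigBounds A l L) : A⁻¹.IsSymm := by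
  rw [Matrix.IsSymm, Matrix.transpose_nonsing_inv, h.1.eq]

lemma EigBounds.norm_act_inv_le (h : EigBounds A l L) (hl : 0 < l) (v : Vec d) :
    ‖act A⁻¹ v‖ ≤ l⁻¹ * ‖v‖ := by
  have := h.le_norm_act (act A⁻¹ v)
  rw [h.act_act_inv hl] at this
  rw [inv_mul_eq_div, le_div_iff₀ hl]
  linarith

lemma EigBounds.le_norm_act_inv (h : EigBounds A l L) (hl : 0 < l) (hL : 0 < L) (v : Vec d) :
    L⁻¹ * ‖v‖ ≤ ‖act A⁻¹ v‖ := by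
  have := h.norm_act_le hl hL (act A⁻¹ v)
  rw [h.act_act_inv hl] at this
  rw [inv_mul_eq_div, div_le_iff₀ hL]
  linarith

lemma EigBounds.lower_le_upper (h : EigBounds A l L) (hd : 0 < d) : l ≤ L := by
  let u : Vec d := EuclideanSpace.single ⟨0, hd⟩ 1
  have hu : ‖u‖ = 1 := by simp [u]
  have := h.2 u
  rw [hu] at this
  linarith [this.1.trans this.2]

lemma posSemidef_of_quad (hA : A.IsSymm) (h : ∀ u : Vec d, 0 ≤ quad A u) : A.PosSemidef := by
  rw [Matrix.posSemidef_iff_dotProduct_mulVec]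
  refine ⟨?_, fun x => ?_⟩
  · rw [Matrix.IsHermitian, Matrix.conjTranspose_eq_transpose_of_trivial]; exact hA
  · have := h (WithLp.toLp 2 x)
    rw [quad, act, Matrix.inner_toEuclideanCLM] at this
    simpa using this

lemma isSymm_sqrt (A : Matrix (Fin d) (Fin d) ℝ) : (CFC.sqrt A).IsSymm := by
  have h : 0 ≤ CFC.sqrt A := CFC.sqrt_nonneg A
  have h2 := (Matrix.nonneg_iff_posSemidef.1 h).1
  rw [Matrix.IsHermitian, Matrix.conjTranspose_eq_transpose_of_trivial] at h2
  exact h2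

lemma EigBounds.nonneg (h : EigBounds A l L) (hl : 0 < l) : 0 ≤ A :=
  Matrix.nonneg_iff_posSemidef.2 (posSemidef_of_quad h.1 (h.quad_nonneg hl))

lemma act_sqrt_act_sqrt (hA : 0 ≤ A) (v : Vec d) :
    act (CFC.sqrt A) (act (CFC.sqrt A) v) = act A v := by
  rw [← act_mul, CFC.sqrt_mul_sqrt_self A hA]

lemma norm_act_sqrt_sq (hA : 0 ≤ A) (v : Vec d) : ‖act (CFC.sqrt A) v‖ ^ 2 = quad A v := by
  rw [← real_inner_self_eq_norm_sq, ← inner_act _ (isSymm_sqrt A), act_sqrt_act_sqrt hA, quad]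

/-- In the norm `u ↦ ‖H^{1/2} u‖`, a Newton-type step `I - γ H⁻¹ A` with damping `γ` contracts, as
soon as `H⁻¹ ≤ κ` with `γ κ L < 2`. Here `A` may be any other symmetric matrix with the same
eigenvalue bounds; it need not commute with `H`. -/
lemma norm_sqrt_newton_step_le {H : Matrix (Fin d) (Fin d) ℝ} (hH : EigBounds H l L)
    (hA : EigBounds A l L) (hl : 0 < l) (hL : 0 < L) {γ κ a : ℝ} (hγ : 0 < γ)
    (hκ : ∀ u : Vec d, quad H⁻¹ u ≤ κ * ‖u‖ ^ 2) (hγκ : γ * (κ * L) < 2) (ha : 0 ≤ a)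
    (hκ0 : 0 ≤ κ) (ha2 : 1 - γ * (2 - γ * (κ * L)) * (l / L) ≤ a ^ 2) (y : Vec d) :
    ‖act (CFC.sqrt H) (y - γ • act H⁻¹ (act A y))‖ ≤ a * ‖act (CFC.sqrt H) y‖ := by
  refine le_of_sq_le_sq ?_ (by positivity)
  have h1 : inner ℝ (act H y) (act H⁻¹ (act A y)) = quad A y := by
    rw [← inner_act _ hH.1, hH.act_act_inv hl, quad]
  have h2 : quad H (act H⁻¹ (act A y)) = quad H⁻¹ (act A y) := by
    rw [quad, hH.act_act_inv hl, quad, real_inner_comm]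
  have h3 : quad H⁻¹ (act A y) ≤ κ * (L * quad A y) :=
    (hκ _).trans (by gcongr; exact hA.norm_act_sq_le hl hL y)
  have h4 : l / L * quad H y ≤ quad A y := by
    calc l / L * quad H y ≤ l / L * (L * ‖y‖ ^ 2) := by gcongr; exact (hH.2 y).2
      _ = l * ‖y‖ ^ 2 := by field_simp
      _ ≤ _ := (hA.2 y).1
  have h0 := hH.quad_nonneg hl y
  rw [mul_pow, norm_act_sqrt_sq (hH.nonneg hl), norm_act_sqrt_sq (hH.nonneg hl),
    quad_sub_smul hH.1, h1, h2]
  calc quad H y - 2 * γ * quad A y + γ ^ 2 * quad H⁻¹ (act A y)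
      ≤ quad H y - 2 * γ * quad A y + γ ^ 2 * (κ * (L * quad A y)) := by gcongr
    _ = quad H y - γ * (2 - γ * (κ * L)) * quad A y := by ring
    _ ≤ quad H y - γ * (2 - γ * (κ * L)) * (l / L * quad H y) := by
        have : 0 ≤ γ * (2 - γ * (κ * L)) := mul_nonneg hγ.le (by linarith)
        gcongr
    _ = (1 - γ * (2 - γ * (κ * L)) * (l / L)) * quad H y := by ring
    _ ≤ _ := by gcongr

/-- If some well-conditioned `P` is close to `H⁻¹` in the sense that `I - P H` is small, then `H⁻¹`
inherits the upper eigenvalue bound of `P`, up to a small error. -/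
lemma quad_inv_le_of_near {H P : Matrix (Fin d) (Fin d) ℝ} (hH : EigBounds H l L) (hl : 0 < l)
    {lP LP δ : ℝ} (hP : EigBounds P lP LP) (hδ : ‖op (1 - P * H)‖ ≤ δ) (u : Vec d) :
    quad H⁻¹ u ≤ (LP + δ / l) * ‖u‖ ^ 2 := by
  have h1 : act H⁻¹ u = act P u + act (1 - P * H) (act H⁻¹ u) := by
    rw [sub_act, act_one, act_mul, hH.act_act_inv hl]; abel
  have h2 : inner ℝ u (act (1 - P * H) (act H⁻¹ u)) ≤ δ / l * ‖u‖ ^ 2 := by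
    calc inner ℝ u (act (1 - P * H) (act H⁻¹ u))
        ≤ ‖u‖ * ‖act (1 - P * H) (act H⁻¹ u)‖ := real_inner_le_norm _ _
      _ ≤ ‖u‖ * (δ * (l⁻¹ * ‖u‖)) := by
          gcongr
          exact (ResampledOpt.norm_act_le _ _).trans
            (mul_le_mul hδ (hH.norm_act_inv_le hl u) (norm_nonneg _) ((norm_nonneg _).trans hδ))
      _ = _ := by ring
  rw [quad, h1, inner_add_right]
  have := (hP.2 u).2
  rw [quad] at this
  linarith

end Linear

/-! ### A mean value inequality -/

/-- Mean value inequality in terms of the derivative along the segment only, so that it can be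
used in norms other than the one of the space. -/
lemma norm_sub_le_of_fderiv_segment {E F : Type*} [NormedAddCommGroup E] [NormedSpace ℝ E]
    [NormedAddCommGroup F] [NormedSpace ℝ F] {s : Set E} (hs : Convex ℝ s) {f : E → F}
    {f' : E → E →L[ℝ] F} (hf : ∀ z ∈ s, HasFDerivAt f (f' z) z) {x y : E} (hx : x ∈ s) (hy : y ∈ s)
    {B : ℝ} (hB : ∀ z ∈ segment ℝ x y, ‖f' z (y - x)‖ ≤ B) : ‖f y - f x‖ ≤ B := by
  have hseg : ∀ t ∈ Set.Icc (0 : ℝ) 1, x + t • (y - x) ∈ segment ℝ x y := fun t ht => by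
    rw [segment_eq_image']; exact ⟨t, ht, rfl⟩
  have hsub : segment ℝ x y ⊆ s := hs.segment_subset hx hy
  have hd : ∀ t ∈ Set.Icc (0 : ℝ) 1, HasDerivWithinAt (fun t : ℝ => f (x + t • (y - x)))
      (f' (x + t • (y - x)) (y - x)) (Set.Icc 0 1) t := fun t ht => by
    have h1 : HasDerivAt (fun t : ℝ => x + t • (y - x)) (y - x) t := by
      simpa using ((hasDerivAt_id t).smul_const (y - x)).const_add x
    exact ((hf _ (hsub (hseg t ht))).comp_hasDerivAt t h1).hasDerivWithinAt
  have := norm_image_sub_le_of_norm_deriv_le_segment_01' hd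
    (fun t ht => hB _ (hseg t ⟨ht.1, ht.2.le⟩))
  simpa using this

/-! ### One step of the algorithm -/

section Step

variable {d n : ℕ} {Z : Type*} {q : Z → Vec d → ℝ} {x : Fin n → Z}

lemma hasFDerivAt_wGrad {θ : Vec d} (h : ∀ i, TwiceDifferentiableAt (q (x i)) θ) (w : Fin n → ℝ) :
    HasFDerivAt (wGrad q x w) (op (wHess q x w θ)) θ := by
  have h1 : op (wHess q x w θ)
      = (n : ℝ)⁻¹ • ∑ i, w i • fderiv ℝ (gradient (q (x i))) θ := by
    simp [op, wHess, hess, map_sum]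
  rw [h1]
  have h2 : ∀ i ∈ Finset.univ, HasFDerivAt (fun z => w i • gradient (q (x i)) z)
      (w i • fderiv ℝ (gradient (q (x i))) θ) θ :=
    fun i _ => ((h i).2.hasFDerivAt).const_smul (w i)
  exact (HasFDerivAt.fun_sum h2).const_smul (n : ℝ)⁻¹

/-- How one step moves the error, measured in the norm `u ↦ ‖H^{1/2} u‖`. The contraction comes
from the idealized step with `P = H⁻¹`; the mismatch `I - P H` and the gradient noise at the
minimizer enter additively. -/
lemma norm_sqrt_step_le {s : Set (Vec d)} (hs : Convex ℝ s)
    {G : Vec d → Vec d} {A : Vec d → Matrix (Fin d) (Fin d) ℝ}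
    (hG : ∀ z ∈ s, HasFDerivAt G (op (A z)) z) {l L lP LP : ℝ} (hl : 0 < l) (hL : 0 < L)
    (hlP : 0 < lP) (hLP : 0 < LP) (hA : ∀ z ∈ s, EigBounds (A z) l L)
    {H P : Matrix (Fin d) (Fin d) ℝ} (hH : EigBounds H l L) (hP : EigBounds P lP LP)
    {γ a : ℝ} (hγ : 0 < γ)
    (hstep : ∀ B, EigBounds B l L → ∀ y : Vec d,
      ‖act (CFC.sqrt H) (y - γ • act H⁻¹ (act B y))‖ ≤ a * ‖act (CFC.sqrt H) y‖)
    {θ η : Vec d} (hθ : θ ∈ s) (hη : η ∈ s) :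
    ‖act (CFC.sqrt H) (θ - γ • act P (G θ) - η)‖ ≤ a * ‖act (CFC.sqrt H) (θ - η)‖
      + (γ * √L * (L / l) * ‖θ - η‖ * ‖op (1 - P * H)‖ + γ * √L * LP * ‖G η‖) := by
  have hS : ∀ v : Vec d, ‖act (CFC.sqrt H) v‖ ≤ √L * ‖v‖ := fun v => by
    refine le_of_sq_le_sq ?_ (by positivity)
    rw [norm_act_sqrt_sq (hH.nonneg hl), mul_pow, Real.sq_sqrt hL.le]
    exact (hH.2 v).2
  have h1 : ‖G θ - G η‖ ≤ L * ‖θ - η‖ := by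
    refine norm_sub_le_of_fderiv_segment hs hG hη hθ fun z hz => ?_
    exact (hA z (hs.segment_subset hη hθ hz)).norm_act_le hl hL _
  have h2 : ‖act (CFC.sqrt H) ((θ - η) - γ • act H⁻¹ (G θ - G η))‖
      ≤ a * ‖act (CFC.sqrt H) (θ - η)‖ := by
    have hF : ∀ z ∈ s, HasFDerivAt (fun z => op (CFC.sqrt H) (z - γ • op H⁻¹ (G z)))
        ((op (CFC.sqrt H)).comp (ContinuousLinearMap.id ℝ _ - γ • (op H⁻¹).comp (op (A z)))) z :=
      fun z hz => (op (CFC.sqrt H)).hasFDerivAt.comp z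
        ((hasFDerivAt_id z).sub (((op H⁻¹).hasFDerivAt.comp z (hG z hz)).const_smul γ))
    have := norm_sub_le_of_fderiv_segment hs hF hη hθ
      (B := a * ‖act (CFC.sqrt H) (θ - η)‖) fun z hz =>
        hstep (A z) (hA z (hs.segment_subset hη hθ hz)) (θ - η)
    refine le_trans (le_of_eq ?_) this
    rw [← map_sub, act_eq_op, act_eq_op, map_sub (op H⁻¹), smul_sub]
    congr 2
    abel
  have h3 : θ - γ • act P (G θ) - η = ((θ - η) - γ • act H⁻¹ (G θ - G η))
      + γ • act (1 - P * H) (act H⁻¹ (G θ - G η)) - γ • act P (G η) := by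
    rw [sub_act, act_one, act_mul, hH.act_act_inv hl, act_sub P, smul_sub, smul_sub]; abel
  rw [h3, act_sub, act_add]
  have h4 : ‖act (CFC.sqrt H) (γ • act (1 - P * H) (act H⁻¹ (G θ - G η)))‖
      ≤ γ * √L * (L / l) * ‖θ - η‖ * ‖op (1 - P * H)‖ := by
    calc _ ≤ √L * ‖γ • act (1 - P * H) (act H⁻¹ (G θ - G η))‖ := hS _
      _ = √L * (γ * ‖act (1 - P * H) (act H⁻¹ (G θ - G η))‖) := by
          rw [norm_smul, Real.norm_of_nonneg hγ.le]
      _ ≤ √L * (γ * (‖op (1 - P * H)‖ * (l⁻¹ * (L * ‖θ - η‖)))) := by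
          gcongr
          refine (norm_act_le _ _).trans ?_
          gcongr
          refine (hH.norm_act_inv_le hl _).trans ?_
          gcongr
      _ = _ := by ring
  have h5 : ‖act (CFC.sqrt H) (γ • act P (G η))‖ ≤ γ * √L * LP * ‖G η‖ := by
    calc _ ≤ √L * ‖γ • act P (G η)‖ := hS _
      _ = √L * (γ * ‖act P (G η)‖) := by rw [norm_smul, Real.norm_of_nonneg hγ.le]
      _ ≤ √L * (γ * (LP * ‖G η‖)) := by gcongr; exact hP.norm_act_le hlP hLP _
      _ = _ := by ring
  calc _ ≤ _ := norm_sub_le _ _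
    _ ≤ _ := add_le_add (norm_add_le _ _) le_rfl
    _ ≤ _ := by linarith

/-- How one step moves the distance between the error `θ - η` and its linear approximation `u`:
all terms that do not contract are products of two small quantities. -/
lemma norm_linearization_step_le {s : Set (Vec d)} (hs : Convex ℝ s)
    {G : Vec d → Vec d} {A A₀ : Vec d → Matrix (Fin d) (Fin d) ℝ}
    (hG : ∀ z ∈ s, HasFDerivAt G (op (A z)) z) {l L lP LP C σ : ℝ} (hl : 0 < l)
    (hlP : 0 < lP) (hLP : 0 < LP) (hC : 0 ≤ C)
    {H P : Matrix (Fin d) (Fin d) ℝ} (hH : EigBounds H l L) (hP : EigBounds P lP LP)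
    {γ : ℝ} (hγ : 0 < γ) (hγ1 : γ ≤ 1) {θ η : Vec d} (hθ : θ ∈ s) (hη : η ∈ s)
    (hσ : ∀ z ∈ s, ‖op (A z - A₀ z)‖ ≤ σ) (hlip : ∀ z ∈ s, ‖op (A₀ z - H)‖ ≤ C * ‖z - η‖)
    (u : Vec d) :
    ‖θ - γ • act P (G θ) - η - ((1 - γ) • u - γ • act H⁻¹ (G η))‖ ≤ (1 - γ) * ‖θ - η - u‖
      + (γ * (‖op (1 - P * H)‖ * (l⁻¹ * ‖G η‖ + ‖θ - η‖))
        + γ * LP * ((σ + C * ‖θ - η‖) * ‖θ - η‖)) := by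
  have h1 : ‖G θ - G η - act H (θ - η)‖ ≤ (σ + C * ‖θ - η‖) * ‖θ - η‖ := by
    have hF : ∀ z ∈ s, HasFDerivAt (fun z => G z - op H z) (op (A z) - op H) z :=
      fun z hz => (hG z hz).sub (op H).hasFDerivAt
    have := norm_sub_le_of_fderiv_segment hs hF hη hθ
      (B := (σ + C * ‖θ - η‖) * ‖θ - η‖) fun z hz => by
        have hzs := hs.segment_subset hη hθ hz
        have e : op (A z) - op H = op (A z - A₀ z) + op (A₀ z - H) := by
          simp [op]
        have hz' : ‖z - η‖ ≤ ‖θ - η‖ := by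
          obtain ⟨t, ht, rfl⟩ := (segment_eq_image' ℝ η θ) ▸ hz
          rw [add_sub_cancel_left, norm_smul, Real.norm_of_nonneg ht.1]
          exact mul_le_of_le_one_left (norm_nonneg _) ht.2
        refine (ContinuousLinearMap.le_opNorm _ _).trans ?_
        gcongr
        rw [e]
        refine (norm_add_le _ _).trans (add_le_add (hσ z hzs) ((hlip z hzs).trans ?_))
        gcongr
    refine le_trans (le_of_eq ?_) this
    rw [act_sub, act_eq_op, act_eq_op]
    congr 1; abel
  set e := G θ - G η - act H (θ - η) with he
  have h2 : θ - γ • act P (G θ) - η - ((1 - γ) • u - γ • act H⁻¹ (G η))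
      = (1 - γ) • (θ - η - u)
        + γ • act (1 - P * H) (act H⁻¹ (G η) + (θ - η)) - γ • act P e := by
    have h3 : G θ = G η + act H (θ - η) + e := by rw [he]; abel
    rw [h3, sub_act, act_one, act_mul, act_add H, hH.act_act_inv hl, act_add P, act_add P]
    module
  rw [h2]
  have h4 : ‖act (1 - P * H) (act H⁻¹ (G η) + (θ - η))‖
      ≤ ‖op (1 - P * H)‖ * (l⁻¹ * ‖G η‖ + ‖θ - η‖) := by
    refine (norm_act_le _ _).trans ?_
    gcongr
    exact (norm_add_le _ _).trans (add_le_add (hH.norm_act_inv_le hl _) le_rfl)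
  have h5 : ‖act P e‖ ≤ LP * ((σ + C * ‖θ - η‖) * ‖θ - η‖) :=
    (hP.norm_act_le hlP hLP _).trans (by gcongr)
  refine (norm_sub_le _ _).trans ((add_le_add (norm_add_le _ _) le_rfl).trans ?_)
  rw [norm_smul, norm_smul, norm_smul, Real.norm_of_nonneg hγ.le,
    Real.norm_of_nonneg (sub_nonneg.2 hγ1)]
  have h6 := mul_le_mul_of_nonneg_left h4 hγ.le
  have h7 := mul_le_mul_of_nonneg_left h5 hγ.le
  linarith

end Step

/-! ### Measurability -/

section Measurability

variable {Ω : Type*} {d n : ℕ} {Z : Type*} {q : Z → Vec d → ℝ} {x : Fin n → Z}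

lemma measurable_gradient (f : Vec d → ℝ) : Measurable (gradient f) :=
  ((InnerProductSpace.toDual ℝ (Vec d)).symm.continuous.measurable).comp (measurable_fderiv ℝ f)

lemma measurable_wGrad {m : MeasurableSpace Ω} {w : Ω → Fin n → ℝ} {θ : Ω → Vec d}
    (hw : Measurable w) (hθ : Measurable θ) : Measurable fun ω => wGrad q x (w ω) (θ ω) := by
  unfold wGrad
  have h : ∀ i ∈ Finset.univ, Measurable fun ω => w ω i • gradient (q (x i)) (θ ω) := fun i _ =>
    ((measurable_pi_apply i).comp hw).smul ((measurable_gradient _).comp hθ)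
  exact (Finset.measurable_fun_sum _ h).const_smul (n : ℝ)⁻¹

lemma measurable_act {m : MeasurableSpace Ω} {A : Ω → Matrix (Fin d) (Fin d) ℝ} {v : Ω → Vec d}
    (hA : ∀ i j, Measurable fun ω => A ω i j) (hv : Measurable v) :
    Measurable fun ω => act (A ω) (v ω) := by
  have : (fun ω => act (A ω) (v ω)) = fun ω => WithLp.toLp 2 (fun i => ∑ j, A ω i j * v ω j) := by
    ext ω i
    rfl
  rw [this]
  refine (WithLp.measurable_toLp 2 _).comp (measurable_pi_lambda _ fun i => ?_)
  exact Finset.measurable_fun_sum _ fun j _ => (hA i j).mul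
    ((measurable_pi_apply j).comp ((WithLp.measurable_ofLp 2 _).comp hv))

lemma measurable_op {m : MeasurableSpace Ω} {A : Ω → Matrix (Fin d) (Fin d) ℝ}
    (hA : ∀ i j, Measurable fun ω => A ω i j) : Measurable fun ω => op (A ω) := by
  have : (fun ω => op (A ω)) = fun ω => ∑ i, ∑ j, A ω i j • op (Matrix.single i j (1 : ℝ)) := by
    ext1 ω
    conv_lhs => rw [Matrix.matrix_eq_sum_single (A ω)]
    simp only [op, map_sum]
    refine Finset.sum_congr rfl fun i _ => Finset.sum_congr rfl fun j _ => ?_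
    rw [← map_smul, Matrix.smul_single, smul_eq_mul, mul_one]
  rw [this]
  exact Finset.measurable_fun_sum _ fun i _ => Finset.measurable_fun_sum _ fun j _ =>
    (hA i j).smul_const _

lemma BootstrapRun.measurable_iter {Ωs : Type*} [mΩ : MeasurableSpace Ωs]
    {law : Measure (Fin n → ℝ)} (R : BootstrapRun Ωs d law) (γ : ℝ) (b : ℕ) :
    Measurable[R.hist b] (R.iter q x γ b) := by
  induction b with
  | zero => exact R.init_meas
  | succ b ih =>
    have ih' : Measurable[R.hist (b + 1)] (R.iter q x γ b) := ih.mono (R.hist.mono b.le_succ) le_rfl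
    exact ih'.sub ((measurable_act (R.cond_meas b) (measurable_wGrad (R.w_meas b) ih')).const_smul γ)

/-- The supremum over an uncountable set is measurable because the perturbed Hessian is continuous
in the weights, which makes the supremum lower semicontinuous. -/
lemma measurable_iSup_enorm_wHess_sub (s : Set (Vec d)) (B : Vec d → Matrix (Fin d) (Fin d) ℝ) :
    Measurable fun w : Fin n → ℝ => ⨆ θ ∈ s, ‖op (wHess q x w θ - B θ)‖ₑ := by
  refine LowerSemicontinuous.measurable (lowerSemicontinuous_biSup fun θ _ => ?_)
  refine Continuous.lowerSemicontinuous (Continuous.enorm ?_)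
  have : (fun w : Fin n → ℝ => op (wHess q x w θ - B θ))
      = fun w => (n : ℝ)⁻¹ • ∑ i, w i • op (hess (q (x i)) θ) - op (B θ) := by
    ext1 w
    simp [op, wHess, map_sum]
  rw [this]
  fun_prop

end Measurability

/-! ### Bounds in `L_p` and geometric recursions -/

section LpBounds

variable {Ω E : Type*} [MeasurableSpace Ω] [NormedAddCommGroup E] {μ : Measure Ω} {p r : ℝ≥0∞}

lemma eLpNorm_le_add_of_ae_le {F : Ω → E} {f g : Ω → ℝ} {a b : ℝ}
    (h : ∀ᵐ ω ∂μ, ‖F ω‖ ≤ f ω + g ω) (hf : Measurable f) (hg : Measurable g) (hp : 1 ≤ p)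
    (ha : 0 ≤ a) (hb : 0 ≤ b) (hfa : eLpNorm f p μ ≤ ENNReal.ofReal a)
    (hgb : eLpNorm g p μ ≤ ENNReal.ofReal b) : eLpNorm F p μ ≤ ENNReal.ofReal (a + b) := by
  rw [ENNReal.ofReal_add ha hb]
  calc eLpNorm F p μ ≤ eLpNorm (f + g) p μ := eLpNorm_mono_ae_real h
    _ ≤ eLpNorm f p μ + eLpNorm g p μ :=
        eLpNorm_add_le hf.aestronglyMeasurable hg.aestronglyMeasurable hp
    _ ≤ _ := add_le_add hfa hgb

lemma eLpNorm_const_mul_le_ofReal {f : Ω → ℝ} {a c : ℝ} (hc : 0 ≤ c)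
    (hfa : eLpNorm f p μ ≤ ENNReal.ofReal a) :
    eLpNorm (fun ω => c * f ω) p μ ≤ ENNReal.ofReal (c * a) := by
  rw [ENNReal.ofReal_mul hc]
  refine (eLpNorm_const_smul_le (c := c) (f := f)).trans ?_
  rw [Real.enorm_of_nonneg hc]
  gcongr

lemma eLpNorm_mul_le_ofReal [hpr : ENNReal.HolderTriple p p r] {f g : Ω → ℝ} {a b : ℝ}
    (hf : Measurable f) (hg : Measurable g) (ha : 0 ≤ a) (hfa : eLpNorm f p μ ≤ ENNReal.ofReal a)
    (hgb : eLpNorm g p μ ≤ ENNReal.ofReal b) :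
    eLpNorm (fun ω => f ω * g ω) r μ ≤ ENNReal.ofReal (a * b) := by
  rw [ENNReal.ofReal_mul ha]
  exact (eLpNorm_smul_le_mul_eLpNorm hg.aestronglyMeasurable hf.aestronglyMeasurable).trans
    (mul_le_mul' hfa hgb)

lemma eLpNorm_le_ofReal_of_ae_le [IsProbabilityMeasure μ] {F : Ω → E} {a : ℝ}
    (h : ∀ᵐ ω ∂μ, ‖F ω‖ ≤ a) : eLpNorm F p μ ≤ ENNReal.ofReal a := by
  simpa using eLpNorm_le_of_ae_bound (p := p) h

/-- A sequence of functions whose `L_p` norms satisfy `z_{b+1} ≤ a z_b + Q (r^b + ε)` is of the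
order `r^b + ε`, whenever `a < r < 1`. -/
lemma eLpNorm_le_of_recursion {F : ℕ → Ω → E} {a r Q C ε : ℝ}
    (hr : 0 ≤ r) (hr1 : r ≤ 1) (hε : 0 ≤ ε) (hC : 0 ≤ C) (hQC : a * C + Q ≤ C * r)
    (h0 : eLpNorm (F 0) p μ ≤ ENNReal.ofReal (C * (r ^ 0 + ε)))
    (h : ∀ b, eLpNorm (F b) p μ ≤ ENNReal.ofReal (C * (r ^ b + ε)) →
      eLpNorm (F (b + 1)) p μ ≤ ENNReal.ofReal (a * (C * (r ^ b + ε)) + Q * (r ^ b + ε)))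
    (b : ℕ) : eLpNorm (F b) p μ ≤ ENNReal.ofReal (C * (r ^ b + ε)) := by
  induction b with
  | zero => exact h0
  | succ b ih =>
    refine (h b ih).trans (ENNReal.ofReal_le_ofReal ?_)
    have h1 : 0 ≤ r ^ b := pow_nonneg hr b
    calc a * (C * (r ^ b + ε)) + Q * (r ^ b + ε) = (a * C + Q) * (r ^ b + ε) := by ring
      _ ≤ C * r * (r ^ b + ε) := by gcongr
      _ = C * (r ^ (b + 1) + r * ε) := by ring
      _ ≤ C * (r ^ (b + 1) + ε) := by
          gcongr
          exact mul_le_of_le_one_left hε hr1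

end LpBounds

/-! ### Consequences of the coupling conditions for one sample -/

namespace Setting

variable {d : ℕ} {Z Ωs : Type*} [MeasurableSpace Z] [MeasurableSpace Ωs] (M : Setting d Z Ωs)

/-- The linear process which approximates `θ_b - θ̂_n`: the iteration for a quadratic objective with
Hessian `H_n(θ̂_n)`, the conditioning matrix `H_n(θ̂_n)⁻¹`, and the gradient noise of the minimizer.
It is started at zero. -/
noncomputable def lin {n : ℕ} (x : Fin n → Z) : ℕ → Ωs → Vec d
  | 0, _ => 0
  | b + 1, ω => (1 - M.γ) • lin x b ω - M.γ • act (M.Hhat x)⁻¹ (M.Gb x (b + 1) ω (M.θhat n x))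

/-- A real majorant of `θ ↦ ‖H_m^{(b)}(θ) - H_n(θ)‖₂` on `Θ`; the default value zero of `toReal`
matters only on a null set. -/
noncomputable def hessSup {n : ℕ} (x : Fin n → Z) (b : ℕ) (ω : Ωs) : ℝ :=
  (⨆ θ ∈ M.Θ, ‖op (M.Hb x b ω θ - sampleHess M.q x θ)‖ₑ).toReal

variable {M}

instance {n : ℕ} (x : Fin n → Z) : IsProbabilityMeasure (M.Pstar x) := (M.run n x).isProb

section

variable {n : ℕ} (x : Fin n → Z)

lemma measurable_draw (b : ℕ) : Measurable (M.draw x b) :=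
  ((M.run n x).measurable_iter M.γ b).mono ((M.run n x).hist.le b) le_rfl

lemma measurable_w (b : ℕ) : Measurable ((M.run n x).w (b + 1)) :=
  ((M.run n x).w_meas b).mono ((M.run n x).hist.le _) le_rfl

lemma measurable_Gb (b : ℕ) (θ : Vec d) : Measurable fun ω => M.Gb x (b + 1) ω θ :=
  measurable_wGrad (measurable_w x b) measurable_const

lemma measurable_lin_hist (b : ℕ) : Measurable[(M.run n x).hist b] (M.lin x b) := by
  induction b with
  | zero => exact measurable_const
  | succ b ih =>
    have ih' : Measurable[(M.run n x).hist (b + 1)] (M.lin x b) :=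
      ih.mono ((M.run n x).hist.mono b.le_succ) le_rfl
    have hg : Measurable[(M.run n x).hist (b + 1)] fun ω => M.Gb x (b + 1) ω (M.θhat n x) :=
      measurable_wGrad ((M.run n x).w_meas b) measurable_const
    exact (ih'.const_smul (1 - M.γ)).sub
      ((measurable_act (A := fun _ => (M.Hhat x)⁻¹) (fun _ _ => measurable_const) hg).const_smul
        M.γ)

lemma measurable_lin (b : ℕ) : Measurable (M.lin x b) :=
  (measurable_lin_hist x b).mono ((M.run n x).hist.le b) le_rfl

lemma measurable_mismatch (b : ℕ) (H : Matrix (Fin d) (Fin d) ℝ) :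
    Measurable fun ω => op (1 - (M.run n x).cond b ω * H) := by
  refine measurable_op fun i j => ?_
  simp only [Matrix.sub_apply, Matrix.mul_apply]
  exact measurable_const.sub (Finset.measurable_fun_sum _ fun k _ =>
    (((M.run n x).cond_meas b i k).mono ((M.run n x).hist.le _) le_rfl).mul_const _)

lemma measurable_iSup_Hb (b : ℕ) : Measurable fun ω =>
    ⨆ θ ∈ M.Θ, ‖op (M.Hb x (b + 1) ω θ - sampleHess M.q x θ)‖ₑ :=
  (measurable_iSup_enorm_wHess_sub M.Θ _).comp (measurable_w x b)

lemma measurable_hessSup (b : ℕ) : Measurable (M.hessSup x (b + 1)) :=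
  (measurable_iSup_Hb x b).ennreal_toReal

end

section

variable {n : ℕ} {x : Fin n → Z} {p : ℝ≥0∞} {c : Consts}

lemma hasFDerivAt_Gb (hM : M.Standing) (b : ℕ) (ω : Ωs) {θ : Vec d} (hθ : θ ∈ M.Θ) :
    HasFDerivAt (M.Gb x b ω) (op (M.Hb x b ω θ)) θ :=
  hasFDerivAt_wGrad (fun _ => hM.smooth _ _ hθ) _

lemma CouplingAt.Hhat_bounds (hc : M.CouplingAt p c x (M.Hhat x)⁻¹) (hM : M.Standing)
    (hx : x ∈ M.S n) : EigBounds (M.Hhat x) c.lamH c.LamH :=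
  hc.hess_bounds _ (hM.θhat_mem n x hx)

lemma CouplingAt.eLpNorm_Gb_le (hc : M.CouplingAt p c x (M.Hhat x)⁻¹) (hM : M.Standing)
    (hx : x ∈ M.S n) (b : ℕ) :
    eLpNorm (fun ω => ‖M.Gb x (b + 1) ω (M.θhat n x)‖) p (M.Pstar x)
      ≤ ENNReal.ofReal (|c.C2| * (1 / √(M.m n))) := by
  refine le_trans ?_ ((hc.grad_dev (b + 1) (by omega)).trans (ENNReal.ofReal_le_ofReal ?_))
  · refine eLpNorm_mono_enorm fun ω => ?_
    rw [enorm_norm]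
    refine le_trans (le_of_eq ?_) (le_iSup₂ (f := fun θ (_ : θ ∈ M.Θ) =>
      ‖M.Gb x (b + 1) ω θ - sampleGrad M.q x θ‖ₑ) _ (hM.θhat_mem n x hx))
    rw [hM.θhat_foc n x hx, sub_zero]
  · rw [div_eq_mul_one_div]
    gcongr
    exact le_abs_self _

lemma CouplingAt.eLpNorm_hessSup_le (hc : M.CouplingAt p c x (M.Hhat x)⁻¹) (b : ℕ) :
    eLpNorm (M.hessSup x (b + 1)) p (M.Pstar x) ≤ ENNReal.ofReal (|c.C3| * (1 / √(M.m n))) := by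
  refine le_trans ?_ ((hc.hess_dev (b + 1) (by omega)).trans (ENNReal.ofReal_le_ofReal ?_))
  · refine eLpNorm_mono_enorm fun ω => ?_
    rw [hessSup, enorm_eq_self, Real.enorm_of_nonneg ENNReal.toReal_nonneg]
    exact ENNReal.ofReal_toReal_le
  · rw [div_eq_mul_one_div]
    gcongr
    exact le_abs_self _

lemma CouplingAt.ae_le_hessSup (hc : M.CouplingAt p c x (M.Hhat x)⁻¹) (hp : 1 ≤ p) (b : ℕ) :
    ∀ᵐ ω ∂(M.Pstar x), ∀ θ ∈ M.Θ,
      ‖op (M.Hb x (b + 1) ω θ - sampleHess M.q x θ)‖ ≤ M.hessSup x (b + 1) ω := by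
  have h1 : eLpNorm (fun ω => ⨆ θ ∈ M.Θ, ‖op (M.Hb x (b + 1) ω θ - sampleHess M.q x θ)‖ₑ) 1
      (M.Pstar x) < ∞ :=
    (eLpNorm_le_eLpNorm_of_exponent_le hp
      (measurable_iSup_Hb x b).aestronglyMeasurable).trans_lt
      ((hc.hess_dev (b + 1) (by omega)).trans_lt ENNReal.ofReal_lt_top)
  rw [eLpNorm_one_eq_lintegral_enorm] at h1
  filter_upwards [ae_lt_top (by simpa using measurable_iSup_Hb x b) h1.ne] with ω hω θ hθ
  rw [enorm_eq_self] at hω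
  have h2 : ‖op (M.Hb x (b + 1) ω θ - sampleHess M.q x θ)‖ₑ ≤
      ⨆ θ ∈ M.Θ, ‖op (M.Hb x (b + 1) ω θ - sampleHess M.q x θ)‖ₑ :=
    le_iSup₂ (f := fun θ (_ : θ ∈ M.Θ) => ‖op (M.Hb x (b + 1) ω θ - sampleHess M.q x θ)‖ₑ) θ hθ
  rw [← toReal_enorm (op (M.Hb x (b + 1) ω θ - sampleHess M.q x θ))]
  exact ENNReal.toReal_mono hω.ne h2

lemma ae_norm_draw_sub_le (hM : M.Standing) (hx : x ∈ M.S n) {D : ℝ}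
    (hD : ∀ θ ∈ M.Θ, ∀ η ∈ M.Θ, ‖θ - η‖ ≤ D) (b : ℕ) :
    ∀ᵐ ω ∂(M.Pstar x), ‖M.draw x b ω - M.θhat n x‖ ≤ D := by
  filter_upwards [hM.draw_mem n x hx] with ω hω
  exact hD _ (hω b) _ (hM.θhat_mem n x hx)

lemma CouplingAt.eLpNorm_mismatch_le (hc : M.CouplingAt p c x (M.Hhat x)⁻¹) (hM : M.Standing)
    (hcA : c.Admissible M.γ) (hx : x ∈ M.S n) {D : ℝ}
    (hD : ∀ θ ∈ M.Θ, ∀ η ∈ M.Θ, ‖θ - η‖ ≤ D) (b : ℕ) :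
    eLpNorm (fun ω => ‖op (1 - (M.run n x).cond b ω * M.Hhat x)‖) p (M.Pstar x)
      ≤ ENNReal.ofReal (|c.C5| * (c.ρ ^ b * D + 1 / √(M.m n))) := by
  have hD0 : 0 ≤ D := (norm_nonneg _).trans (hD _ (hM.θhat_mem n x hx) _ (hM.θhat_mem n x hx))
  have h1 := hc.cond_dev b
  rw [Matrix.nonsing_inv_nonsing_inv _ ((hc.Hhat_bounds hM hx).isUnit_det hcA.lamH_pos)] at h1
  rw [eLpNorm_norm]
  refine h1.trans (ENNReal.ofReal_le_ofReal ?_)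
  have h2 : (eLpNorm (fun ω => (M.run n x).init ω - M.θhat n x) p (M.Pstar x)).toReal ≤ D :=
    ENNReal.toReal_le_of_le_ofReal hD0
      (eLpNorm_le_ofReal_of_ae_le (ae_norm_draw_sub_le hM hx hD 0))
  have h3 := hcA.ρ_nonneg
  calc _ ≤ |c.C5| * (c.ρ ^ b * _ + 1 / √(M.m n)) :=
        mul_le_mul_of_nonneg_right (le_abs_self _) (by positivity)
    _ ≤ _ := by gcongr

end

end Setting

namespace Setting

variable {d : ℕ} {Z Ωs : Type*} [MeasurableSpace Z] [MeasurableSpace Ωs] {M : Setting d Z Ωs}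
variable {p : ℝ≥0∞} {c : Consts}

/-! ### Rates of convergence of the draws and of their linear approximation -/

lemma tendsto_one_div_sqrt_m (hm : Tendsto M.m atTop atTop) :
    Tendsto (fun n => 1 / √(M.m n : ℝ)) atTop (𝓝 0) := by
  simp_rw [one_div]
  exact (Real.tendsto_sqrt_atTop.comp
    (tendsto_natCast_atTop_atTop.comp hm)).inv_tendsto_atTop

lemma one_div_sqrt_natCast_le_one (k : ℕ) : 1 / √(k : ℝ) ≤ 1 := by
  rcases Nat.eq_zero_or_pos k with rfl | hk
  · simp
  · have h1 : (1 : ℝ) ≤ k := by exact_mod_cast hk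
    rw [div_le_one (by positivity)]
    exact Real.one_le_sqrt.2 h1

lemma CouplingAt.lower_le_upper {n : ℕ} {x : Fin n → Z} (hc : M.CouplingAt p c x (M.Hhat x)⁻¹)
    (hM : M.Standing) (hx : x ∈ M.S n) (hd : 0 < d) : c.lamH ≤ c.LamH ∧ c.lamP ≤ c.LamP := by
  obtain ⟨ω, hω⟩ := (hc.cond_bounds 1 le_rfl).exists
  exact ⟨(hc.Hhat_bounds hM hx).lower_le_upper hd, hω.lower_le_upper hd⟩

lemma exists_bound_diam (hM : M.Standing) : ∃ D : ℝ, 0 ≤ D ∧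
    ∀ θ ∈ M.Θ, ∀ η ∈ M.Θ, ‖θ - η‖ ≤ D :=
  ⟨Metric.diam M.Θ, Metric.diam_nonneg, fun θ hθ η hη => by
    rw [← dist_eq_norm]; exact Metric.dist_le_diam_of_mem hM.compact.isBounded hθ hη⟩

/-- Since `P_b` approaches `H_n(θ̂_n)⁻¹`, the latter inherits the upper eigenvalue bound of the
former, up to an arbitrarily small margin. -/
lemma eventually_quad_Hhat_inv_le (hM : M.Standing) (hm : Tendsto M.m atTop atTop) (hp : 1 ≤ p)
    (hcA : c.Admissible M.γ) (hc : ∀ n, ∀ x ∈ M.S n, M.CouplingAt p c x (M.Hhat x)⁻¹)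
    {κ : ℝ} (hκ : c.LamP < κ) :
    ∀ᶠ n in atTop, ∀ x ∈ M.S n, ∀ u : Vec d, quad (M.Hhat x)⁻¹ u ≤ κ * ‖u‖ ^ 2 := by
  obtain ⟨D, hD0, hD⟩ := exists_bound_diam hM
  have hl := hcA.lamH_pos
  set δ := c.lamH * (κ - c.LamP) with hδ
  have hδ0 : 0 < δ := mul_pos hl (sub_pos.2 hκ)
  have h1 : Tendsto (fun b => |c.C5| * (c.ρ ^ b * D)) atTop (𝓝 0) := by
    simpa using ((tendsto_pow_atTop_nhds_zero_of_lt_one hcA.ρ_nonneg hcA.ρ_lt).mul_const D).const_mul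
      |c.C5|
  obtain ⟨b, hb, hb1⟩ := ((h1.eventually_lt_const (by positivity : (0 : ℝ) < δ / 4)).and
    (eventually_ge_atTop 1)).exists
  have h2 : Tendsto (fun n => |c.C5| * (1 / √(M.m n : ℝ))) atTop (𝓝 0) := by
    simpa using (tendsto_one_div_sqrt_m hm).const_mul |c.C5|
  filter_upwards [h2.eventually_lt_const (by positivity : (0 : ℝ) < δ / 4)] with n hn x hx u
  have hH := (hc n x hx).Hhat_bounds hM hx
  obtain ⟨ω, hω, hω'⟩ : ∃ ω, EigBounds ((M.run n x).cond b ω) c.lamP c.LamP ∧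
      ‖op (1 - (M.run n x).cond b ω * M.Hhat x)‖ ≤ δ := by
    by_contra! hcon
    have h3 : eLpNorm (fun _ : Ωs => δ) p (M.Pstar x)
        ≤ eLpNorm (fun ω => ‖op (1 - (M.run n x).cond b ω * M.Hhat x)‖) p (M.Pstar x) := by
      refine eLpNorm_mono_ae ?_
      filter_upwards [(hc n x hx).cond_bounds b hb1] with ω hω
      rw [Real.norm_of_nonneg hδ0.le, norm_norm]
      exact (hcon ω hω).le
    have h4 := h3.trans ((hc n x hx).eLpNorm_mismatch_le hM hcA hx hD b)
    rw [eLpNorm_const _ (by positivity) (IsProbabilityMeasure.ne_zero _)] at h4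
    rw [measure_univ, ENNReal.one_rpow, mul_one, Real.enorm_of_nonneg hδ0.le] at h4
    have h5 := (ENNReal.ofReal_le_ofReal_iff
      (by have := hcA.ρ_nonneg; positivity)).1 h4
    linarith
  have := quad_inv_le_of_near hH hl hω hω' u
  rwa [hδ, mul_div_cancel_left₀ _ hl.ne', add_sub_cancel] at this

/-- The contraction factor of the idealized step: `A(γ) < 1` leaves room for a contraction in the
norm `u ↦ ‖H_n(θ̂_n)^{1/2} u‖`, uniformly over the samples. -/
lemma exists_contraction (hM : M.Standing) (hm : Tendsto M.m atTop atTop) (hp : 1 ≤ p)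
    (hcA : c.Admissible M.γ) (hc : ∀ n, ∀ x ∈ M.S n, M.CouplingAt p c x (M.Hhat x)⁻¹)
    (hH : c.lamH ≤ c.LamH) (hP : c.lamP ≤ c.LamP) :
    ∃ a : ℝ, 0 ≤ a ∧ a < 1 ∧ ∀ᶠ n in atTop, ∀ x ∈ M.S n, ∀ B, EigBounds B c.lamH c.LamH →
      ∀ y : Vec d, ‖act (CFC.sqrt (M.Hhat x)) (y - M.γ • act (M.Hhat x)⁻¹ (act B y))‖
        ≤ a * ‖act (CFC.sqrt (M.Hhat x)) y‖ := by
  have hl := hcA.lamH_pos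
  have hL : 0 < c.LamH := hl.trans_le hH
  have hlP := hcA.lamP_pos
  have hLP : 0 < c.LamP := hlP.trans_le hP
  have hγ := hM.γ_pos
  have h1 : M.γ * (c.LamP * c.LamH) < 2 := by
    have h2 := hcA.A_lt
    rw [Consts.A] at h2
    have h3 : c.lamP * c.lamH ≤ c.LamP * c.LamH := by gcongr
    have h4 : M.γ * (c.LamP * c.LamH) * (M.γ * (c.LamP * c.LamH))
        < 2 * (M.γ * (c.LamP * c.LamH)) := by nlinarith
    exact lt_of_mul_lt_mul_right h4 (by positivity)
  set κ := (c.LamP + 2 / (M.γ * c.LamH)) / 2 with hκ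
  have hκ1 : c.LamP < κ := by
    have : c.LamP < 2 / (M.γ * c.LamH) := by
      rw [lt_div_iff₀ (by positivity)]; linarith
    rw [hκ]; linarith
  have hκ2 : M.γ * (κ * c.LamH) < 2 := by
    have : M.γ * (κ * c.LamH) = (M.γ * (c.LamP * c.LamH) + 2) / 2 := by
      rw [hκ]; field_simp
    rw [this]; linarith
  set v := 1 - M.γ * (2 - M.γ * (κ * c.LamH)) * (c.lamH / c.LamH) with hv
  have hv1 : v < 1 := by
    have : 0 < M.γ * (2 - M.γ * (κ * c.LamH)) * (c.lamH / c.LamH) :=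
      mul_pos (mul_pos hγ (by linarith)) (by positivity)
    rw [hv]; linarith
  refine ⟨√(max 0 v), Real.sqrt_nonneg _, ?_, ?_⟩
  · rw [Real.sqrt_lt' one_pos, one_pow]
    exact max_lt one_pos hv1
  · filter_upwards [eventually_quad_Hhat_inv_le hM hm hp hcA hc hκ1] with n hn x hx B hB y
    refine norm_sqrt_newton_step_le ((hc n x hx).Hhat_bounds hM hx) hB hl hL hγ (hn x hx) hκ2
      (Real.sqrt_nonneg _) (hLP.le.trans hκ1.le) ?_ y
    rw [Real.sq_sqrt (le_max_left _ _)]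
    exact le_max_right _ _

/-- The draws approach `θ̂_n` geometrically, up to the noise level `m^{-1/2}`. -/
theorem exists_eLpNorm_draw_sub_le (hM : M.Standing) (hm : Tendsto M.m atTop atTop) (hp : 1 ≤ p)
    (hcA : c.Admissible M.γ) (hc : ∀ n, ∀ x ∈ M.S n, M.CouplingAt p c x (M.Hhat x)⁻¹)
    (hH : c.lamH ≤ c.LamH) (hP : c.lamP ≤ c.LamP) :
    ∃ C r : ℝ, 0 ≤ C ∧ 0 ≤ r ∧ r < 1 ∧ c.ρ ≤ r ∧ ∀ᶠ n in atTop, ∀ x ∈ M.S n, ∀ b,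
      eLpNorm (fun ω => ‖M.draw x (b + 1) ω - M.θhat n x‖) p (M.Pstar x)
        ≤ ENNReal.ofReal (C * (r ^ b + 1 / √(M.m n))) := by
  obtain ⟨D, hD0, hD⟩ := exists_bound_diam hM
  obtain ⟨a, ha0, ha1, ha⟩ := exists_contraction hM hm hp hcA hc hH hP
  have hl := hcA.lamH_pos
  have hL : 0 < c.LamH := hl.trans_le hH
  have hlP := hcA.lamP_pos
  have hLP : 0 < c.LamP := hlP.trans_le hP
  have hγ := hM.γ_pos
  have hρ0 := hcA.ρ_nonneg
  set r := max ((1 + a) / 2) c.ρ with hr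
  have har : a < r := lt_of_lt_of_le (by linarith) (le_max_left _ _)
  have hr0 : 0 ≤ r := ha0.trans har.le
  have hr1 : r < 1 := max_lt (by linarith) hcA.ρ_lt
  have hρr : c.ρ ≤ r := le_max_right _ _
  set k₁ := M.γ * √c.LamH * (c.LamH / c.lamH) * D with hk₁
  set k₂ := M.γ * √c.LamH * c.LamP with hk₂
  have hk₁0 : 0 ≤ k₁ := by positivity
  have hk₂0 : 0 ≤ k₂ := by positivity
  set Q := k₁ * (|c.C5| * (D + 1)) + k₂ * |c.C2| with hQ
  have hQ0 : 0 ≤ Q := by positivity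
  set C := Q / (r - a) + √c.LamH * D with hC
  have hC0 : 0 ≤ C := add_nonneg (div_nonneg hQ0 (by linarith)) (by positivity)
  refine ⟨(√c.lamH)⁻¹ * C, r, by positivity, hr0, hr1, hρr, ?_⟩
  filter_upwards [ha] with n hn x hx
  have hcx := hc n x hx
  have hHx := hcx.Hhat_bounds hM hx
  set μ := 1 / √(M.m n : ℝ) with hμ
  have hμ0 : 0 ≤ μ := by positivity
  have hmain : ∀ b, eLpNorm (fun ω => act (CFC.sqrt (M.Hhat x)) (M.draw x (b + 1) ω - M.θhat n x))
      p (M.Pstar x) ≤ ENNReal.ofReal (C * (r ^ b + μ)) := by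
    refine eLpNorm_le_of_recursion (a := a) (Q := Q) hr0 hr1.le hμ0 hC0 ?_ ?_ ?_
    · have : Q ≤ C * (r - a) := by
        rw [hC, add_mul, div_mul_cancel₀ _ (by linarith)]
        have : 0 ≤ √c.LamH * D * (r - a) := mul_nonneg (by positivity) (by linarith)
        linarith
      linarith
    · refine (eLpNorm_le_ofReal_of_ae_le (a := √c.LamH * D) ?_).trans
        (ENNReal.ofReal_le_ofReal ?_)
      · filter_upwards [ae_norm_draw_sub_le hM hx hD 1] with ω hω
        refine le_of_sq_le_sq ?_ (by positivity)
        rw [norm_act_sqrt_sq (hHx.nonneg hl), mul_pow, Real.sq_sqrt hL.le]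
        exact (hHx.2 _).2.trans (by gcongr)
      · have h1 : √c.LamH * D ≤ C := by
          rw [hC]; linarith [div_nonneg hQ0 (by linarith : 0 ≤ r - a)]
        rw [pow_zero]
        nlinarith
    · intro b ih
      have hrb : c.ρ ^ (b + 1) ≤ r ^ b :=
        (pow_le_pow_left₀ hρ0 hρr _).trans (pow_le_pow_of_le_one hr0 hr1.le b.le_succ)
      have hrb0 : 0 ≤ r ^ b := pow_nonneg hr0 b
      have hm1 : Measurable fun ω => ‖op (1 - (M.run n x).cond (b + 1) ω * M.Hhat x)‖ :=
        (measurable_mismatch x _ _).norm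
      have hm2 : Measurable fun ω => ‖M.Gb x (b + 1 + 1) ω (M.θhat n x)‖ :=
        (measurable_Gb x _ _).norm
      have hm3 : Measurable fun ω =>
          ‖act (CFC.sqrt (M.Hhat x)) (M.draw x (b + 1) ω - M.θhat n x)‖ :=
        (measurable_act (A := fun _ => CFC.sqrt (M.Hhat x)) (fun _ _ => measurable_const)
          ((measurable_draw x _).sub measurable_const)).norm
      refine eLpNorm_le_add_of_ae_le
        (f := fun ω => a * ‖act (CFC.sqrt (M.Hhat x)) (M.draw x (b + 1) ω - M.θhat n x)‖)
        (g := fun ω => k₁ * ‖op (1 - (M.run n x).cond (b + 1) ω * M.Hhat x)‖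
          + k₂ * ‖M.Gb x (b + 1 + 1) ω (M.θhat n x)‖)
        ?_ (hm3.const_mul a) ((hm1.const_mul _).add (hm2.const_mul _)) hp (by positivity)
        (by positivity) ?_ ?_
      · filter_upwards [hM.draw_mem n x hx, hcx.cond_bounds (b + 1) (by omega),
          hcx.hess_star_bounds (b + 1 + 1) (by omega)] with ω h1 h2 h3
        refine (norm_sqrt_step_le hM.convex (fun z hz => hasFDerivAt_Gb hM (b + 1 + 1) ω hz) hl hL
          hlP hLP h3 hHx h2 hγ (hn x hx) (h1 (b + 1)) (hM.θhat_mem n x hx)).trans ?_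
        gcongr
        rw [hk₁]
        gcongr
        exact hD _ (h1 _) _ (hM.θhat_mem n x hx)
      · refine eLpNorm_const_mul_le_ofReal ha0 ?_
        rw [eLpNorm_norm]; exact ih
      · have h1 := eLpNorm_const_mul_le_ofReal hk₁0
          (hcx.eLpNorm_mismatch_le hM hcA hx hD (b + 1))
        have h2 := eLpNorm_const_mul_le_ofReal hk₂0 (hcx.eLpNorm_Gb_le hM hx (b + 1))
        refine (eLpNorm_le_add_of_ae_le (Eventually.of_forall fun ω => ?_) (hm1.const_mul k₁)
          (hm2.const_mul k₂) hp (by positivity) (by positivity) h1 h2).trans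
          (ENNReal.ofReal_le_ofReal ?_)
        · rw [Real.norm_of_nonneg (by positivity)]
        · rw [hQ, add_mul, mul_assoc k₁, mul_assoc k₂, mul_assoc |c.C5|]
          gcongr
          · calc c.ρ ^ (b + 1) * D + μ ≤ r ^ b * D + μ := by gcongr
              _ ≤ (D + 1) * (r ^ b + μ) := by nlinarith [mul_nonneg hD0 hμ0]
          · linarith
  intro b
  rw [mul_assoc]
  refine le_trans (eLpNorm_mono_real (g := fun ω => (√c.lamH)⁻¹ *
    ‖act (CFC.sqrt (M.Hhat x)) (M.draw x (b + 1) ω - M.θhat n x)‖) fun ω => ?_)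
    (eLpNorm_const_mul_le_ofReal (by positivity) (by rw [eLpNorm_norm]; exact hmain b))
  rw [norm_norm, inv_mul_eq_div, le_div_iff₀ (by positivity)]
  refine le_of_sq_le_sq ?_ (norm_nonneg _)
  rw [norm_act_sqrt_sq (hHx.nonneg hl), mul_pow, Real.sq_sqrt hl.le, mul_comm]
  exact (hHx.2 _).1

/-- The size of the second-order terms of the linearization: products of two functions of size `e`
in `L_p` are of size `e²` in the smaller exponent. -/
lemma eLpNorm_second_order_le {Ω : Type*} [MeasurableSpace Ω] {ν : Measure Ω} {s : ℝ≥0∞}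
    [ENNReal.HolderTriple p p s] (hs : 1 ≤ s) (hp : 1 ≤ p) {f g y t : Ω → ℝ}
    (hf : Measurable f) (hg : Measurable g) (hy : Measurable y) (ht : Measurable t)
    (hf0 : ∀ ω, 0 ≤ f ω) (hg0 : ∀ ω, 0 ≤ g ω) (hy0 : ∀ ω, 0 ≤ y ω) (ht0 : ∀ ω, 0 ≤ t ω)
    {k₁ k₂ k₃ k₄ l C u v e : ℝ} (hk₁ : 0 ≤ k₁) (hk₂ : 0 ≤ k₂) (hk₃ : 0 ≤ k₃) (hk₄ : 0 ≤ k₄)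
    (hl : 0 ≤ l) (hC : 0 ≤ C) (hu : 0 ≤ u) (hv : 0 ≤ v) (he : 0 ≤ e)
    (bf : eLpNorm f p ν ≤ ENNReal.ofReal (k₁ * e)) (bg : eLpNorm g p ν ≤ ENNReal.ofReal (k₂ * e))
    (bt : eLpNorm t p ν ≤ ENNReal.ofReal (k₃ * e)) (bY : eLpNorm y p ν ≤ ENNReal.ofReal (k₄ * e)) :
    eLpNorm (fun ω => u * (f ω * (l * g ω + y ω)) + v * ((t ω + C * y ω) * y ω)) s ν
      ≤ ENNReal.ofReal ((u * (k₁ * (l * k₂ + k₄)) + v * ((k₃ + C * k₄) * k₄)) * e ^ 2) := by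
  have m5 : Measurable fun ω => l * g ω + y ω := (hg.const_mul l).add hy
  have m6 : Measurable fun ω => t ω + C * y ω := ht.add (hy.const_mul C)
  have b5 : eLpNorm (fun ω => l * g ω + y ω) p ν ≤ ENNReal.ofReal (l * (k₂ * e) + k₄ * e) :=
    eLpNorm_le_add_of_ae_le (Eventually.of_forall fun ω => by
        have := hg0 ω
        have := hy0 ω
        rw [Real.norm_of_nonneg (by positivity)])
      (hg.const_mul l) hy hp (by positivity) (by positivity)
      (eLpNorm_const_mul_le_ofReal hl bg) bY
  have b6 : eLpNorm (fun ω => t ω + C * y ω) p ν ≤ ENNReal.ofReal (k₃ * e + C * (k₄ * e)) :=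
    eLpNorm_le_add_of_ae_le (Eventually.of_forall fun ω => by
        have := ht0 ω
        have := hy0 ω
        rw [Real.norm_of_nonneg (by positivity)])
      ht (hy.const_mul C) hp (by positivity) (by positivity) bt
      (eLpNorm_const_mul_le_ofReal hC bY)
  have b7 := eLpNorm_const_mul_le_ofReal hu
    (eLpNorm_mul_le_ofReal (r := s) hf m5 (by positivity) bf b5)
  have b8 := eLpNorm_const_mul_le_ofReal hv
    (eLpNorm_mul_le_ofReal (r := s) m6 hy (by positivity) b6 bY)
  refine (eLpNorm_le_add_of_ae_le (Eventually.of_forall fun ω => ?_)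
    ((hf.mul m5).const_mul u) ((m6.mul hy).const_mul v) hs (by positivity) (by positivity)
    b7 b8).trans (ENNReal.ofReal_le_ofReal (le_of_eq (by ring)))
  have := hf0 ω
  have := hg0 ω
  have := hy0 ω
  have := ht0 ω
  rw [Real.norm_of_nonneg (by positivity)]
  rfl

set_option maxHeartbeats 1000000 in
/-- The linear approximation is one order better than the draws themselves: the distance is of the
order `m⁻¹` after the transient. Products of two `L_p` functions force the smaller exponent. -/
theorem exists_eLpNorm_draw_sub_lin_le {s : ℝ≥0∞} [ENNReal.HolderTriple p p s] (hs : 1 ≤ s)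
    (hsp : s ≤ p) (hM : M.Standing) (hcA : c.Admissible M.γ)
    (hc : ∀ n, ∀ x ∈ M.S n, M.CouplingAt p c x (M.Hhat x)⁻¹)
    (hH : c.lamH ≤ c.LamH) (hP : c.lamP ≤ c.LamP) {C r : ℝ} (hC : 0 ≤ C) (hr0 : 0 ≤ r)
    (hr1 : r < 1) (hρr : c.ρ ≤ r) (hY : ∀ᶠ n in atTop, ∀ x ∈ M.S n, ∀ b,
      eLpNorm (fun ω => ‖M.draw x (b + 1) ω - M.θhat n x‖) p (M.Pstar x)
        ≤ ENNReal.ofReal (C * (r ^ b + 1 / √(M.m n)))) :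
    ∃ C' r' : ℝ, 0 ≤ C' ∧ 0 ≤ r' ∧ r' < 1 ∧ ∀ᶠ n in atTop, ∀ x ∈ M.S n, ∀ b,
      eLpNorm (fun ω => M.draw x (b + 1) ω - M.θhat n x - M.lin x (b + 1) ω) s (M.Pstar x)
        ≤ ENNReal.ofReal (C' * (r' ^ b + 1 / (M.m n))) := by
  obtain ⟨D, hD0, hD⟩ := exists_bound_diam hM
  have hp : 1 ≤ p := hs.trans hsp
  have hl := hcA.lamH_pos
  have hL : 0 < c.LamH := hl.trans_le hH
  have hlP := hcA.lamP_pos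
  have hLP : 0 < c.LamP := hlP.trans_le hP
  have hγ := hM.γ_pos
  have hγ1 := hM.γ_le
  have hρ0 := hcA.ρ_nonneg
  set a := 1 - M.γ with ha
  have ha0 : 0 ≤ a := by rw [ha]; linarith
  set r' := max r (1 - M.γ / 2) with hr'
  have har : a < r' := lt_of_lt_of_le (by rw [ha]; linarith) (le_max_right _ _)
  have hr'0 : 0 ≤ r' := hr0.trans (le_max_left _ _)
  have hr'1 : r' < 1 := max_lt hr1 (by linarith)
  have hl0 : 0 ≤ c.lamH⁻¹ := by positivity
  set Q₀ := M.γ * (|c.C5| * (D + 1) * (c.lamH⁻¹ * |c.C2| + C))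
    + M.γ * c.LamP * ((|c.C3| + |c.C1| * C) * C) with hQ₀
  have hQ₀0 : 0 ≤ Q₀ := by positivity
  set B₀ := D + M.γ * (c.lamH⁻¹ * |c.C2|) with hB₀
  have hB₀0 : 0 ≤ B₀ := by positivity
  set C' := 2 * Q₀ / (r' - a) + B₀ with hC'
  have hq : 0 ≤ 2 * Q₀ / (r' - a) := div_nonneg (by positivity) (by linarith)
  have hC'0 : 0 ≤ C' := add_nonneg hq hB₀0
  refine ⟨C', r', hC'0, hr'0, hr'1, ?_⟩
  filter_upwards [hY] with n hn x hx
  have hcx := hc n x hx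
  have hHx := hcx.Hhat_bounds hM hx
  set μ := 1 / √(M.m n : ℝ) with hμ
  have hμ0 : 0 ≤ μ := by positivity
  have hμ1 : μ ≤ 1 := one_div_sqrt_natCast_le_one _
  have hμ2 : μ ^ 2 = 1 / (M.m n : ℝ) := by
    rw [hμ, div_pow, one_pow, Real.sq_sqrt (Nat.cast_nonneg _)]
  refine eLpNorm_le_of_recursion (a := a) (Q := 2 * Q₀) hr'0 hr'1.le (by positivity) hC'0
    ?_ ?_ ?_
  · have : 2 * Q₀ ≤ C' * (r' - a) := by
      rw [hC', add_mul, div_mul_cancel₀ _ (by linarith)]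
      have : 0 ≤ B₀ * (r' - a) := mul_nonneg (by positivity) (by linarith)
      linarith
    linarith
  · have h1 := (eLpNorm_le_eLpNorm_of_exponent_le hsp
      (measurable_Gb x 0 (M.θhat n x)).norm.aestronglyMeasurable).trans (hcx.eLpNorm_Gb_le hM hx 0)
    refine (eLpNorm_le_add_of_ae_le (a := D) (b := M.γ * (c.lamH⁻¹ * (|c.C2| * μ)))
      (f := fun _ => D)
      (g := fun ω => M.γ * (c.lamH⁻¹ * ‖M.Gb x (0 + 1) ω (M.θhat n x)‖)) ?_ measurable_const
      (((measurable_Gb x 0 (M.θhat n x)).norm.const_mul _).const_mul _) hs hD0 (by positivity)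
      (eLpNorm_le_ofReal_of_ae_le (Eventually.of_forall fun _ => ?_))
      (eLpNorm_const_mul_le_ofReal hγ.le (eLpNorm_const_mul_le_ofReal hl0 h1))).trans
      (ENNReal.ofReal_le_ofReal ?_)
    · filter_upwards [ae_norm_draw_sub_le hM hx hD 1] with ω hω
      refine (norm_sub_le _ _).trans (add_le_add hω ?_)
      simp only [lin, smul_zero, zero_sub, norm_neg, norm_smul, Real.norm_of_nonneg hγ.le]
      gcongr
      exact hHx.norm_act_inv_le hl _
    · rw [Real.norm_of_nonneg hD0]
    · calc D + M.γ * (c.lamH⁻¹ * (|c.C2| * μ)) ≤ D + M.γ * (c.lamH⁻¹ * (|c.C2| * 1)) := by gcongr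
        _ = B₀ := by rw [hB₀, mul_one]
        _ ≤ C' * 1 := by rw [hC']; linarith
        _ ≤ _ := by
          rw [pow_zero]
          gcongr
          linarith [show (0 : ℝ) ≤ 1 / (M.m n : ℝ) by positivity]
  · intro b ih
    have hrb0 : 0 ≤ r ^ b := pow_nonneg hr0 b
    have hρb : c.ρ ^ (b + 1) ≤ r ^ b :=
      (pow_le_pow_left₀ hρ0 hρr _).trans (pow_le_pow_of_le_one hr0 hr1.le b.le_succ)
    have hrb1 : r ^ b ≤ 1 := pow_le_one₀ hr0 hr1.le
    set e := r ^ b + μ with he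
    have he0 : 0 ≤ e := by positivity
    have hμe : μ ≤ e := by rw [he]; linarith
    have he2 : e ^ 2 ≤ 2 * (r' ^ b + 1 / (M.m n : ℝ)) := by
      have h1 : e ^ 2 ≤ 2 * ((r ^ b) ^ 2 + μ ^ 2) := by rw [he]; nlinarith [sq_nonneg (r ^ b - μ)]
      have h2 : (r ^ b) ^ 2 ≤ r ^ b := by nlinarith
      have h3 : r ^ b ≤ r' ^ b := pow_le_pow_left₀ hr0 (le_max_left _ _) b
      rw [← hμ2]; linarith
    have hm1 : Measurable fun ω => ‖op (1 - (M.run n x).cond (b + 1) ω * M.Hhat x)‖ :=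
      (measurable_mismatch x _ _).norm
    have hm2 : Measurable fun ω => ‖M.Gb x (b + 1 + 1) ω (M.θhat n x)‖ :=
      (measurable_Gb x _ _).norm
    have hm3 : Measurable fun ω => ‖M.draw x (b + 1) ω - M.θhat n x‖ :=
      ((measurable_draw x _).sub measurable_const).norm
    have hm4 : Measurable fun ω => M.hessSup x (b + 1 + 1) ω := measurable_hessSup x _
    have hm5 : Measurable fun ω =>
        ‖M.draw x (b + 1) ω - M.θhat n x - M.lin x (b + 1) ω‖ :=
      (((measurable_draw x _).sub measurable_const).sub (measurable_lin x _)).norm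
    have b1 : eLpNorm (fun ω => ‖op (1 - (M.run n x).cond (b + 1) ω * M.Hhat x)‖) p (M.Pstar x)
        ≤ ENNReal.ofReal (|c.C5| * (D + 1) * e) := by
      refine (hcx.eLpNorm_mismatch_le hM hcA hx hD (b + 1)).trans (ENNReal.ofReal_le_ofReal ?_)
      rw [mul_assoc]
      gcongr
      calc c.ρ ^ (b + 1) * D + μ ≤ r ^ b * D + μ := by gcongr
        _ ≤ (D + 1) * e := by rw [he]; nlinarith [mul_nonneg hD0 hμ0]
    have b2 : eLpNorm (fun ω => ‖M.Gb x (b + 1 + 1) ω (M.θhat n x)‖) p (M.Pstar x)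
        ≤ ENNReal.ofReal (|c.C2| * e) :=
      (hcx.eLpNorm_Gb_le hM hx (b + 1)).trans (ENNReal.ofReal_le_ofReal (by gcongr))
    have b3 := hn x hx b
    have b4 : eLpNorm (fun ω => M.hessSup x (b + 1 + 1) ω) p (M.Pstar x)
        ≤ ENNReal.ofReal (|c.C3| * e) :=
      (hcx.eLpNorm_hessSup_le (b + 1)).trans (ENNReal.ofReal_le_ofReal (by gcongr))
    have b5 := eLpNorm_second_order_le (s := s) (k₁ := |c.C5| * (D + 1)) (k₂ := |c.C2|)
      (k₃ := |c.C3|) hs hp hm1 hm2 hm3 hm4 (fun _ => norm_nonneg _)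
      (fun _ => norm_nonneg _) (fun _ => norm_nonneg _) (fun _ => ENNReal.toReal_nonneg)
      (by positivity) (by positivity) (by positivity) hC hl0 (abs_nonneg c.C1) hγ.le
      (mul_nonneg hγ.le hLP.le) he0 b1 b2 b4 b3
    refine eLpNorm_le_add_of_ae_le
      (f := fun ω => a * ‖M.draw x (b + 1) ω - M.θhat n x - M.lin x (b + 1) ω‖)
      (g := fun ω => M.γ * (‖op (1 - (M.run n x).cond (b + 1) ω * M.Hhat x)‖
          * (c.lamH⁻¹ * ‖M.Gb x (b + 1 + 1) ω (M.θhat n x)‖ + ‖M.draw x (b + 1) ω - M.θhat n x‖))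
        + M.γ * c.LamP * ((M.hessSup x (b + 1 + 1) ω
            + |c.C1| * ‖M.draw x (b + 1) ω - M.θhat n x‖) * ‖M.draw x (b + 1) ω - M.θhat n x‖))
      ?_ (hm5.const_mul a) (((hm1.mul ((hm2.const_mul _).add hm3)).const_mul _).add
        (((hm4.add (hm3.const_mul _)).mul hm3).const_mul _)) hs (by positivity) (by positivity) ?_ ?_
    · filter_upwards [hM.draw_mem n x hx, hcx.cond_bounds (b + 1) (by omega),
        hcx.ae_le_hessSup hp (b + 1)] with ω h1 h2 h3
      exact norm_linearization_step_le hM.convex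
        (fun z hz => hasFDerivAt_Gb hM (b + 1 + 1) ω hz) hl hlP hLP (abs_nonneg c.C1) hHx h2 hγ hγ1
        (h1 (b + 1)) (hM.θhat_mem n x hx) h3
        (fun z hz => (hcx.hess_lip z hz).trans (by gcongr; exact le_abs_self _)) _
    · refine eLpNorm_const_mul_le_ofReal ha0 ?_
      rw [eLpNorm_norm]; exact ih
    · refine b5.trans (ENNReal.ofReal_le_ofReal ?_)
      calc _ = Q₀ * e ^ 2 := by rw [hQ₀]
        _ ≤ Q₀ * (2 * (r' ^ b + 1 / (M.m n : ℝ))) := by gcongr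
        _ = _ := by ring

end Setting

/-! ### The matrix `V_n` and the moments of the gradient noise -/

lemma phi_pos {γ : ℝ} (h0 : 0 < γ) (h1 : γ ≤ 1) : 0 < phi γ := by
  rw [phi]
  exact div_pos (by positivity) (by nlinarith)

lemma sq_div_phi {γ : ℝ} (h0 : 0 < γ) : γ ^ 2 / phi γ = 1 - (1 - γ) ^ 2 := by
  rw [phi, div_div_cancel₀ (by positivity)]

namespace Setting

variable {d : ℕ} {Z Ωs : Type*} [MeasurableSpace Z] [MeasurableSpace Ωs] (M : Setting d Z Ωs)

/-- The coordinate in direction `v` of the Newton step `H_n(θ̂_n)⁻¹ G_m^{(b)}(θ̂_n)`, the innovation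
of the linear process. -/
noncomputable def noise {n : ℕ} (x : Fin n → Z) (v : Vec d) (b : ℕ) (ω : Ωs) : ℝ :=
  inner ℝ v (act (M.Hhat x)⁻¹ (M.Gb x b ω (M.θhat n x)))

variable {M} {n : ℕ} {x : Fin n → Z} {c : Consts}

lemma measurable_noise (v : Vec d) (b : ℕ) : Measurable (M.noise x v (b + 1)) :=
  Measurable.const_inner (measurable_act (A := fun _ => (M.Hhat x)⁻¹)
    (fun _ _ => measurable_const) (measurable_Gb x b _))

lemma inner_lin_succ (v : Vec d) (b : ℕ) (ω : Ωs) :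
    inner ℝ v (M.lin x (b + 1) ω)
      = (1 - M.γ) * inner ℝ v (M.lin x b ω) + (-M.γ) * M.noise x v (b + 1) ω := by
  rw [lin, inner_sub_right, inner_smul_right, inner_smul_right, noise]; ring

lemma map_noise (v : Vec d) (b : ℕ) :
    (M.Pstar x).map (M.noise x v (b + 1)) = (M.Pstar x).map (M.noise x v 1) := by
  let F : (Fin n → ℝ) → ℝ := fun w => inner ℝ v (act (M.Hhat x)⁻¹ (wGrad M.q x w (M.θhat n x)))
  have hF : Measurable F := Measurable.const_inner (measurable_act (A := fun _ => (M.Hhat x)⁻¹)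
    (fun _ _ => measurable_const) (measurable_wGrad measurable_id measurable_const))
  have h : ∀ b, (M.Pstar x).map (M.noise x v (b + 1)) = (M.scheme.law (M.m n) n).map F := by
    intro b
    rw [← (M.run n x).w_law b, Measure.map_map hF (measurable_w x b)]
    rfl
  rw [h b, ← h 0]

/-- The innovation of iteration `b + 1` is independent of the linear process up to iteration `b`. -/
lemma indepFun_lin_noise (v : Vec d) (b : ℕ) :
    IndepFun (fun ω => inner ℝ v (M.lin x b ω)) (M.noise x v (b + 1)) (M.Pstar x) := by
  let F : (Fin n → ℝ) → ℝ := fun w => inner ℝ v (act (M.Hhat x)⁻¹ (wGrad M.q x w (M.θhat n x)))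
  have hF : Measurable F := Measurable.const_inner (measurable_act (A := fun _ => (M.Hhat x)⁻¹)
    (fun _ _ => measurable_const) (measurable_wGrad measurable_id measurable_const))
  have h1 : Measurable[(M.run n x).hist b] fun ω => (inner ℝ v (M.lin x b ω) : ℝ) :=
    Measurable.const_inner (measurable_lin_hist x b)
  have h2 : MeasurableSpace.comap (M.noise x v (b + 1)) inferInstance
      ≤ MeasurableSpace.comap ((M.run n x).w (b + 1)) inferInstance := by
    rintro s ⟨t, ht, rfl⟩
    exact ⟨F ⁻¹' t, hF ht, rfl⟩
  exact indep_of_indep_of_le_right (indep_of_indep_of_le_left ((M.run n x).w_indep b).symm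
    h1.comap_le) h2

lemma CouplingAt.memLp_Gb (hc : M.CouplingAt 2 c x (M.Hhat x)⁻¹) (hM : M.Standing)
    (hx : x ∈ M.S n) (b : ℕ) : MemLp (fun ω => M.Gb x (b + 1) ω (M.θhat n x)) 2 (M.Pstar x) := by
  refine ⟨(measurable_Gb x b _).aestronglyMeasurable, ?_⟩
  have := hc.eLpNorm_Gb_le hM hx b
  rw [eLpNorm_norm] at this
  exact this.trans_lt ENNReal.ofReal_lt_top

lemma CouplingAt.memLp_noise (hc : M.CouplingAt 2 c x (M.Hhat x)⁻¹) (hM : M.Standing)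
    (hx : x ∈ M.S n) (v : Vec d) (b : ℕ) : MemLp (M.noise x v (b + 1)) 2 (M.Pstar x) :=
  ((op (M.Hhat x)⁻¹).comp_memLp' (hc.memLp_Gb hM hx b)).const_inner v

lemma quad_VN (hH : EigBounds (M.Hhat x) c.lamH c.LamH) (v : Vec d) :
    quad (M.VN x) v = quad (M.SigmaN x) (act (M.Hhat x)⁻¹ v) := by
  rw [quad, VN, act_mul, act_mul, inner_act _ hH.isSymm_inv, quad]

lemma SigmaN_isSymm : (M.SigmaN x).IsSymm := by
  ext i j
  simp only [SigmaN, Matrix.transpose_apply, Matrix.of_apply]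
  rw [covariance_comm]

lemma VN_isSymm (hH : EigBounds (M.Hhat x) c.lamH c.LamH) : (M.VN x).IsSymm := by
  rw [Matrix.IsSymm, VN, Matrix.transpose_mul, Matrix.transpose_mul, hH.isSymm_inv.eq,
    SigmaN_isSymm.eq, Matrix.mul_assoc]

/-- Bounds for the eigenvalues of `Σ_n` carry over to `V_n`. -/
lemma VN_bounds (hH : EigBounds (M.Hhat x) c.lamH c.LamH) (hl : 0 < c.lamH) (hL : 0 < c.LamH)
    {l L : ℝ} (hl0 : 0 < l) (hS : EigBounds (M.SigmaN x) l L) :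
    EigBounds (M.VN x) (l * (c.LamH⁻¹) ^ 2) (|L| * (c.lamH⁻¹) ^ 2) := by
  refine ⟨VN_isSymm hH, fun u => ?_⟩
  rw [quad_VN hH, mul_assoc, mul_assoc, ← mul_pow, ← mul_pow]
  have h1 := hH.le_norm_act_inv hl hL u
  have h2 := hH.norm_act_inv_le hl u
  have h3 := hS.2 (act (M.Hhat x)⁻¹ u)
  constructor
  · exact le_trans (by gcongr) h3.1
  · refine h3.2.trans ?_
    calc L * ‖act (M.Hhat x)⁻¹ u‖ ^ 2 ≤ |L| * ‖act (M.Hhat x)⁻¹ u‖ ^ 2 := by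
          gcongr; exact le_abs_self _
      _ ≤ _ := by gcongr

lemma CouplingAt.m_mul_variance_noise (hc : M.CouplingAt 2 c x (M.Hhat x)⁻¹) (hM : M.Standing)
    (hx : x ∈ M.S n) (v : Vec d) :
    (M.m n : ℝ) * Var[M.noise x v 1; M.Pstar x] = quad (M.VN x) v := by
  have hH := hc.Hhat_bounds hM hx
  rw [quad_VN hH]
  set u := act (M.Hhat x)⁻¹ v with hu
  have h1 : M.noise x v 1 = fun ω => ∑ i, u i * M.Gb x 1 ω (M.θhat n x) i := by
    ext ω
    rw [noise, inner_act _ hH.isSymm_inv, ← hu, PiLp.inner_apply]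
    simp [mul_comm]
  have h2 : ∀ i, MemLp (fun ω => M.Gb x 1 ω (M.θhat n x) i) 2 (M.Pstar x) := fun i =>
    (EuclideanSpace.proj (𝕜 := ℝ) i).comp_memLp' (hc.memLp_Gb hM hx 0)
  rw [h1, variance_fun_sum (fun i => (h2 i).const_mul (u i)), quad, act,
    Matrix.inner_toEuclideanCLM, Finset.mul_sum, dotProduct]
  refine Finset.sum_congr rfl fun i _ => ?_
  rw [Matrix.mulVec, dotProduct, Finset.mul_sum, Finset.mul_sum]
  refine Finset.sum_congr rfl fun j _ => ?_
  rw [covariance_const_mul_left, covariance_const_mul_right, SigmaN, Matrix.of_apply]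
  ring

/-! ### The linear process -/

lemma CouplingAt.memLp_inner_lin (hc : M.CouplingAt 2 c x (M.Hhat x)⁻¹) (hM : M.Standing)
    (hx : x ∈ M.S n) (v : Vec d) (b : ℕ) :
    MemLp (fun ω => (inner ℝ v (M.lin x b ω) : ℝ)) 2 (M.Pstar x) := by
  induction b with
  | zero => simp [lin]
  | succ b ih =>
    simp_rw [inner_lin_succ]
    exact (ih.const_mul _).add ((hc.memLp_noise hM hx v b).const_mul _)

/-- The variances of the independent innovations add up to a geometric sum; `φ(γ)` is the factor that
normalizes its limit. -/
lemma CouplingAt.variance_inner_lin (hc : M.CouplingAt 2 c x (M.Hhat x)⁻¹) (hM : M.Standing)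
    (hx : x ∈ M.S n) (v : Vec d) (b : ℕ) :
    (M.m n : ℝ) / phi M.γ * Var[fun ω => (inner ℝ v (M.lin x b ω) : ℝ); M.Pstar x]
      = (1 - ((1 - M.γ) ^ 2) ^ b) * quad (M.VN x) v := by
  induction b with
  | zero =>
    have h0 : Var[fun _ : Ωs => (0 : ℝ); M.Pstar x] = 0 := variance_zero _
    simp [lin, h0]
  | succ b ih =>
    have hv : Var[M.noise x v (b + 1); M.Pstar x] = Var[M.noise x v 1; M.Pstar x] := by
      rw [← variance_id_map (measurable_noise v b).aemeasurable,
        ← variance_id_map (measurable_noise v 0).aemeasurable, map_noise]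
    have hi : IndepFun (fun ω => (1 - M.γ) * inner ℝ v (M.lin x b ω))
        (fun ω => (-M.γ) * M.noise x v (b + 1) ω) (M.Pstar x) :=
      (indepFun_lin_noise v b).comp (measurable_const_mul _) (measurable_const_mul _)
    simp_rw [inner_lin_succ]
    rw [IndepFun.variance_fun_add ((hc.memLp_inner_lin hM hx v b).const_mul _)
      ((hc.memLp_noise hM hx v b).const_mul _) hi, variance_const_mul, variance_const_mul, hv]
    calc _ = (1 - M.γ) ^ 2 * ((M.m n : ℝ) / phi M.γ *
            Var[fun ω => (inner ℝ v (M.lin x b ω) : ℝ); M.Pstar x])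
          + M.γ ^ 2 / phi M.γ * ((M.m n : ℝ) * Var[M.noise x v 1; M.Pstar x]) := by ring
      _ = _ := by
        rw [ih, hc.m_mul_variance_noise hM hx, sq_div_phi hM.γ_pos]; ring

/-- Solving the recursion writes the linear process as a sum of independent innovations with
geometric weights. -/
lemma charFun_inner_lin (v : Vec d) (b : ℕ) (t : ℝ) :
    charFun ((M.Pstar x).map fun ω => (inner ℝ v (M.lin x b ω) : ℝ)) t
      = ∏ k ∈ Finset.range b,
          charFun ((M.Pstar x).map (M.noise x v 1)) (-M.γ * ((1 - M.γ) ^ k * t)) := by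
  induction b generalizing t with
  | zero => simp [lin, Measure.map_const]
  | succ b ih =>
    have hi : IndepFun (fun ω => (1 - M.γ) * inner ℝ v (M.lin x b ω))
        (fun ω => (-M.γ) * M.noise x v (b + 1) ω) (M.Pstar x) :=
      (indepFun_lin_noise v b).comp (measurable_const_mul _) (measurable_const_mul _)
    have hm1 : Measurable fun ω => (inner ℝ v (M.lin x b ω) : ℝ) :=
      Measurable.const_inner (measurable_lin x b)
    have hm2 := measurable_noise (M := M) (x := x) v b
    simp_rw [inner_lin_succ]
    rw [hi.charFun_map_fun_add_eq_mul (hm1.const_mul _).aemeasurable (hm2.const_mul _).aemeasurable,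
      Pi.mul_apply, charFun_map_mul_comp hm1.aemeasurable, charFun_map_mul_comp hm2.aemeasurable,
      ih, map_noise v b, Finset.prod_range_succ']
    congr 1
    · refine Finset.prod_congr rfl fun k _ => ?_
      congr 1; ring
    · simp

end Setting

namespace Setting

variable {d : ℕ} {Z Ωs : Type*} [MeasurableSpace Z] [MeasurableSpace Ωs] {M : Setting d Z Ωs}
  {c : Consts}

/-! ### Characteristic functions -/

/-- The inverse square root of `V_n` in the expansion disappears in the directions
`τ = V_n^{1/2} v`. -/
lemma inner_sqrt_act_sqrt_inv_mul {A : Matrix (Fin d) (Fin d) ℝ} {l L : ℝ} (hA : EigBounds A l L)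
    (hl : 0 < l) (B : Matrix (Fin d) (Fin d) ℝ) (v w : Vec d) :
    inner ℝ (act (CFC.sqrt A) v) (act ((CFC.sqrt A)⁻¹ * B) w) = inner ℝ v (act B w) := by
  have hdet : IsUnit (CFC.sqrt A).det := by
    have h1 := hA.isUnit_det hl
    rw [← CFC.sqrt_mul_sqrt_self A (hA.nonneg hl), Matrix.det_mul] at h1
    exact isUnit_of_mul_isUnit_left h1
  rw [act_mul, ← inner_act _ (isSymm_sqrt A), ← act_mul, Matrix.mul_nonsing_inv _ hdet, act_one]

/-- The expansion of the characteristic function of one innovation, in scalar form. -/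
lemma CharFunExpansion.noise (hchar : M.CharFunExpansion)
    (hV : ∀ n, ∀ x ∈ M.S n, ∃ l L : ℝ, 0 < l ∧ EigBounds (M.VN x) l L) :
    ∃ β κ C : ℝ, 0 < β ∧ 0 < κ ∧ 0 ≤ C ∧ ∀ T : ℝ, ∀ᶠ n in atTop, ∀ x ∈ M.S n, ∀ (v : Vec d) (s : ℝ),
      |s| * √(quad (M.VN x) v) ≤ T → ∃ z : ℂ,
        ‖z‖ ≤ C * (|s| * √(quad (M.VN x) v)) ^ κ / (M.m n : ℝ) ^ β ∧
        charFun ((M.Pstar x).map (M.noise x v 1)) (√(M.m n) * s)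
          = Real.exp (-(s ^ 2 * quad (M.VN x) v) / 2) * (1 + z) := by
  obtain ⟨β, κ, C, hβ, -, hκ, h⟩ := hchar
  refine ⟨β, κ, |C|, hβ, hκ, abs_nonneg C, fun T => ?_⟩
  filter_upwards [h T] with n hn x hx v s hs
  obtain ⟨l, L, hl, hVb⟩ := hV n x hx
  obtain ⟨r, hr⟩ := hn x hx 1 le_rfl
  set q := quad (M.VN x) v with hq
  have hq0 : 0 ≤ q := hVb.quad_nonneg hl v
  have hτ2 : ‖act (CFC.sqrt (M.VN x)) (s • v)‖ ^ 2 = s ^ 2 * q := by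
    rw [act_smul, norm_smul, mul_pow, norm_act_sqrt_sq (hVb.nonneg hl), Real.norm_eq_abs, sq_abs]
  have hτ : ‖act (CFC.sqrt (M.VN x)) (s • v)‖ = |s| * √q := by
    rw [← Real.sqrt_sq (norm_nonneg (act (CFC.sqrt (M.VN x)) (s • v))), hτ2,
      Real.sqrt_mul (sq_nonneg s), Real.sqrt_sq_eq_abs]
  obtain ⟨h1, h2⟩ := hr _ (hτ.le.trans hs)
  refine ⟨r (act (CFC.sqrt (M.VN x)) (s • v)) / (((M.m n : ℝ) ^ β : ℝ) : ℂ), ?_, ?_⟩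
  · rw [norm_div, Complex.norm_of_nonneg (by positivity)]
    gcongr
    rw [hτ] at h1
    exact h1.trans (by gcongr; exact le_abs_self C)
  · rw [neg_div, hτ2, ← neg_div] at h2
    rw [← h2, charFun_apply_real, integral_map (measurable_noise v 0).aemeasurable
      (by fun_prop)]
    congr 1
    ext ω
    rw [inner_sqrt_act_sqrt_inv_mul hVb hl, inner_smul_left]
    congr 1
    simp only [Setting.noise]
    push_cast
    rw [conj_trivial]
    ring_nf

/-- The characteristic function of the linear process, uniformly in the sample: the variances of
the innovations add up to a geometric sum and the relative errors to a convergent series. -/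
lemma exists_charFun_inner_lin_expansion (hM : M.Standing) (hchar : M.CharFunExpansion)
    (hV : ∀ n, ∀ x ∈ M.S n, ∃ l L : ℝ, 0 < l ∧ EigBounds (M.VN x) l L) :
    ∃ β κ K : ℝ, 0 < β ∧ 0 < κ ∧ ∀ T : ℝ, ∀ᶠ n in atTop, ∀ x ∈ M.S n, ∀ (v : Vec d) (t : ℝ) (b : ℕ),
      |t| * √(quad (M.VN x) v) ≤ T → ∃ z : ℂ,
        ‖z‖ ≤ Real.exp (K * (|t| * √(quad (M.VN x) v)) ^ κ / (M.m n : ℝ) ^ β) - 1 ∧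
        charFun ((M.Pstar x).map fun ω => (inner ℝ v (M.lin x b ω) : ℝ))
            (√(M.m n / phi M.γ) * t)
          = Real.exp (-((1 - ((1 - M.γ) ^ 2) ^ b) * t ^ 2 * quad (M.VN x) v) / 2) * (1 + z) := by
  obtain ⟨β, κ, C, hβ, hκ, hC, h⟩ := hchar.noise hV
  have hγ := hM.γ_pos
  have hγ1 := hM.γ_le
  have hφ := phi_pos hγ hγ1
  set g := 1 - M.γ with hg
  have hg0 : 0 ≤ g := by rw [hg]; linarith
  have hg1 : g < 1 := by rw [hg]; linarith
  have hgκ0 : 0 ≤ g ^ κ := Real.rpow_nonneg hg0 κ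
  have hgκ : g ^ κ < 1 := Real.rpow_lt_one hg0 hg1 hκ
  refine ⟨β, κ, C * (1 - g ^ κ)⁻¹, hβ, hκ, fun T => ?_⟩
  filter_upwards [h T] with n hn x hx v t b ht
  set q := quad (M.VN x) v with hq
  have hγφ : M.γ / √(phi M.γ) ≤ 1 := by
    rw [div_le_one (Real.sqrt_pos.2 hφ)]
    apply Real.le_sqrt_of_sq_le
    have := sq_div_phi (γ := M.γ) hγ
    rw [div_eq_iff hφ.ne'] at this
    rw [this]
    exact mul_le_of_le_one_left hφ.le (by nlinarith)
  let s : ℕ → ℝ := fun k => -(M.γ / √(phi M.γ)) * (g ^ k * t)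
  have hs : ∀ k, |s k| ≤ g ^ k * |t| := fun k => by
    simp only [s]
    rw [abs_mul, abs_neg, abs_of_nonneg (by positivity), abs_mul, abs_of_nonneg (by positivity)]
    exact mul_le_of_le_one_left (by positivity) hγφ
  have hsT : ∀ k, |s k| * √q ≤ T := fun k => by
    refine le_trans ?_ ht
    exact mul_le_mul_of_nonneg_right ((hs k).trans
      (mul_le_of_le_one_left (abs_nonneg t) (pow_le_one₀ hg0 hg1.le))) (Real.sqrt_nonneg _)
  choose z hz1 hz2 using fun k => hn x hx v (s k) (hsT k)
  refine ⟨∏ k ∈ Finset.range b, (1 + z k) - 1, ?_, ?_⟩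
  · refine (Finset.norm_prod_one_add_sub_one_le _ _).trans ?_
    gcongr
    have h1 : ∀ k, ‖z k‖ ≤ (C * (|t| * √q) ^ κ / (M.m n : ℝ) ^ β) * (g ^ κ) ^ k := fun k => by
      refine (hz1 k).trans ?_
      have h2 : (|s k| * √q) ^ κ ≤ (g ^ κ) ^ k * (|t| * √q) ^ κ := by
        calc (|s k| * √q) ^ κ ≤ (g ^ k * (|t| * √q)) ^ κ := by
              refine Real.rpow_le_rpow (by positivity) ?_ hκ.le
              rw [← mul_assoc]; gcongr; exact hs k
          _ = _ := by
              rw [Real.mul_rpow (by positivity) (by positivity), Real.rpow_pow_comm hg0]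
      calc _ ≤ C * ((g ^ κ) ^ k * (|t| * √q) ^ κ) / (M.m n : ℝ) ^ β := by gcongr
        _ = _ := by ring
    calc ∑ k ∈ Finset.range b, ‖z k‖
        ≤ ∑ k ∈ Finset.range b, (C * (|t| * √q) ^ κ / (M.m n : ℝ) ^ β) * (g ^ κ) ^ k :=
          Finset.sum_le_sum fun k _ => h1 k
      _ = (C * (|t| * √q) ^ κ / (M.m n : ℝ) ^ β) * ∑ k ∈ Finset.range b, (g ^ κ) ^ k := by
          rw [Finset.mul_sum]
      _ ≤ (C * (|t| * √q) ^ κ / (M.m n : ℝ) ^ β) * (1 - g ^ κ)⁻¹ := by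
          gcongr
          rw [← tsum_geometric_of_lt_one hgκ0 hgκ]
          exact (summable_geometric_of_lt_one hgκ0 hgκ).sum_le_tsum _ fun _ _ => by positivity
      _ = _ := by ring
  · rw [charFun_inner_lin, add_sub_cancel]
    have h1 : ∀ k, charFun ((M.Pstar x).map (M.noise x v 1))
        (-M.γ * (g ^ k * (√(M.m n / phi M.γ) * t)))
        = Real.exp (-(s k ^ 2 * q) / 2) * (1 + z k) := fun k => by
      rw [← hz2 k]
      congr 1
      simp only [s]
      rw [Real.sqrt_div (Nat.cast_nonneg _)]
      ring
    rw [Finset.prod_congr rfl fun k _ => h1 k, Finset.prod_mul_distrib, ← Complex.ofReal_prod,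
      ← Real.exp_sum]
    congr 3
    have h2 : ∀ k, -(s k ^ 2 * q) / 2 = (-(t ^ 2 * q) / 2) * ((1 - g ^ 2) * (g ^ 2) ^ k) := by
      intro k
      simp only [s]
      rw [← sq_div_phi hγ, mul_pow, neg_sq, div_pow, Real.sq_sqrt hφ.le, mul_pow, ← pow_mul,
        ← pow_mul, mul_comm k 2]
      ring
    rw [Finset.sum_congr rfl fun k _ => h2 k, ← Finset.mul_sum, ← Finset.mul_sum,
      mul_neg_geom_sum]
    ring

end Setting

/-! ### Convergence of distribution functions and of quantiles -/

section Distribution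

variable {ι : Type*} {L : Filter ι} {Ω : ι → Type*} {mΩ : ∀ i, MeasurableSpace (Ω i)}
  {μ : ∀ i, Measure (Ω i)} [∀ i, IsProbabilityMeasure (μ i)]

lemma gaussianReal_real_Iic_continuous {v : NNReal} (hv : v ≠ 0) :
    Continuous fun t => (gaussianReal 0 v).real (Set.Iic t) := by
  have := nullSingletonClass_gaussianReal (μ := 0) hv
  have h : (fun t => (gaussianReal 0 v).real (Set.Iic t)) = cdf (gaussianReal 0 v) := by
    ext t; rw [cdf_eq_real]
  rw [h, continuous_iff_continuousAt]
  intro t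
  rw [continuousAt_iff_continuous_left'_right']
  refine ⟨?_, ((cdf _).right_continuous t).mono Set.Ioi_subset_Ici_self⟩
  have h1 := (cdf (gaussianReal 0 v)).measure_singleton t
  rw [measure_cdf, measure_singleton] at h1
  have h2 := ENNReal.ofReal_eq_zero.1 h1.symm
  have h3 := (monotone_cdf (gaussianReal 0 v)).leftLim_le le_rfl (x := t)
  have h4 := (monotone_cdf (gaussianReal 0 v)).tendsto_leftLim t
  rwa [le_antisymm h3 (by linarith)] at h4

lemma gaussianReal_real_Iic_strictMono {v : NNReal} (hv : v ≠ 0) :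
    StrictMono fun t => (gaussianReal 0 v).real (Set.Iic t) := by
  intro s t hst
  have := (gaussianReal_absolutelyContinuous' 0 hv).isOpenPosMeasure
  have h1 : 0 < (gaussianReal 0 v) (Set.Ioo s t) :=
    isOpen_Ioo.measure_pos _ (Set.nonempty_Ioo.2 hst)
  have h2 : 0 < (gaussianReal 0 v).real (Set.Ioo s t) :=
    ENNReal.toReal_pos h1.ne' (measure_ne_top _ _)
  have h3 : (gaussianReal 0 v).real (Set.Iic s ∪ Set.Ioo s t)
      = (gaussianReal 0 v).real (Set.Iic s) + (gaussianReal 0 v).real (Set.Ioo s t) :=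
    measureReal_union (Set.disjoint_left.2 fun x hx hx' => absurd hx'.1 (not_lt.2 hx))
      measurableSet_Ioo
  have h4 : (gaussianReal 0 v).real (Set.Iic s ∪ Set.Ioo s t) ≤ (gaussianReal 0 v).real (Set.Iic t) :=
    measureReal_mono (Set.union_subset (Set.Iic_subset_Iic.2 hst.le) fun x hx => hx.2.le)
  change (gaussianReal 0 v).real (Set.Iic s) < (gaussianReal 0 v).real (Set.Iic t)
  linarith

lemma exists_gaussianReal_real_Iic_eq {v : NNReal} (hv : v ≠ 0) {α : ℝ} (h0 : 0 < α) (h1 : α < 1) :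
    ∃ z, (gaussianReal 0 v).real (Set.Iic z) = α := by
  obtain ⟨s, hs⟩ := ((tendsto_cdf_atBot (gaussianReal 0 v)).eventually_lt_const h0).exists
  obtain ⟨t, ht⟩ := ((tendsto_cdf_atTop (gaussianReal 0 v)).eventually_const_lt h1).exists
  rw [cdf_eq_real] at hs ht
  exact mem_range_of_exists_le_of_exists_ge (gaussianReal_real_Iic_continuous hv) ⟨s, hs.le⟩
    ⟨t, ht.le⟩

/-- Lévy's continuity theorem along a countably generated filter, for a Gaussian limit, in terms of
distribution functions. -/
lemma tendsto_real_le_of_tendsto_charFun [L.IsCountablyGenerated] {X : ∀ i, Ω i → ℝ}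
    (hX : ∀ i, AEMeasurable (X i) (μ i)) {v : NNReal} (hv : v ≠ 0)
    (h : ∀ t, Tendsto (fun i => charFun ((μ i).map (X i)) t) L
      (𝓝 (charFun (gaussianReal 0 v) t))) (t : ℝ) :
    Tendsto (fun i => (μ i).real {ω | X i ω ≤ t}) L (𝓝 ((gaussianReal 0 v).real (Set.Iic t))) := by
  refine tendsto_of_seq_tendsto fun u hu => ?_
  have := nullSingletonClass_gaussianReal (μ := 0) hv
  have hP : ∀ i, IsProbabilityMeasure ((μ i).map (X i)) := fun i =>
    Measure.isProbabilityMeasure_map (hX i)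
  let ν : ℕ → ProbabilityMeasure ℝ := fun k => ⟨(μ (u k)).map (X (u k)), hP _⟩
  let ν₀ : ProbabilityMeasure ℝ := ⟨gaussianReal 0 v, inferInstance⟩
  have h1 : Tendsto ν atTop (𝓝 ν₀) :=
    ProbabilityMeasure.tendsto_of_tendsto_charFun fun t => (h t).comp hu
  have h2 := ProbabilityMeasure.tendsto_measure_of_null_frontier_of_tendsto' h1
    (E := Set.Iic t) (by rw [frontier_Iic]; exact measure_singleton (μ := gaussianReal 0 v) t)
  have h3 := (ENNReal.tendsto_toReal (measure_ne_top _ _)).comp h2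
  refine h3.congr fun k => ?_
  change ((μ (u k)).map (X (u k)) (Set.Iic t)).toReal = _
  rw [Measure.map_apply_of_aemeasurable (hX _) measurableSet_Iic]
  rfl

/-- A perturbation that vanishes in probability does not change the limit of the distribution
functions. No measurability of the perturbed variables is needed. -/
lemma tendsto_real_le_of_close {X W : ∀ i, Ω i → ℝ} {F : ℝ → ℝ} (hF : Continuous F)
    (hX : ∀ t, Tendsto (fun i => (μ i).real {ω | X i ω ≤ t}) L (𝓝 (F t)))
    (hW : ∀ ε, 0 < ε → Tendsto (fun i => (μ i).real {ω | ε ≤ |W i ω - X i ω|}) L (𝓝 0)) (t : ℝ) :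
    Tendsto (fun i => (μ i).real {ω | W i ω ≤ t}) L (𝓝 (F t)) := by
  rw [tendsto_order]
  constructor
  · intro a ha
    obtain ⟨ε, hε, h1⟩ : ∃ ε > 0, a < F (t - ε) := by
      have h2 : Tendsto (fun ε => F (t - ε)) (𝓝[>] 0) (𝓝 (F t)) := by
        have : Tendsto (fun ε => F (t - ε)) (𝓝 0) (𝓝 (F (t - 0))) :=
          (hF.comp (continuous_const.sub continuous_id)).tendsto 0
        rw [sub_zero] at this
        exact this.mono_left nhdsWithin_le_nhds
      obtain ⟨ε, h3, h4⟩ := ((h2.eventually_const_lt ha).and self_mem_nhdsWithin).exists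
      exact ⟨ε, h4, h3⟩
    have h5 := (hX (t - ε)).sub (hW ε hε)
    rw [sub_zero] at h5
    filter_upwards [h5.eventually_const_lt h1] with i hi
    have h6 : {ω | X i ω ≤ t - ε} ⊆ {ω | W i ω ≤ t} ∪ {ω | ε ≤ |W i ω - X i ω|} := by
      intro ω hω
      by_contra hcon
      simp only [Set.mem_union, Set.mem_ofPred_eq, not_or, not_le] at hcon hω
      linarith [le_abs_self (W i ω - X i ω)]
    have h7 := (measureReal_mono h6 (measure_ne_top (μ i) _)).trans (measureReal_union_le _ _)
    linarith
  · intro a ha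
    obtain ⟨ε, hε, h1⟩ : ∃ ε > 0, F (t + ε) < a := by
      have h2 : Tendsto (fun ε => F (t + ε)) (𝓝[>] 0) (𝓝 (F t)) := by
        have : Tendsto (fun ε => F (t + ε)) (𝓝 0) (𝓝 (F (t + 0))) :=
          (hF.comp (continuous_const.add continuous_id)).tendsto 0
        rw [add_zero] at this
        exact this.mono_left nhdsWithin_le_nhds
      obtain ⟨ε, h3, h4⟩ := ((h2.eventually_lt_const ha).and self_mem_nhdsWithin).exists
      exact ⟨ε, h4, h3⟩
    have h5 := (hX (t + ε)).add (hW ε hε)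
    rw [add_zero] at h5
    filter_upwards [h5.eventually_lt_const h1] with i hi
    have h6 : {ω | W i ω ≤ t} ⊆ {ω | X i ω ≤ t + ε} ∪ {ω | ε ≤ |W i ω - X i ω|} := by
      intro ω hω
      by_contra hcon
      simp only [Set.mem_union, Set.mem_ofPred_eq, not_or, not_le] at hcon hω
      linarith [neg_abs_le (W i ω - X i ω)]
    have h7 := (measureReal_mono h6 (measure_ne_top (μ i) _)).trans (measureReal_union_le _ _)
    linarith

/-- Convergence of the distribution functions of `s X`, with scale factors `s > 0`, to a strictly
increasing one implies convergence of the scaled quantiles of `X`. -/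
lemma tendsto_mul_quantile {X : ∀ i, Ω i → ℝ} {s : ι → ℝ} (hs : ∀ᶠ i in L, 0 < s i) {F : ℝ → ℝ}
    (hF : StrictMono F)
    (hX : ∀ t, Tendsto (fun i => (μ i).real {ω | s i * X i ω ≤ t}) L (𝓝 (F t))) (z : ℝ) :
    Tendsto (fun i => s i * quantile (μ i) (X i) (F z)) L (𝓝 z) := by
  rw [Metric.tendsto_nhds]
  intro ε hε
  have h1 : F (z - ε / 2) < F z := hF (by linarith)
  have h2 : F z < F (z + ε / 2) := hF (by linarith)
  filter_upwards [hs, (hX _).eventually_lt_const h1, (hX _).eventually_const_lt h2]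
    with i hi hlo hup
  set A := {t : ℝ | F z ≤ (μ i).real {ω | X i ω ≤ t}} with hA
  have h3 : ∀ t ∈ A, (z - ε / 2) / s i ≤ t := by
    intro t ht
    by_contra! hcon
    rw [lt_div_iff₀ hi] at hcon
    have h4 : {ω | X i ω ≤ t} ⊆ {ω | s i * X i ω ≤ z - ε / 2} := fun ω hω => by
      have := mul_le_mul_of_nonneg_left (show X i ω ≤ t from hω) hi.le
      simp only [Set.mem_ofPred_eq]
      linarith
    have h5 := measureReal_mono h4 (measure_ne_top (μ i) _)
    have h6 : F z ≤ (μ i).real {ω | X i ω ≤ t} := ht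
    linarith
  have h4 : (z + ε / 2) / s i ∈ A := by
    have h5 : {ω | X i ω ≤ (z + ε / 2) / s i} = {ω | s i * X i ω ≤ z + ε / 2} := by
      ext ω
      simp only [Set.mem_ofPred_eq]
      rw [le_div_iff₀ hi, mul_comm]
    rw [hA, Set.mem_ofPred_eq, h5]
    exact hup.le
  have h5 : quantile (μ i) (X i) (F z) ≤ (z + ε / 2) / s i := csInf_le ⟨_, h3⟩ h4
  have h6 : (z - ε / 2) / s i ≤ quantile (μ i) (X i) (F z) := le_csInf ⟨_, h4⟩ h3
  rw [le_div_iff₀ hi] at h5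
  rw [div_le_iff₀ hi] at h6
  rw [Real.dist_eq, abs_lt]
  constructor <;> linarith

/-- If the random bounds `c₁`, `c₂` converge in probability to the constants `z₁ < z₂`, then the
probability of `c₁ ≤ T ≤ c₂` converges to that of the fixed interval. The bounds need not be
measurable. -/
lemma tendsto_real_between {T c₁ c₂ : ∀ i, Ω i → ℝ} {F : ℝ → ℝ} (hF : Continuous F)
    (hTm : ∀ᶠ i in L, AEMeasurable (T i) (μ i)) {z₁ z₂ : ℝ} (hz : z₁ < z₂)
    (hT : ∀ t, Tendsto (fun i => (μ i).real {ω | T i ω ≤ t}) L (𝓝 (F t)))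
    (h₁ : ∀ ε, 0 < ε → Tendsto (fun i => (μ i).real {ω | ε ≤ |c₁ i ω - z₁|}) L (𝓝 0))
    (h₂ : ∀ ε, 0 < ε → Tendsto (fun i => (μ i).real {ω | ε ≤ |c₂ i ω - z₂|}) L (𝓝 0)) :
    Tendsto (fun i => (μ i).real {ω | c₁ i ω ≤ T i ω ∧ T i ω ≤ c₂ i ω}) L
      (𝓝 (F z₂ - F z₁)) := by
  rw [tendsto_order]
  constructor
  · intro a ha
    obtain ⟨ε, hε, h1⟩ : ∃ ε > 0, a < F (z₂ - ε) - F (z₁ + ε) := by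
      have h2 : Tendsto (fun ε => F (z₂ - ε) - F (z₁ + ε)) (𝓝[>] 0) (𝓝 (F z₂ - F z₁)) := by
        have : Tendsto (fun ε => F (z₂ - ε) - F (z₁ + ε)) (𝓝 0) (𝓝 (F (z₂ - 0) - F (z₁ + 0))) :=
          ((hF.comp (continuous_const.sub continuous_id)).sub
            (hF.comp (continuous_const.add continuous_id))).tendsto 0
        rw [sub_zero, add_zero] at this
        exact this.mono_left nhdsWithin_le_nhds
      obtain ⟨ε, h3, h4⟩ := ((h2.eventually_const_lt ha).and self_mem_nhdsWithin).exists
      exact ⟨ε, h4, h3⟩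
    have h5 := (((hT (z₂ - ε)).sub (hT (z₁ + ε))).sub (h₁ ε hε)).sub (h₂ ε hε)
    rw [sub_zero, sub_zero] at h5
    filter_upwards [h5.eventually_const_lt h1] with i hi
    have h6 : {ω | T i ω ≤ z₂ - ε} ⊆ {ω | c₁ i ω ≤ T i ω ∧ T i ω ≤ c₂ i ω} ∪
        {ω | T i ω ≤ z₁ + ε} ∪ {ω | ε ≤ |c₁ i ω - z₁|} ∪ {ω | ε ≤ |c₂ i ω - z₂|} := by
      intro ω hω
      by_contra hcon
      simp only [Set.mem_union, Set.mem_ofPred_eq, not_or, not_le] at hcon hω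
      obtain ⟨⟨⟨h7, h8⟩, h9⟩, h10⟩ := hcon
      rw [abs_lt] at h9 h10
      exact h7 ⟨by linarith, by linarith⟩
    have h7 := measureReal_mono h6 (measure_ne_top (μ i) _)
    have h8 := h7.trans ((measureReal_union_le _ _).trans (add_le_add_left
      ((measureReal_union_le _ _).trans (add_le_add_left (measureReal_union_le _ _) _)) _))
    linarith
  · intro a ha
    obtain ⟨ε, hε, h1⟩ : ∃ ε > 0, F (z₂ + ε) - F (z₁ - 2 * ε) < a := by
      have h2 : Tendsto (fun ε => F (z₂ + ε) - F (z₁ - 2 * ε)) (𝓝[>] 0) (𝓝 (F z₂ - F z₁)) := by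
        have : Tendsto (fun ε => F (z₂ + ε) - F (z₁ - 2 * ε)) (𝓝 0)
            (𝓝 (F (z₂ + 0) - F (z₁ - 2 * 0))) :=
          ((hF.comp (continuous_const.add continuous_id)).sub
            (hF.comp (continuous_const.sub (continuous_const.mul continuous_id)))).tendsto 0
        rw [mul_zero, sub_zero, add_zero] at this
        exact this.mono_left nhdsWithin_le_nhds
      obtain ⟨ε, h3, h4⟩ := ((h2.eventually_lt_const ha).and self_mem_nhdsWithin).exists
      exact ⟨ε, h4, h3⟩
    have h5 := (((hT (z₂ + ε)).sub (hT (z₁ - 2 * ε))).add (h₁ ε hε)).add (h₂ ε hε)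
    rw [add_zero, add_zero] at h5
    filter_upwards [h5.eventually_lt_const h1, hTm] with i hi hm
    have h6 : {ω | c₁ i ω ≤ T i ω ∧ T i ω ≤ c₂ i ω} ⊆
        ({ω | T i ω ≤ z₂ + ε} \ {ω | T i ω ≤ z₁ - 2 * ε}) ∪
          {ω | ε ≤ |c₁ i ω - z₁|} ∪ {ω | ε ≤ |c₂ i ω - z₂|} := by
      intro ω hω
      by_contra hcon
      simp only [Set.mem_union, Set.mem_sdiff, Set.mem_ofPred_eq, not_or, not_and, not_le]
        at hcon hω
      obtain ⟨⟨h8, h9⟩, h10⟩ := hcon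
      rw [abs_lt] at h9 h10
      have := h8 (by linarith)
      linarith
    have h7 := measureReal_mono h6 (measure_ne_top (μ i) _)
    have h8 := h7.trans ((measureReal_union_le _ _).trans
      (add_le_add_left (measureReal_union_le _ _) _))
    have hsub : {ω | T i ω ≤ z₁ - 2 * ε} ⊆ {ω | T i ω ≤ z₂ + ε} := fun ω hω => by
      simp only [Set.mem_ofPred_eq] at hω ⊢
      linarith
    have h9 : (μ i).real ({ω | T i ω ≤ z₂ + ε} \ {ω | T i ω ≤ z₁ - 2 * ε})
        = (μ i).real {ω | T i ω ≤ z₂ + ε} - (μ i).real {ω | T i ω ≤ z₁ - 2 * ε} := by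
      rw [measureReal_def, measure_sdiff hsub (nullMeasurableSet_le hm aemeasurable_const)
        (measure_ne_top _ _), ENNReal.toReal_sub_of_le (measure_mono hsub) (measure_ne_top _ _)]
      rfl
    linarith

/-- Markov's inequality for a nonnegative variable whose `L_p` norm is bounded by `a`. -/
lemma measureReal_le_of_eLpNorm {Ω : Type*} [MeasurableSpace Ω] {ν : Measure Ω}
    [IsProbabilityMeasure ν] {p : ℝ≥0∞} (hp : 1 ≤ p) {f : Ω → ℝ} (hf : Measurable f)
    (hf0 : ∀ ω, 0 ≤ f ω) {a k e : ℝ} (ha : 0 ≤ a) (hk : 0 ≤ k) (he : 0 < e)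
    (h : eLpNorm f p ν ≤ ENNReal.ofReal a) : ν.real {ω | e ≤ k * f ω} ≤ k * a / e := by
  have h1 : ENNReal.ofReal e * ν {ω | e ≤ k * f ω} ≤ ENNReal.ofReal (k * a) := by
    calc ENNReal.ofReal e * ν {ω | e ≤ k * f ω}
        ≤ ENNReal.ofReal e * ν {ω | ENNReal.ofReal e ≤ ‖k * f ω‖ₑ} := by
          gcongr with ω
          intro hω
          have h0 := hf0 ω
          rw [Real.enorm_of_nonneg (by positivity)]
          exact ENNReal.ofReal_le_ofReal hω
      _ ≤ ∫⁻ ω, ‖k * f ω‖ₑ ∂ν := mul_meas_ge_le_lintegral (hf.const_mul k).enorm _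
      _ = eLpNorm (fun ω => k * f ω) 1 ν := by rw [eLpNorm_one_eq_lintegral_enorm]
      _ ≤ eLpNorm (fun ω => k * f ω) p ν :=
          eLpNorm_le_eLpNorm_of_exponent_le hp (hf.const_mul k).aestronglyMeasurable
      _ ≤ _ := eLpNorm_const_mul_le_ofReal hk h
  rw [le_div_iff₀ he, mul_comm]
  have h2 := ENNReal.toReal_mono ENNReal.ofReal_ne_top h1
  rwa [ENNReal.toReal_mul, ENNReal.toReal_ofReal he.le, ENNReal.toReal_ofReal (by positivity)] at h2

end Distribution

namespace Setting

variable {d : ℕ} {Z Ωs : Type*} [MeasurableSpace Z] [MeasurableSpace Ωs] (M : Setting d Z Ωs)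

/-! ### Filters on samples -/

/-- The filter of `n → ∞`, uniformly over the samples in `S n`. -/
noncomputable def sampleFilter : Filter (Σ n, Fin n → Z) :=
  comap Sigma.fst atTop ⊓ 𝓟 {i | i.2 ∈ M.S i.1}

instance : M.sampleFilter.IsCountablyGenerated := by
  unfold sampleFilter; infer_instance

/-- The filter of the properties that hold with probability tending to one; convergence along it is
convergence in probability. -/
noncomputable def whpFilter : Filter (Σ n, Fin n → Z) where
  sets := {s | Tendsto (fun n => M.P n {x | (⟨n, x⟩ : Σ n, Fin n → Z) ∉ s}) atTop (𝓝 0)}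
  univ_sets := by simp
  sets_of_superset := fun {s t} hs hst =>
    tendsto_of_tendsto_of_tendsto_of_le_of_le tendsto_const_nhds hs (fun _ => zero_le)
      fun n => measure_mono fun _ hx hxs => hx (hst hxs)
  inter_sets := fun {s t} hs ht => by
    have h := Tendsto.add (show Tendsto _ _ _ from hs) (show Tendsto _ _ _ from ht)
    rw [add_zero] at h
    refine tendsto_of_tendsto_of_tendsto_of_le_of_le tendsto_const_nhds h (fun _ => zero_le)
      fun n => le_trans (measure_mono fun x hx => ?_) (measure_union_le _ _)
    by_contra hcon
    simp only [Set.mem_union, Set.mem_ofPred_eq, not_or, not_not] at hcon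
    exact hx hcon

variable {M}

lemma eventually_whpFilter {p : (Σ n, Fin n → Z) → Prop} : (∀ᶠ i in M.whpFilter, p i) ↔
    Tendsto (fun n => M.P n {x | ¬ p ⟨n, x⟩}) atTop (𝓝 0) := Iff.rfl

lemma eventually_sampleFilter {p : (Σ n, Fin n → Z) → Prop} : (∀ᶠ i in M.sampleFilter, p i) ↔
    ∀ᶠ n in atTop, ∀ x ∈ M.S n, p ⟨n, x⟩ := by
  rw [sampleFilter, eventually_inf_principal, eventually_comap]
  refine eventually_congr (Eventually.of_forall fun n => ?_)
  constructor
  · intro h x hx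
    exact h ⟨n, x⟩ rfl hx
  · rintro h ⟨k, x⟩ rfl hx
    exact h x hx

lemma eventually_sampleFilter_of {p : ∀ n, (Fin n → Z) → Prop}
    (h : ∀ᶠ n in atTop, ∀ x ∈ M.S n, p n x) : ∀ᶠ i in M.sampleFilter, p i.1 i.2 :=
  eventually_sampleFilter.2 h

lemma tendsto_fst_sampleFilter : Tendsto Sigma.fst M.sampleFilter atTop :=
  tendsto_comap.mono_left inf_le_left

lemma whpFilter_le_sampleFilter (hM : M.Standing) : M.whpFilter ≤ M.sampleFilter := by
  refine le_inf (tendsto_iff_comap.1 ?_) (le_principal_iff.2 hM.S_prob)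
  rw [tendsto_atTop]
  intro N
  refine eventually_whpFilter.2 (tendsto_const_nhds.congr' ?_)
  filter_upwards [eventually_ge_atTop N] with n hn
  simp [hn]

lemma whpFilter_neBot [∀ n, IsProbabilityMeasure (M.P n)] : M.whpFilter.NeBot := by
  rw [neBot_iff]
  intro h
  have h1 : (∅ : Set (Σ n, Fin n → Z)) ∈ M.whpFilter := by rw [h]; exact mem_bot
  have h2 : Tendsto (fun n => M.P n Set.univ) atTop (𝓝 0) := by
    simpa using eventually_whpFilter (M := M) (p := fun _ => False) |>.1 h1
  simp only [measure_univ] at h2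
  exact one_ne_zero (tendsto_nhds_unique tendsto_const_nhds h2)

lemma tendsto_real_of_tendsto_whpFilter [∀ n, IsProbabilityMeasure (M.P n)]
    {f : (Σ n, Fin n → Z) → ℝ} {a : ℝ} (h : Tendsto f M.whpFilter (𝓝 a)) (ε : ℝ) (hε : 0 < ε) :
    Tendsto (fun n => (M.P n).real {x | ε ≤ |f ⟨n, x⟩ - a|}) atTop (𝓝 0) := by
  have h1 := eventually_whpFilter.1 (Metric.tendsto_nhds.1 h ε hε)
  have h2 := (ENNReal.tendsto_toReal ENNReal.zero_ne_top).comp h1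
  simpa [Real.dist_eq, Function.comp_def, Measure.real] using h2

/-! ### The bootstrap distribution -/

section Bootstrap

variable {c : Consts} {b : ℕ → ℕ} {L : Filter (Σ n, Fin n → Z)}

/-- The transient of the algorithm is negligible: `√m r^b → 0` as soon as `log m = o(b)`. -/
lemma tendsto_sqrt_m_mul_pow (hm : Tendsto M.m atTop atTop) (hb : Tendsto b atTop atTop)
    (hlog : Tendsto (fun n => Real.log (M.m n) / (b n : ℝ)) atTop (𝓝 0)) {r : ℝ} (hr0 : 0 ≤ r)
    (hr1 : r < 1) : Tendsto (fun n => √(M.m n) * r ^ (b n - 1)) atTop (𝓝 0) := by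
  -- A positive ratio `s` makes `log s` meaningful.
  set s := max r (1 / 2) with hs
  have hs0 : 0 < s := lt_of_lt_of_le (by norm_num) (le_max_right _ _)
  have hs1 : s < 1 := max_lt hr1 (by norm_num)
  have hlogs : Real.log s < 0 := Real.log_neg hs0 hs1
  have hbR : Tendsto (fun n => (b n : ℝ)) atTop atTop := tendsto_natCast_atTop_atTop.comp hb
  have h1 : Tendsto (fun n => s⁻¹ * Real.exp ((b n : ℝ) *
      (Real.log (M.m n) / (b n : ℝ) / 2 + Real.log s))) atTop (𝓝 0) := by
    have h2 : Tendsto (fun n => Real.log (M.m n) / (b n : ℝ) / 2 + Real.log s) atTop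
        (𝓝 (Real.log s)) := by simpa using (hlog.div_const 2).add_const (Real.log s)
    simpa using (Real.tendsto_exp_atBot.comp (hbR.atTop_mul_neg hlogs h2)).const_mul s⁻¹
  refine tendsto_of_tendsto_of_tendsto_of_le_of_le' tendsto_const_nhds h1
    (Eventually.of_forall fun n => by positivity) ?_
  filter_upwards [hm.eventually_ge_atTop 1, hb.eventually_ge_atTop 1] with n hmn hbn
  have hm0 : (0 : ℝ) < M.m n := by exact_mod_cast hmn
  have hb0 : (b n : ℝ) ≠ 0 := by
    have : b n ≠ 0 := by omega
    exact_mod_cast this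
  calc √(M.m n) * r ^ (b n - 1) ≤ √(M.m n) * s ^ (b n - 1) := by
        gcongr; exact le_max_left _ _
    _ = √(M.m n) * (s⁻¹ * s ^ (b n)) := by
        congr 1
        obtain ⟨k, hk⟩ : ∃ k, b n = k + 1 := ⟨b n - 1, by omega⟩
        rw [hk, Nat.add_sub_cancel, pow_succ]
        field_simp
    _ = s⁻¹ * (Real.exp (Real.log (M.m n) / 2) * Real.exp (b n * Real.log s)) := by
        rw [Real.exp_half, Real.exp_log hm0, Real.exp_nat_mul, Real.exp_log hs0]
        ring
    _ = _ := by
        rw [← Real.exp_add]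
        congr 2
        field_simp

lemma exists_VN_bounds (hM : M.Standing) (hcA : c.Admissible M.γ)
    (hc : ∀ n, ∀ x ∈ M.S n, M.CouplingAt 2 c x (M.Hhat x)⁻¹) (hH : c.lamH ≤ c.LamH)
    (hSigma : M.SigmaRegular) : ∃ l L : ℝ, 0 < l ∧ ∀ n, ∀ x ∈ M.S n, EigBounds (M.VN x) l L := by
  obtain ⟨l, L, hl, h⟩ := hSigma
  have h0 := hcA.lamH_pos
  have h1 := h0.trans_le hH
  exact ⟨_, _, by positivity, fun n x hx =>
    VN_bounds ((hc n x hx).Hhat_bounds hM hx) h0 h1 hl (h n x hx)⟩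

/-- The scaled linear process is asymptotically normal in every direction, along any filter of
samples on which its variance converges. -/
lemma tendsto_charFun_lin (hM : M.Standing) (hm : Tendsto M.m atTop atTop)
    (hb : Tendsto b atTop atTop) (hchar : M.CharFunExpansion)
    (hV : ∃ l L : ℝ, 0 < l ∧ ∀ n, ∀ x ∈ M.S n, EigBounds (M.VN x) l L) (hL : L ≤ M.sampleFilter)
    {v : Vec d} {q : ℝ} (hq0 : 0 ≤ q)
    (hq : Tendsto (fun i : Σ n, Fin n → Z => quad (M.VN i.2) v) L (𝓝 q)) (t : ℝ) :
    Tendsto (fun i : Σ n, Fin n → Z => charFun ((M.Pstar i.2).map fun ω =>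
        √(M.m i.1 / phi M.γ) * inner ℝ v (M.lin i.2 (b i.1) ω)) t) L
      (𝓝 (charFun (gaussianReal 0 q.toNNReal) t)) := by
  obtain ⟨lV, LV, hlV, hVb⟩ := hV
  obtain ⟨β, κ, K, hβ, hκ, h⟩ := exists_charFun_inner_lin_expansion hM hchar
    (fun n x hx => ⟨lV, LV, hlV, hVb n x hx⟩)
  have hγ := hM.γ_pos
  have hγ1 := hM.γ_le
  have hn : Tendsto (fun i : Σ n, Fin n → Z => i.1) L atTop := tendsto_fst_sampleFilter.mono_left hL
  set g := 1 - M.γ with hg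
  let E : (Σ n, Fin n → Z) → ℝ := fun i =>
    Real.exp (-((1 - (g ^ 2) ^ b i.1) * t ^ 2 * quad (M.VN i.2) v) / 2)
  let B : (Σ n, Fin n → Z) → ℝ := fun i =>
    Real.exp (K * (|t| * √(quad (M.VN i.2) v)) ^ κ / (M.m i.1 : ℝ) ^ β) - 1
  have hE : Tendsto E L (𝓝 (Real.exp (-(t ^ 2 * q) / 2))) := by
    have h1 : Tendsto (fun i : Σ n, Fin n → Z => (g ^ 2) ^ b i.1) L (𝓝 0) :=
      (tendsto_pow_atTop_nhds_zero_of_lt_one (sq_nonneg g)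
        (by rw [sq_lt_one_iff_abs_lt_one, abs_lt]; constructor <;> rw [hg] <;> linarith)).comp
        (hb.comp hn)
    have h2 : Tendsto (fun i : Σ n, Fin n → Z =>
        -((1 - (g ^ 2) ^ b i.1) * t ^ 2 * quad (M.VN i.2) v) / 2) L
        (𝓝 (-((1 - 0) * t ^ 2 * q) / 2)) :=
      ((((h1.const_sub 1).mul_const (t ^ 2)).mul hq).neg).div_const 2
    have h3 := (Real.continuous_exp.tendsto _).comp h2
    rw [sub_zero, one_mul] at h3
    exact h3
  have hB : Tendsto B L (𝓝 0) := by
    have h1 : Tendsto (fun i : Σ n, Fin n → Z => K * (|t| * √(quad (M.VN i.2) v)) ^ κ) L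
        (𝓝 (K * (|t| * √q) ^ κ)) :=
      ((hq.sqrt.const_mul |t|).rpow_const (Or.inr hκ.le)).const_mul K
    have h2 : Tendsto (fun i : Σ n, Fin n → Z => (M.m i.1 : ℝ) ^ β) L atTop :=
      (tendsto_rpow_atTop hβ).comp (tendsto_natCast_atTop_atTop.comp (hm.comp hn))
    have h3 := (Real.continuous_exp.tendsto _).comp (h1.div_atTop h2)
    simpa using h3.sub_const 1
  have hclose : ∀ᶠ i in L, ‖charFun ((M.Pstar i.2).map fun ω =>
      √(M.m i.1 / phi M.γ) * inner ℝ v (M.lin i.2 (b i.1) ω)) t - (E i : ℂ)‖ ≤ E i * B i := by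
    filter_upwards [hL (eventually_sampleFilter_of (h (|t| * √(q + 1)))),
      hq.eventually_lt_const (lt_add_one q)] with i hi hqi
    obtain ⟨z, hz1, hz2⟩ := hi v t (b i.1) (by gcongr)
    rw [charFun_map_mul_comp (Measurable.const_inner (measurable_lin i.2 (b i.1))).aemeasurable,
      hz2, mul_add, mul_one, add_sub_cancel_left, norm_mul, Complex.norm_of_nonneg (by positivity)]
    exact mul_le_mul_of_nonneg_left hz1 (Real.exp_nonneg _)
  have h0 := hE.mul hB
  rw [mul_zero] at h0
  have h4 := (squeeze_zero_norm' hclose h0).add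
    ((Complex.continuous_ofReal.tendsto _).comp hE)
  have h5 : (0 : ℂ) + ((Real.exp (-(t ^ 2 * q) / 2) : ℝ) : ℂ)
      = charFun (gaussianReal 0 q.toNNReal) t := by
    rw [charFun_gaussianReal, Real.coe_toNNReal _ hq0]
    push_cast
    rw [zero_add]
    congr 1
    ring
  rw [← h5]
  refine h4.congr fun i => ?_
  simp

/-- For one sample, the scaled statistic `h(θ̃_b) - h(θ̂_n)` is close to the linear process in the
direction of the gradient of `h`: the three terms account for leaving the neighbourhood where `h`
is almost linear, for the linearization of `h` there, and for the linearization of the algorithm. -/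
lemma measureReal_statistic_sub_lin_le (hM : M.Standing) {h : Vec d → ℝ} {v : Vec d} {δ η ε : ℝ}
    (hδ0 : 0 < δ) (hη0 : 0 < η) (hε : 0 < ε)
    (hδ : ∀ θ θ' : Vec d, ‖θ - M.θdag‖ < δ → ‖θ' - M.θdag‖ < δ →
      |h θ - h θ' - inner ℝ v (θ - θ')| ≤ η * ‖θ - θ'‖)
    {n : ℕ} {x : Fin n → Z} (hm : 1 ≤ M.m n) (hθ : ‖M.θhat n x - M.θdag‖ < δ / 2) {b : ℕ}
    {A A' : ℝ} (hA : 0 ≤ A) (hA' : 0 ≤ A')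
    (hY : eLpNorm (fun ω => ‖M.draw x b ω - M.θhat n x‖) 2 (M.Pstar x) ≤ ENNReal.ofReal A)
    (hD : eLpNorm (fun ω => M.draw x b ω - M.θhat n x - M.lin x b ω) 1 (M.Pstar x)
      ≤ ENNReal.ofReal A') :
    (M.Pstar x).real {ω | ε ≤ |√n * (h (M.adjDraw x b ω) - h (M.θhat n x))
        - √(M.m n / phi M.γ) * inner ℝ v (M.lin x b ω)|}
      ≤ √(1 / phi M.γ) * A / (δ / 2) + η * √(M.m n / phi M.γ) * A / (ε / 2)
        + √(M.m n / phi M.γ) * ‖v‖ * A' / (ε / 2) := by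
  have hφ := phi_pos hM.γ_pos hM.γ_le
  have hmn : (M.m n : ℝ) ≤ n := by exact_mod_cast hM.m_le n
  have hm0 : (0 : ℝ) < M.m n := by exact_mod_cast hm
  have hn0 : (0 : ℝ) < n := hm0.trans_le hmn
  set s := √(M.m n / (n * phi M.γ)) with hs
  set K := √(M.m n / phi M.γ) with hK
  have hs0 : 0 ≤ s := Real.sqrt_nonneg _
  have hK0 : 0 ≤ K := Real.sqrt_nonneg _
  have hsk : s ≤ √(1 / phi M.γ) := by
    apply Real.sqrt_le_sqrt
    rw [div_le_div_iff₀ (by positivity) hφ]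
    nlinarith
  have hnK : √n * s = K := by
    rw [hs, hK, ← Real.sqrt_mul hn0.le]
    congr 1
    field_simp
  have mY : Measurable fun ω => ‖M.draw x b ω - M.θhat n x‖ :=
    ((measurable_draw x b).sub measurable_const).norm
  have mD : Measurable fun ω => ‖M.draw x b ω - M.θhat n x - M.lin x b ω‖ :=
    (((measurable_draw x b).sub measurable_const).sub (measurable_lin x b)).norm
  rw [← eLpNorm_norm] at hD
  have b1 := measureReal_le_of_eLpNorm (k := √(1 / phi M.γ)) (e := δ / 2) one_le_two mY
    (fun _ => norm_nonneg _) hA (Real.sqrt_nonneg _) (by positivity) hY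
  have b2 := measureReal_le_of_eLpNorm (k := η * K) (e := ε / 2) one_le_two mY
    (fun _ => norm_nonneg _) hA (by positivity) (by positivity) hY
  have b3 := measureReal_le_of_eLpNorm (k := K * ‖v‖) (e := ε / 2) le_rfl mD
    (fun _ => norm_nonneg _) hA' (by positivity) (by positivity) hD
  refine le_trans (measureReal_mono ?_ (measure_ne_top _ _)) ((measureReal_union_le _ _).trans
    (add_le_add ((measureReal_union_le _ _).trans (add_le_add b1 b2)) b3))
  intro ω hω
  by_contra hcon
  simp only [Set.mem_union, Set.mem_ofPred_eq, not_or, not_le] at hcon hω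
  obtain ⟨⟨h1, h2⟩, h3⟩ := hcon
  set Y := M.draw x b ω - M.θhat n x with hYdef
  have hadj : M.adjDraw x b ω = M.θhat n x + s • Y := rfl
  have hsY : ‖s • Y‖ = s * ‖Y‖ := by rw [norm_smul, Real.norm_of_nonneg hs0]
  have h4 : ‖s • Y‖ < δ / 2 := by
    rw [hsY]
    exact lt_of_le_of_lt (by gcongr) h1
  have h5 := hδ (M.adjDraw x b ω) (M.θhat n x)
    (by
      rw [hadj, add_sub_right_comm]
      exact (norm_add_le _ _).trans_lt (by linarith)) (by linarith)
  rw [hadj, add_sub_cancel_left, hsY, inner_smul_right] at h5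
  have h6 : √n * (h (M.θhat n x + s • Y) - h (M.θhat n x)) - K * inner ℝ v (M.lin x b ω)
      = √n * (h (M.θhat n x + s • Y) - h (M.θhat n x) - s * inner ℝ v Y)
        + K * inner ℝ v (Y - M.lin x b ω) := by
    rw [inner_sub_right v Y (M.lin x b ω), ← hnK]; ring
  have h7 : |√n * (h (M.θhat n x + s • Y) - h (M.θhat n x) - s * inner ℝ v Y)| ≤ η * K * ‖Y‖ := by
    rw [abs_mul, abs_of_nonneg (Real.sqrt_nonneg _), ← hnK]
    calc _ ≤ √n * (η * (s * ‖Y‖)) := by gcongr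
      _ = _ := by ring
  have h8 : |K * inner ℝ v (Y - M.lin x b ω)| ≤ K * ‖v‖ * ‖Y - M.lin x b ω‖ := by
    rw [abs_mul, abs_of_nonneg hK0, mul_assoc]
    gcongr
    exact abs_real_inner_le_norm _ _
  rw [hadj, h6] at hω
  have h9 := hω.trans (abs_add_le _ _)
  linarith

lemma exists_abs_sub_inner_le {h : Vec d → ℝ} {v θ₀ : Vec d}
    (hh : HasStrictFDerivAt h (innerSL ℝ v) θ₀) {η : ℝ} (hη : 0 < η) :
    ∃ δ > 0, ∀ θ θ' : Vec d, ‖θ - θ₀‖ < δ → ‖θ' - θ₀‖ < δ →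
      |h θ - h θ' - inner ℝ v (θ - θ')| ≤ η * ‖θ - θ'‖ := by
  have h1 := hh.isLittleO.def hη
  rw [nhds_prod_eq] at h1
  obtain ⟨s, hs, s', hs', hss⟩ := eventually_prod_iff.1 h1
  obtain ⟨δ₁, h2, h3⟩ := Metric.eventually_nhds_iff.1 hs
  obtain ⟨δ₂, h4, h5⟩ := Metric.eventually_nhds_iff.1 hs'
  refine ⟨min δ₁ δ₂, lt_min h2 h4, fun θ θ' h6 h7 => ?_⟩
  have := hss (h3 (by rw [dist_eq_norm]; exact h6.trans_le (min_le_left _ _)))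
    (h5 (by rw [dist_eq_norm]; exact h7.trans_le (min_le_right _ _)))
  simpa using this

/-- The three error terms of `measureReal_statistic_sub_lin_le` are eventually small. The constant
`η` is chosen first, because `√m` times the `L₂` norm of `θ_b - θ̂_n` only stays bounded. -/
lemma tendsto_measureReal_statistic_sub_lin (hM : M.Standing) (hm : Tendsto M.m atTop atTop)
    (hb : Tendsto b atTop atTop)
    (hlog : Tendsto (fun n => Real.log (M.m n) / (b n : ℝ)) atTop (𝓝 0))
    {h : Vec d → ℝ} {v : Vec d} (hh : HasStrictFDerivAt h (innerSL ℝ v) M.θdag)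
    (hL : L ≤ M.sampleFilter)
    (hθ : Tendsto (fun i : Σ n, Fin n → Z => M.θhat i.1 i.2) L (𝓝 M.θdag))
    {C r C' r' : ℝ} (hC : 0 ≤ C) (hr0 : 0 ≤ r) (hr1 : r < 1) (hC' : 0 ≤ C') (hr'0 : 0 ≤ r')
    (hr'1 : r' < 1)
    (hY : ∀ᶠ n in atTop, ∀ x ∈ M.S n, ∀ b, eLpNorm (fun ω => ‖M.draw x (b + 1) ω - M.θhat n x‖) 2
      (M.Pstar x) ≤ ENNReal.ofReal (C * (r ^ b + 1 / √(M.m n))))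
    (hD : ∀ᶠ n in atTop, ∀ x ∈ M.S n, ∀ b,
      eLpNorm (fun ω => M.draw x (b + 1) ω - M.θhat n x - M.lin x (b + 1) ω) 1
      (M.Pstar x) ≤ ENNReal.ofReal (C' * (r' ^ b + 1 / (M.m n)))) {ε : ℝ} (hε : 0 < ε) :
    Tendsto (fun i : Σ n, Fin n → Z => (M.Pstar i.2).real
      {ω | ε ≤ |√i.1 * (h (M.adjDraw i.2 (b i.1) ω) - h (M.θhat i.1 i.2))
        - √(M.m i.1 / phi M.γ) * inner ℝ v (M.lin i.2 (b i.1) ω)|}) L (𝓝 0) := by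
  have hφ := phi_pos hM.γ_pos hM.γ_le
  have hn : Tendsto (fun i : Σ n, Fin n → Z => i.1) L atTop := tendsto_fst_sampleFilter.mono_left hL
  have ht1 := tendsto_sqrt_m_mul_pow hm hb hlog hr0 hr1
  have ht2 := tendsto_sqrt_m_mul_pow hm hb hlog hr'0 hr'1
  have ht3 := tendsto_one_div_sqrt_m hm
  have ht4 : Tendsto (fun n => r ^ (b n - 1)) atTop (𝓝 0) :=
    (tendsto_pow_atTop_nhds_zero_of_lt_one hr0 hr1).comp ((tendsto_sub_atTop_nat 1).comp hb)
  rw [Metric.tendsto_nhds]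
  intro e he
  obtain ⟨k, hk⟩ : ∃ k, k = √(1 / phi M.γ) := ⟨_, rfl⟩
  have hk0 : 0 < k := by rw [hk]; exact Real.sqrt_pos.2 (by positivity)
  obtain ⟨η, hη0, hη⟩ : ∃ η > 0, η * k * (C * 2) / (ε / 2) < e / 3 := by
    have h0 : 0 ≤ k * (C * 2) / (ε / 2) := by positivity
    refine ⟨e / 3 / (k * (C * 2) / (ε / 2) + 1), by positivity, ?_⟩
    rw [mul_assoc, mul_div_assoc, div_mul_eq_mul_div, div_lt_iff₀ (by positivity)]
    exact mul_lt_mul_of_pos_left (lt_add_one _) (by positivity)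
  obtain ⟨δ, hδ0, hδ⟩ := exists_abs_sub_inner_le hh hη0
  have hlim : ∀ᶠ n in atTop, k * (C * (r ^ (b n - 1) + 1 / √(M.m n))) / (δ / 2) < e / 3 ∧
      √(M.m n) * r ^ (b n - 1) < 1 ∧
      k * ‖v‖ * (C' * (√(M.m n) * r' ^ (b n - 1) + 1 / √(M.m n))) / (ε / 2) < e / 3 := by
    have h1 : Tendsto (fun n => k * (C * (r ^ (b n - 1) + 1 / √(M.m n))) / (δ / 2)) atTop (𝓝 0) := by
      have := (((ht4.add ht3).const_mul C).const_mul k).div_const (δ / 2)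
      rwa [add_zero, mul_zero, mul_zero, zero_div] at this
    have h2 : Tendsto (fun n => k * ‖v‖ * (C' * (√(M.m n) * r' ^ (b n - 1) + 1 / √(M.m n)))
        / (ε / 2)) atTop (𝓝 0) := by
      have := (((ht2.add ht3).const_mul C').const_mul (k * ‖v‖)).div_const (ε / 2)
      rwa [add_zero, mul_zero, mul_zero, zero_div] at this
    have he3 : 0 < e / 3 := by positivity
    exact (h1.eventually_lt_const he3).and
      ((ht1.eventually_lt_const one_pos).and (h2.eventually_lt_const he3))
  filter_upwards [hL (eventually_sampleFilter_of hY), hL (eventually_sampleFilter_of hD),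
    hn.eventually hlim, hn.eventually (hm.eventually_ge_atTop 1),
    hn.eventually (hb.eventually_ge_atTop 1),
    (Metric.tendsto_nhds.1 hθ (δ / 2) (by positivity))] with i hYi hDi hlimi hmi hbi hθi
  obtain ⟨n, x⟩ := i
  obtain ⟨hl1, hl2, hl3⟩ := hlimi
  have hbn : b n - 1 + 1 = b n := Nat.sub_add_cancel hbi
  have hYn := hYi (b n - 1)
  have hDn := hDi (b n - 1)
  rw [hbn] at hYn hDn
  have hm0 : (0 : ℝ) < M.m n := by exact_mod_cast hmi
  have hms : √(M.m n : ℝ) * (1 / √(M.m n)) = 1 := mul_one_div_cancel (Real.sqrt_pos.2 hm0).ne'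
  have hms' : √(M.m n : ℝ) * (1 / (M.m n)) = 1 / √(M.m n) := by
    rw [mul_one_div, Real.sqrt_div_self']
  have hK : √(M.m n / phi M.γ) = k * √(M.m n) := by
    rw [hk, ← Real.sqrt_mul (by positivity), one_div_mul_eq_div]
  have hA : 0 ≤ C * (r ^ (b n - 1) + 1 / √(M.m n)) := by positivity
  have hA' : 0 ≤ C' * (r' ^ (b n - 1) + 1 / (M.m n : ℝ)) := by positivity
  have key := measureReal_statistic_sub_lin_le hM hδ0 hη0 hε hδ hmi
    (by rw [← dist_eq_norm]; exact hθi) hA hA' hYn hDn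
  rw [Real.dist_eq, sub_zero, abs_of_nonneg measureReal_nonneg]
  refine key.trans_lt ?_
  have e1 : η * √(M.m n / phi M.γ) * (C * (r ^ (b n - 1) + 1 / √(M.m n))) / (ε / 2)
      ≤ η * k * (C * 2) / (ε / 2) := by
    rw [hK]
    refine div_le_div_of_nonneg_right ?_ (by positivity)
    calc _ = η * k * (C * (√(M.m n) * r ^ (b n - 1) + √(M.m n) * (1 / √(M.m n)))) := by ring
      _ ≤ η * k * (C * 2) := by
        rw [hms]
        refine mul_le_mul_of_nonneg_left (mul_le_mul_of_nonneg_left ?_ hC) (by positivity)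
        linarith
  have e2 : √(M.m n / phi M.γ) * ‖v‖ * (C' * (r' ^ (b n - 1) + 1 / (M.m n))) / (ε / 2)
      = k * ‖v‖ * (C' * (√(M.m n) * r' ^ (b n - 1) + 1 / √(M.m n))) / (ε / 2) := by
    rw [hK, ← hms']; ring
  rw [e2, ← hk]
  linarith

/-- In the bootstrap world, the scaled statistic has the same Gaussian limit as the linear process
in the direction of the gradient of `h`. -/
theorem tendsto_bootstrap_real_le (hM : M.Standing) (hm : Tendsto M.m atTop atTop)
    (hb : Tendsto b atTop atTop)
    (hlog : Tendsto (fun n => Real.log (M.m n) / (b n : ℝ)) atTop (𝓝 0))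
    (hcA : c.Admissible M.γ) (hc : ∀ n, ∀ x ∈ M.S n, M.CouplingAt 2 c x (M.Hhat x)⁻¹)
    (hH : c.lamH ≤ c.LamH) (hP : c.lamP ≤ c.LamP) (hSigma : M.SigmaRegular)
    (hchar : M.CharFunExpansion) {h : Vec d → ℝ} {v : Vec d}
    (hh : HasStrictFDerivAt h (innerSL ℝ v) M.θdag) [L.IsCountablyGenerated]
    (hL : L ≤ M.sampleFilter)
    (hθ : Tendsto (fun i : Σ n, Fin n → Z => M.θhat i.1 i.2) L (𝓝 M.θdag)) {q : ℝ} (hq0 : 0 < q)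
    (hq : Tendsto (fun i : Σ n, Fin n → Z => quad (M.VN i.2) v) L (𝓝 q)) (t : ℝ) :
    Tendsto (fun i : Σ n, Fin n → Z => (M.Pstar i.2).real
        {ω | √i.1 * (h (M.adjDraw i.2 (b i.1) ω) - h (M.θhat i.1 i.2)) ≤ t}) L
      (𝓝 ((gaussianReal 0 q.toNNReal).real (Set.Iic t))) := by
  have hv0 : q.toNNReal ≠ 0 := by simpa using hq0
  obtain ⟨C, r, hC, hr0, hr1, hρr, hY⟩ :=
    exists_eLpNorm_draw_sub_le hM hm one_le_two hcA hc hH hP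
  obtain ⟨C', r', hC', hr'0, hr'1, hD⟩ := exists_eLpNorm_draw_sub_lin_le (p := 2) (s := 1) le_rfl
    one_le_two hM hcA hc hH hP hC hr0 hr1 hρr hY
  have hX := tendsto_real_le_of_tendsto_charFun (Ω := fun _ : (Σ n, Fin n → Z) => Ωs)
    (μ := fun i => M.Pstar i.2)
    (X := fun i ω => √(M.m i.1 / phi M.γ) * inner ℝ v (M.lin i.2 (b i.1) ω))
    (fun i => ((Measurable.const_inner
      (measurable_lin i.2 (b i.1))).const_mul _).aemeasurable) hv0
      (tendsto_charFun_lin hM hm hb hchar (exists_VN_bounds hM hcA hc hH hSigma) hL hq0.le hq)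
  exact tendsto_real_le_of_close (gaussianReal_real_Iic_continuous hv0) hX
    (fun ε hε => tendsto_measureReal_statistic_sub_lin hM hm hb hlog hh hL hθ hC hr0 hr1 hC' hr'0
      hr'1 hY hD hε) t

end Bootstrap

end Setting

/-! ### The sampling distribution -/

lemma quad_eq_dotProduct {d : ℕ} (A : Matrix (Fin d) (Fin d) ℝ) (u : Vec d) :
    quad A u = u.ofLp ⬝ᵥ A.mulVec u.ofLp := by
  rw [quad, act, Matrix.inner_toEuclideanCLM]

namespace Setting

variable {d : ℕ} {Z Ωs : Type*} [MeasurableSpace Z] [MeasurableSpace Ωs] {M : Setting d Z Ωs}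
  [∀ n, IsProbabilityMeasure (M.P n)] {V : Matrix (Fin d) (Fin d) ℝ} {h : Vec d → ℝ}

namespace NormalDelta

lemma tendsto_VN_apply (hN : M.NormalDelta V h) (i j : Fin d) :
    Tendsto (fun k : Σ n, Fin n → Z => M.VN k.2 i j) M.whpFilter (𝓝 (V i j)) := by
  rw [Metric.tendsto_nhds]
  intro ε hε
  refine eventually_whpFilter.2 ?_
  simpa [Real.dist_eq] using hN.VN_tendsto i j ε hε

lemma tendsto_quad_VN (hN : M.NormalDelta V h) (u : Vec d) :
    Tendsto (fun k : Σ n, Fin n → Z => quad (M.VN k.2) u) M.whpFilter (𝓝 (quad V u)) := by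
  simp only [quad_eq_dotProduct, dotProduct, Matrix.mulVec]
  exact tendsto_finsetSum _ fun i _ => (tendsto_finsetSum _ fun j _ =>
    (hN.tendsto_VN_apply i j).mul_const _).const_mul _

/-- The limit `V` inherits symmetry and the eigenvalue bounds of `V_n`. -/
lemma eigBounds (hN : M.NormalDelta V h) (hM : M.Standing) {l L : ℝ}
    (hV : ∀ n, ∀ x ∈ M.S n, EigBounds (M.VN x) l L) : EigBounds V l L := by
  have := whpFilter_neBot (M := M)
  have h1 : ∀ᶠ i in M.whpFilter, EigBounds (M.VN i.2) l L :=
    whpFilter_le_sampleFilter hM (eventually_sampleFilter.2 (Eventually.of_forall hV))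
  refine ⟨?_, fun u => ⟨?_, ?_⟩⟩
  · ext i j
    refine tendsto_nhds_unique ((hN.tendsto_VN_apply j i).congr' ?_) (hN.tendsto_VN_apply i j)
    filter_upwards [h1] with k hk
    exact hk.1.apply i j
  · exact ge_of_tendsto (hN.tendsto_quad_VN u) (h1.mono fun k hk => (hk.2 u).1)
  · exact le_of_tendsto (hN.tendsto_quad_VN u) (h1.mono fun k hk => (hk.2 u).2)

lemma tendsto_charFun (hN : M.NormalDelta V h) (t : Vec d) :
    Tendsto (fun n : ℕ => charFun ((M.P n).map fun x => √n • (M.θhat n x - M.θdag)) t) atTop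
      (𝓝 (charFun (multivariateGaussian 0 V) t)) := by
  have h1 := ProbabilityMeasure.tendsto_iff_tendsto_charFun.1 hN.clt.tendsto t
  simpa only [ProbabilityMeasure.coe_mk, Measure.map_id] using h1

/-- The scaled estimation error is bounded in probability. -/
lemma exists_measure_norm_gt_le (hN : M.NormalDelta V h) {η : ℝ≥0∞} (hη : 0 < η) :
    ∃ K : ℝ, 0 < K ∧ ∀ n : ℕ, M.P n {x | K < ‖√n • (M.θhat n x - M.θdag)‖} ≤ η := by
  have hae := hN.clt.forall_aemeasurable
  have hP : ∀ n : ℕ, IsProbabilityMeasure ((M.P n).map fun x => √n • (M.θhat n x - M.θdag)) :=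
    fun n => Measure.isProbabilityMeasure_map (hae n)
  have h1 := tendsto_measure_norm_gt_of_isTightMeasureSet
    (isTightMeasureSet_of_tendsto_charFun continuous_charFun.continuousAt hN.tendsto_charFun)
  obtain ⟨K, hK, hK0⟩ := ((h1.eventually_lt_const hη).and (eventually_gt_atTop 0)).exists
  refine ⟨K, hK0, fun n => ?_⟩
  have h2 := (le_iSup₂ (f := fun (μ : Measure (Vec d)) (_ : μ ∈ Set.range fun n : ℕ =>
    (M.P n).map fun x => √n • (M.θhat n x - M.θdag)) => μ {x | K < ‖x‖}) _ ⟨n, rfl⟩).trans hK.le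
  rwa [Measure.map_apply_of_aemeasurable (hae n)
    (measurableSet_lt measurable_const measurable_norm)] at h2

lemma tendsto_θhat (hN : M.NormalDelta V h) :
    Tendsto (fun i : Σ n, Fin n → Z => M.θhat i.1 i.2) M.whpFilter (𝓝 M.θdag) := by
  rw [Metric.tendsto_nhds]
  intro ε hε
  rw [eventually_whpFilter, ENNReal.tendsto_nhds_zero]
  intro η hη
  obtain ⟨K, -, hK⟩ := hN.exists_measure_norm_gt_le hη
  have hsq : Tendsto (fun n : ℕ => √(n : ℝ) * ε) atTop atTop :=
    (Real.tendsto_sqrt_atTop.comp tendsto_natCast_atTop_atTop).atTop_mul_const hε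
  filter_upwards [hsq.eventually_gt_atTop K] with n hn
  refine (measure_mono fun x hx => ?_).trans (hK n)
  simp only [Set.mem_ofPred_eq, not_lt, dist_eq_norm] at hx ⊢
  rw [norm_smul, Real.norm_of_nonneg (Real.sqrt_nonneg _)]
  exact hn.trans_le (by gcongr)

lemma tendsto_real_inner_le (hN : M.NormalDelta V h) (hV : V.PosSemidef) {v : Vec d}
    (hv : 0 < quad V v) (t : ℝ) :
    Tendsto (fun n : ℕ => (M.P n).real {x | -inner ℝ v (√n • (M.θhat n x - M.θdag)) ≤ t}) atTop
      (𝓝 ((gaussianReal 0 (quad V v).toNNReal).real (Set.Iic t))) := by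
  have hae := hN.clt.forall_aemeasurable
  have hg : Measurable fun y : Vec d => -(inner ℝ v y : ℝ) :=
    (Measurable.const_inner measurable_id).neg
  refine tendsto_real_le_of_tendsto_charFun (μ := M.P) (L := atTop)
    (fun n => hg.comp_aemeasurable (hae n)) (by simpa using hv) (fun s => ?_) t
  have h1 : ∀ μ : Measure (Vec d), charFun (μ.map fun y : Vec d => -(inner ℝ v y : ℝ)) s
      = charFun μ (-s • v) := by
    intro μ
    rw [charFun_apply_real, integral_map hg.aemeasurable (by fun_prop), charFun_apply]
    refine integral_congr_ae (Eventually.of_forall fun y => ?_)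
    simp only [inner_smul_right, real_inner_comm]
    push_cast
    ring_nf
  have h2 := hN.tendsto_charFun (-s • v)
  have h3 : charFun (multivariateGaussian 0 V) (-s • v)
      = charFun (gaussianReal 0 (quad V v).toNNReal) s := by
    rw [charFun_multivariateGaussian hV, charFun_gaussianReal, Real.coe_toNNReal _ hv.le,
      quad_eq_dotProduct]
    simp only [inner_zero_right, WithLp.ofLp_smul, Matrix.mulVec_smul, dotProduct_smul,
      smul_dotProduct, smul_eq_mul]
    push_cast
    congr 1
    ring
  rw [← h3]
  refine h2.congr fun n => ?_
  rw [← h1, AEMeasurable.map_map_of_aemeasurable hg.aemeasurable (hae n)]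

/-- The delta method for the scaled error `√n (h(θ†) - h(θ̂_n))`. -/
lemma tendsto_real_le (hN : M.NormalDelta V h) (hV : V.PosSemidef) {v : Vec d}
    (hv : 0 < quad V v) (hh : HasStrictFDerivAt h (innerSL ℝ v) M.θdag) (t : ℝ) :
    Tendsto (fun n : ℕ => (M.P n).real {x | √n * (h M.θdag - h (M.θhat n x)) ≤ t}) atTop
      (𝓝 ((gaussianReal 0 (quad V v).toNNReal).real (Set.Iic t))) := by
  have hv0 : (quad V v).toNNReal ≠ 0 := by simpa using hv
  refine tendsto_real_le_of_close (μ := M.P) (L := atTop) (gaussianReal_real_Iic_continuous hv0)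
    (hN.tendsto_real_inner_le hV hv) (fun ε hε => ?_) t
  suffices H : Tendsto (fun n : ℕ => M.P n {x | ε ≤ |√n * (h M.θdag - h (M.θhat n x))
      - -inner ℝ v (√n • (M.θhat n x - M.θdag))|}) atTop (𝓝 0) by
    exact (ENNReal.tendsto_toReal ENNReal.zero_ne_top).comp H
  rw [ENNReal.tendsto_nhds_zero]
  intro η hη
  have hη2 : 0 < η / 2 := ENNReal.half_pos hη.ne'
  obtain ⟨K, hK0, hK⟩ := hN.exists_measure_norm_gt_le hη2
  obtain ⟨δ, hδ0, hδ⟩ := exists_abs_sub_inner_le hh (η := ε / (2 * K)) (by positivity)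
  have h1 := eventually_whpFilter.1 (Metric.tendsto_nhds.1 hN.tendsto_θhat δ hδ0)
  filter_upwards [ENNReal.tendsto_nhds_zero.1 h1 (η / 2) hη2] with n hn
  refine (measure_mono fun x hx => ?_).trans ((measure_union_le _ _).trans
    ((add_le_add hn (hK n)).trans_eq (ENNReal.add_halves η)))
  by_contra hcon
  simp only [Set.mem_union, Set.mem_ofPred_eq, not_or, not_lt, not_le, dist_eq_norm] at hx hcon
  obtain ⟨h2, h3⟩ := hcon
  rw [norm_smul, Real.norm_of_nonneg (Real.sqrt_nonneg _)] at h3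
  have h4 := hδ M.θdag (M.θhat n x) (by simpa using hδ0) h2
  have h5 : √(n : ℝ) * (h M.θdag - h (M.θhat n x)) - -inner ℝ v (√n • (M.θhat n x - M.θdag))
      = √n * (h M.θdag - h (M.θhat n x) - inner ℝ v (M.θdag - M.θhat n x)) := by
    rw [inner_smul_right, ← neg_sub (M.θhat n x) M.θdag, inner_neg_right]
    ring
  rw [h5, abs_mul, abs_of_nonneg (Real.sqrt_nonneg _)] at hx
  have h6 : √(n : ℝ) * |h M.θdag - h (M.θhat n x) - inner ℝ v (M.θdag - M.θhat n x)| ≤ ε / 2 := by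
    calc _ ≤ √(n : ℝ) * (ε / (2 * K) * ‖M.θdag - M.θhat n x‖) := by gcongr
      _ = ε / (2 * K) * (√n * ‖M.θhat n x - M.θdag‖) := by rw [norm_sub_rev]; ring
      _ ≤ ε / (2 * K) * K := by gcongr
      _ = ε / 2 := by field_simp
  linarith

end NormalDelta

end Setting

/-! ### The bootstrap variance -/

lemma holderTriple_four_four_two : ENNReal.HolderTriple 4 4 2 := ⟨by
  rw [← ENNReal.toReal_eq_toReal_iff' (by simp) (by simp), ENNReal.toReal_add (by simp) (by simp)]
  norm_num⟩

/-- A square-integrable perturbation changes the variance by an amount controlled by its `L₂` norm;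
the weight `t` balances the two terms of Young's inequality for the covariance. -/
lemma abs_variance_sub_le {Ω : Type*} [MeasurableSpace Ω] {ν : Measure Ω} [IsProbabilityMeasure ν]
    {X W : Ω → ℝ} (hX : MemLp X 2 ν) (hW : Measurable W) {k e t : ℝ} (ht : 0 < t) (he : 0 ≤ e)
    (hR : eLpNorm (fun ω => W ω - k - X ω) 2 ν ≤ ENNReal.ofReal e) :
    |Var[W; ν] - Var[X; ν]| ≤ t * Var[X; ν] + (1 + 1 / t) * e ^ 2 := by
  set R : Ω → ℝ := fun ω => W ω - k - X ω with hRdef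
  have hRm : MemLp R 2 ν := ⟨(hW.sub_const k).aestronglyMeasurable.sub hX.1,
    hR.trans_lt ENNReal.ofReal_lt_top⟩
  have hRe : Var[R; ν] ≤ e ^ 2 := by
    refine (variance_le_expectation_sq hRm.1).trans ?_
    rw [hRm.eLpNorm_eq_integral_rpow_norm two_ne_zero ENNReal.ofNat_ne_top,
      ENNReal.ofReal_le_ofReal_iff he] at hR
    simp only [ENNReal.toReal_ofNat, Real.rpow_two, Real.norm_eq_abs, sq_abs] at hR
    rw [← one_div, ← Real.sqrt_eq_rpow] at hR
    exact (Real.sqrt_le_left he).1 hR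
  have hWX : Var[W; ν] = Var[X; ν] + 2 * cov[X, R; ν] + Var[R; ν] := by
    rw [← variance_add hX hRm, ← variance_sub_const hW.aestronglyMeasurable k]
    congr 1
    ext ω
    simp [hRdef]
  have h1 := variance_nonneg (fun ω => t * X ω + R ω) ν
  have h2 := variance_nonneg (fun ω => t * X ω - R ω) ν
  rw [variance_fun_add (hX.const_mul t) hRm, variance_const_mul, covariance_const_mul_left] at h1
  rw [variance_fun_sub (hX.const_mul t) hRm, variance_const_mul, covariance_const_mul_left] at h2
  have hR0 := variance_nonneg R ν
  have h3 : t * |2 * cov[X, R; ν]| ≤ t * (t * Var[X; ν] + 1 / t * Var[R; ν]) := by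
    have : t * (t * Var[X; ν] + 1 / t * Var[R; ν]) = t ^ 2 * Var[X; ν] + Var[R; ν] := by
      field_simp
    rw [this, ← abs_of_pos ht, ← abs_mul, abs_of_pos ht, abs_le]
    constructor <;> linarith
  have h4 := le_of_mul_le_mul_left h3 ht
  have h5 : |Var[W; ν] - Var[X; ν]| ≤ |2 * cov[X, R; ν]| + Var[R; ν] := by
    rw [hWX, ← abs_of_nonneg hR0, abs_of_nonneg hR0]
    calc _ = |2 * cov[X, R; ν] + Var[R; ν]| := by congr 1; ring
      _ ≤ _ := (abs_add_le _ _).trans_eq (by rw [abs_of_nonneg hR0])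
  have h6 : (1 + 1 / t) * Var[R; ν] ≤ (1 + 1 / t) * e ^ 2 := by gcongr
  linarith

lemma hasFDerivAt_innerSL_gradient {d : ℕ} {h : Vec d → ℝ} {θ : Vec d}
    (hh : DifferentiableAt ℝ h θ) : HasFDerivAt h (innerSL ℝ (gradient h θ)) θ :=
  hh.hasGradientAt.hasFDerivAt

/-- A second-order Taylor bound for functions with Lipschitz gradient. -/
lemma abs_sub_inner_gradient_le {d : ℕ} {h : Vec d → ℝ} {s : Set (Vec d)} (hs : Convex ℝ s)
    (hh : ∀ θ ∈ s, DifferentiableAt ℝ h θ) {K : NNReal} (hK : LipschitzOnWith K (gradient h) s)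
    {x y : Vec d} (hx : x ∈ s) (hy : y ∈ s) :
    |h y - h x - inner ℝ (gradient h x) (y - x)| ≤ K * ‖y - x‖ ^ 2 := by
  have h1 := norm_sub_le_of_fderiv_segment hs
    (f := fun z => h z - innerSL ℝ (gradient h x) z)
    (f' := fun z => innerSL ℝ (gradient h z) - innerSL ℝ (gradient h x))
    (fun z hz => (hasFDerivAt_innerSL_gradient (hh z hz)).sub
      (innerSL ℝ (gradient h x)).hasFDerivAt) hx hy (B := K * ‖y - x‖ ^ 2) (fun z hz => by
      rw [← map_sub, innerSL_apply_apply]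
      have h2 := hK.norm_sub_le (hs.segment_subset hx hy hz) hx
      have h3 : ‖z - x‖ ≤ ‖y - x‖ := by
        obtain ⟨t, ht, rfl⟩ := (segment_eq_image' ℝ x y) ▸ hz
        rw [add_sub_cancel_left, norm_smul, Real.norm_of_nonneg ht.1]
        exact mul_le_of_le_one_left (norm_nonneg _) ht.2
      calc _ ≤ ‖gradient h z - gradient h x‖ * ‖y - x‖ := norm_inner_le_norm _ _
        _ ≤ (K * ‖y - x‖) * ‖y - x‖ := by
          refine mul_le_mul_of_nonneg_right (h2.trans ?_) (norm_nonneg _)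
          gcongr
        _ = _ := by ring)
  simp only [innerSL_apply_apply] at h1
  have h4 : h y - h x - inner ℝ (gradient h x) (y - x)
      = h y - inner ℝ (gradient h x) y - (h x - inner ℝ (gradient h x) x) := by
    rw [inner_sub_right]; ring
  rwa [h4, ← Real.norm_eq_abs]

namespace Setting

variable {d : ℕ} {Z Ωs : Type*} [MeasurableSpace Z] [MeasurableSpace Ωs] {M : Setting d Z Ωs}
  {h : Vec d → ℝ}

lemma exists_gradient_bound (hM : M.Standing) {K : NNReal}
    (hK : LipschitzOnWith K (gradient h) M.Θ) : ∃ G : ℝ, 0 ≤ G ∧ ∀ θ ∈ M.Θ, ‖gradient h θ‖ ≤ G := by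
  obtain ⟨G, hG⟩ := hM.compact.exists_bound_of_continuousOn hK.continuousOn
  exact ⟨max G 0, le_max_right _ _, fun θ hθ => (hG θ hθ).trans (le_max_left _ _)⟩

/-- The statistic `h(θ_b)` differs from the linear process in the direction of the gradient by a
quadratic term, controlled in `L₂` by the `L₄` norm of the error, and by the linearization error of
the algorithm. -/
lemma eLpNorm_statistic_sub_lin_le (hM : M.Standing)
    (hh : ∀ θ ∈ M.Θ, DifferentiableAt ℝ h θ) {K : NNReal}
    (hK : LipschitzOnWith K (gradient h) M.Θ) {n : ℕ} {x : Fin n → Z} (hx : x ∈ M.S n) {b : ℕ}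
    {G A A' : ℝ} (hG : ‖gradient h (M.θhat n x)‖ ≤ G) (hA : 0 ≤ A) (hA' : 0 ≤ A')
    (hY : eLpNorm (fun ω => ‖M.draw x b ω - M.θhat n x‖) 4 (M.Pstar x) ≤ ENNReal.ofReal A)
    (hD : eLpNorm (fun ω => M.draw x b ω - M.θhat n x - M.lin x b ω) 2 (M.Pstar x)
      ≤ ENNReal.ofReal A') :
    eLpNorm (fun ω => h (M.draw x b ω) - h (M.θhat n x)
        - inner ℝ (gradient h (M.θhat n x)) (M.lin x b ω)) 2 (M.Pstar x)
      ≤ ENNReal.ofReal (K * (A * A) + G * A') := by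
  have hG0 : 0 ≤ G := (norm_nonneg _).trans hG
  have := holderTriple_four_four_two
  have mY : Measurable fun ω => ‖M.draw x b ω - M.θhat n x‖ :=
    ((measurable_draw x b).sub measurable_const).norm
  have mD : Measurable fun ω => ‖M.draw x b ω - M.θhat n x - M.lin x b ω‖ :=
    (((measurable_draw x b).sub measurable_const).sub (measurable_lin x b)).norm
  rw [← eLpNorm_norm] at hD
  refine eLpNorm_le_add_of_ae_le
    (f := fun ω => K * (‖M.draw x b ω - M.θhat n x‖ * ‖M.draw x b ω - M.θhat n x‖))
    (g := fun ω => G * ‖M.draw x b ω - M.θhat n x - M.lin x b ω‖) ?_ ((mY.mul mY).const_mul _)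
    (mD.const_mul _) one_le_two (by positivity) (by positivity)
    (eLpNorm_const_mul_le_ofReal K.2 (eLpNorm_mul_le_ofReal mY mY hA hY hY))
    (eLpNorm_const_mul_le_ofReal hG0 hD)
  filter_upwards [hM.draw_mem n x hx] with ω hω
  have h1 := abs_sub_inner_gradient_le hM.convex hh hK (hM.θhat_mem n x hx) (hω b)
  have h2 : |(inner ℝ (gradient h (M.θhat n x)) (M.draw x b ω - M.θhat n x - M.lin x b ω) : ℝ)|
      ≤ G * ‖M.draw x b ω - M.θhat n x - M.lin x b ω‖ :=
    (abs_real_inner_le_norm _ _).trans (by gcongr)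
  rw [inner_sub_right _ (M.draw x b ω - M.θhat n x)] at h2
  rw [Real.norm_eq_abs, ← sq]
  refine le_trans ?_ (add_le_add h1 h2)
  refine le_trans (le_of_eq ?_) (abs_add_le _ _)
  congr 1
  ring

/-- The scaled bootstrap variance of `h(θ_b)` is uniformly close to the delta-method variance. -/
theorem eventually_abs_variance_sub_quad_le (hM : M.Standing) {b : ℕ → ℕ}
    (hm : Tendsto M.m atTop atTop) (hb : Tendsto b atTop atTop)
    (hlog : Tendsto (fun n => Real.log (M.m n) / (b n : ℝ)) atTop (𝓝 0))
    {c c₄ : Consts} (hc : ∀ n, ∀ x ∈ M.S n, M.CouplingAt 2 c x (M.Hhat x)⁻¹)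
    (hV : ∃ l L : ℝ, 0 < l ∧ ∀ n, ∀ x ∈ M.S n, EigBounds (M.VN x) l L)
    (hcA₄ : c₄.Admissible M.γ) (hc₄ : ∀ n, ∀ x ∈ M.S n, M.CouplingAt 4 c₄ x (M.Hhat x)⁻¹)
    (hH₄ : c₄.lamH ≤ c₄.LamH) (hP₄ : c₄.lamP ≤ c₄.LamP) (hhm : Measurable h)
    (hh : ∀ θ ∈ M.Θ, DifferentiableAt ℝ h θ) {K : NNReal}
    (hK : LipschitzOnWith K (gradient h) M.Θ) {ε : ℝ} (hε : 0 < ε) :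
    ∀ᶠ n in atTop, ∀ x ∈ M.S n,
      |(M.m n : ℝ) / phi M.γ * Var[fun ω => h (M.draw x (b n) ω); M.Pstar x]
        - quad (M.VN x) (gradient h (M.θhat n x))| ≤ ε := by
  have := holderTriple_four_four_two
  have hφ := phi_pos hM.γ_pos hM.γ_le
  have h14 : (1 : ℝ≥0∞) ≤ 4 := by norm_num
  have h24 : (2 : ℝ≥0∞) ≤ 4 := by norm_num
  obtain ⟨l, L, hl, hVb⟩ := hV
  obtain ⟨G, hG0, hG⟩ := exists_gradient_bound hM hK
  obtain ⟨C, r, hC, hr0, hr1, hρr, hY⟩ := exists_eLpNorm_draw_sub_le hM hm h14 hcA₄ hc₄ hH₄ hP₄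
  obtain ⟨C', r', hC', hr'0, hr'1, hD⟩ := exists_eLpNorm_draw_sub_lin_le (p := 4) (s := 2)
    one_le_two h24 hM hcA₄ hc₄ hH₄ hP₄ hC hr0 hr1 hρr hY
  have ht1 := tendsto_sqrt_m_mul_pow hm hb hlog hr0 hr1
  have ht2 := tendsto_sqrt_m_mul_pow hm hb hlog hr'0 hr'1
  have ht3 := tendsto_one_div_sqrt_m hm
  have ht4 : Tendsto (fun n => r ^ (b n - 1)) atTop (𝓝 0) :=
    (tendsto_pow_atTop_nhds_zero_of_lt_one hr0 hr1).comp ((tendsto_sub_atTop_nat 1).comp hb)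
  set B := |L| * G ^ 2 with hB
  have hB0 : 0 ≤ B := by positivity
  obtain ⟨t, ht, htB⟩ : ∃ t > 0, t * B ≤ ε / 3 := by
    refine ⟨ε / 3 / (B + 1), by positivity, ?_⟩
    rw [div_mul_eq_mul_div, div_le_iff₀ (by positivity)]
    exact mul_le_mul_of_nonneg_left (by linarith) (by positivity)
  -- `√m` times the bound for the `L₂` norm of the linearization error
  let E : ℕ → ℝ := fun n =>
    K * (C * C * ((r ^ (b n - 1) + 1 / √(M.m n)) * (√(M.m n) * r ^ (b n - 1) + 1)))
      + G * (C' * (√(M.m n) * r' ^ (b n - 1) + 1 / √(M.m n)))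
  have hE : Tendsto (fun n => (1 + 1 / t) * (1 / phi M.γ * E n ^ 2)) atTop (𝓝 0) := by
    have h1 : Tendsto E atTop (𝓝 (K * (C * C * ((0 + 0) * (0 + 1))) + G * (C' * (0 + 0)))) :=
      ((((ht4.add ht3).mul (ht1.add_const 1)).const_mul (C * C)).const_mul (K : ℝ)).add
        (((ht2.add ht3).const_mul C').const_mul G)
    have h2 := ((h1.pow 2).const_mul (1 / phi M.γ)).const_mul (1 + 1 / t)
    simpa using h2
  have hg : Tendsto (fun n => ((1 - M.γ) ^ 2) ^ b n * B) atTop (𝓝 0) := by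
    have h1 : (1 - M.γ) ^ 2 < 1 := by
      have := hM.γ_pos; have := hM.γ_le; nlinarith
    have := ((tendsto_pow_atTop_nhds_zero_of_lt_one (sq_nonneg _) h1).comp hb).mul_const B
    rwa [zero_mul] at this
  have hε3 : 0 < ε / 3 := by positivity
  filter_upwards [hY, hD, hE.eventually_lt_const hε3, hg.eventually_lt_const hε3,
    hm.eventually_ge_atTop 1, hb.eventually_ge_atTop 1] with n hYn hDn hEn hgn hmn hbn x hx
  have hbn' : b n - 1 + 1 = b n := Nat.sub_add_cancel hbn
  have hYx := hYn x hx (b n - 1)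
  have hDx := hDn x hx (b n - 1)
  rw [hbn'] at hYx hDx
  have hm0 : (0 : ℝ) < M.m n := by exact_mod_cast hmn
  have hms : √(M.m n : ℝ) * (1 / √(M.m n)) = 1 := mul_one_div_cancel (Real.sqrt_pos.2 hm0).ne'
  have hms' : √(M.m n : ℝ) * (1 / (M.m n)) = 1 / √(M.m n) := by
    rw [mul_one_div, Real.sqrt_div_self']
  have hθ := hM.θhat_mem n x hx
  set A := C * (r ^ (b n - 1) + 1 / √(M.m n)) with hA
  set A' := C' * (r' ^ (b n - 1) + 1 / (M.m n : ℝ)) with hA'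
  have hA0 : 0 ≤ A := by positivity
  have hA'0 : 0 ≤ A' := by positivity
  have hEe : √(M.m n) * (K * (A * A) + G * A') = E n := by
    calc √(M.m n) * (K * (A * A) + G * A')
        = K * (C * C * ((r ^ (b n - 1) + 1 / √(M.m n))
            * (√(M.m n) * r ^ (b n - 1) + √(M.m n) * (1 / √(M.m n)))))
          + G * (C' * (√(M.m n) * r' ^ (b n - 1) + √(M.m n) * (1 / M.m n))) := by
          rw [hA, hA']; ring
      _ = E n := by rw [hms, hms']
  set X : Ωs → ℝ := fun ω => inner ℝ (gradient h (M.θhat n x)) (M.lin x (b n) ω) with hX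
  have key := abs_variance_sub_le (k := h (M.θhat n x))
    ((hc n x hx).memLp_inner_lin hM hx (gradient h (M.θhat n x)) (b n))
    (hhm.comp (measurable_draw x (b n))) ht (by positivity)
    (eLpNorm_statistic_sub_lin_le hM hh hK hx (hG _ hθ) hA0 hA'0 hYx hDx)
  have hvar := (hc n x hx).variance_inner_lin hM hx (gradient h (M.θhat n x)) (b n)
  set Q := quad (M.VN x) (gradient h (M.θhat n x)) with hQ
  have hQ0 : 0 ≤ Q := (hVb n x hx).quad_nonneg hl _
  have hQB : Q ≤ B := by
    refine ((hVb n x hx).2 _).2.trans ?_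
    rw [hB]
    have := hG _ hθ
    gcongr
    exact le_abs_self L
  set s := (M.m n : ℝ) / phi M.γ with hs
  have hs0 : 0 ≤ s := by positivity
  set g := ((1 - M.γ) ^ 2) ^ b n with hgdef
  have hg0 : 0 ≤ g := by positivity
  have hse : s * (K * (A * A) + G * A') ^ 2 = 1 / phi M.γ * E n ^ 2 := by
    rw [← hEe, mul_pow, Real.sq_sqrt hm0.le, hs]
    ring
  have h1 := mul_le_mul_of_nonneg_left key hs0
  rw [← abs_of_nonneg hs0, ← abs_mul, abs_of_nonneg hs0, mul_sub, hvar] at h1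
  have h2 : s * (t * Var[X; M.Pstar x] + (1 + 1 / t) * (K * (A * A) + G * A') ^ 2)
      = t * ((1 - g) * Q) + (1 + 1 / t) * (1 / phi M.γ * E n ^ 2) := by
    rw [← hvar, ← hse]
    ring
  rw [h2] at h1
  have h3 : t * ((1 - g) * Q) ≤ ε / 3 :=
    (mul_le_mul_of_nonneg_left ((mul_le_of_le_one_left hQ0 (by linarith only [hg0])).trans hQB)
      ht.le).trans htB
  have h4 : |g * Q| ≤ ε / 3 := by
    rw [abs_of_nonneg (mul_nonneg hg0 hQ0)]
    exact (mul_le_mul_of_nonneg_left hQB hg0).trans hgn.le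
  have h5 : ∀ y : ℝ, y - Q = y - (1 - g) * Q - g * Q := fun y => by ring
  rw [h5]
  refine (abs_sub _ _).trans ?_
  have h6 := h1
  simp only [Function.comp_def] at h6
  linarith only [h6, h3, h4, hEn]

end Setting

namespace Setting

/-! ### Coverage -/

variable {d : ℕ} {Z Ωs : Type*} [MeasurableSpace Z] [MeasurableSpace Ωs] {M : Setting d Z Ωs}
  [∀ n, IsProbabilityMeasure (M.P n)] {V : Matrix (Fin d) (Fin d) ℝ} {h : Vec d → ℝ}

lemma NormalDelta.dim_pos (hN : M.NormalDelta V h) : 0 < d := by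
  rcases Nat.eq_zero_or_pos d with rfl | hd
  · exact absurd (Subsingleton.elim _ _) hN.h_grad
  · exact hd

lemma exists_mem_S (hM : M.Standing) : ∃ n, ∃ x : Fin n → Z, x ∈ M.S n := by
  have := whpFilter_neBot (M := M)
  have h1 : ∀ᶠ i in M.whpFilter, i.2 ∈ M.S i.1 := whpFilter_le_sampleFilter hM
    (eventually_sampleFilter.2 (Eventually.of_forall fun _ _ hx => hx))
  obtain ⟨i, hi⟩ := h1.exists
  exact ⟨_, _, hi⟩

lemma NormalDelta.hasStrictFDerivAt (hN : M.NormalDelta V h) (hM : M.Standing) :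
    HasStrictFDerivAt h (innerSL ℝ (gradient h M.θdag)) M.θdag := by
  have h1 := hN.h_C1 _ hM.θdag_mem
  rw [← (hasFDerivAt_innerSL_gradient (h1.differentiableAt one_ne_zero)).fderiv]
  exact h1.hasStrictFDerivAt one_ne_zero

/-- The scaled critical values converge in probability to the quantiles of the Gaussian limit. -/
lemma tendsto_sqrt_mul_critValue (hM : M.Standing) (hN : M.NormalDelta V h) {b : ℕ → ℕ}
    (hm : Tendsto M.m atTop atTop) (hb : Tendsto b atTop atTop)
    (hlog : Tendsto (fun n => Real.log (M.m n) / (b n : ℝ)) atTop (𝓝 0)) {c : Consts}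
    (hcA : c.Admissible M.γ) (hc : ∀ n, ∀ x ∈ M.S n, M.CouplingAt 2 c x (M.Hhat x)⁻¹)
    (hH : c.lamH ≤ c.LamH) (hP : c.lamP ≤ c.LamP) (hSigma : M.SigmaRegular)
    (hchar : M.CharFunExpansion) (hq : 0 < quad V (gradient h M.θdag)) (z : ℝ) :
    Tendsto (fun i : Σ n, Fin n → Z => √i.1 * M.critValue h i.2 (b i.1)
        ((gaussianReal 0 (quad V (gradient h M.θdag)).toNNReal).real (Set.Iic z)))
      M.whpFilter (𝓝 z) := by
  have hv0 : (quad V (gradient h M.θdag)).toNNReal ≠ 0 := by simpa using hq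
  -- Lévy's theorem needs a countably generated filter, which `whpFilter` need not be: it is
  -- replaced by the coarser filter generated by the limits in probability that matter.
  let L : Filter (Σ n, Fin n → Z) := M.sampleFilter ⊓
    (comap (fun i => M.θhat i.1 i.2) (𝓝 M.θdag) ⊓
      comap (fun i => quad (M.VN i.2) (gradient h M.θdag)) (𝓝 (quad V (gradient h M.θdag))))
  have hL : M.whpFilter ≤ L := le_inf (whpFilter_le_sampleFilter hM)
    (le_inf (tendsto_iff_comap.1 hN.tendsto_θhat) (tendsto_iff_comap.1 (hN.tendsto_quad_VN _)))
  have hLs : L ≤ M.sampleFilter := inf_le_left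
  have hn : Tendsto (fun i : Σ n, Fin n → Z => i.1) L atTop :=
    tendsto_fst_sampleFilter.mono_left hLs
  refine Tendsto.mono_left (tendsto_mul_quantile (L := L)
    (Ω := fun _ : (Σ n, Fin n → Z) => Ωs) (μ := fun i => M.Pstar i.2)
    (X := fun i ω => h (M.adjDraw i.2 (b i.1) ω) - h (M.θhat i.1 i.2)) (s := fun i => √i.1)
    ?_ (gaussianReal_real_Iic_strictMono hv0) (fun t => ?_) z) hL
  · filter_upwards [hn.eventually_ge_atTop 1] with i hi
    exact Real.sqrt_pos.2 (by exact_mod_cast hi)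
  · exact tendsto_bootstrap_real_le hM hm hb hlog hcA hc hH hP hSigma hchar
      (hN.hasStrictFDerivAt hM) hLs (tendsto_comap.mono_left (inf_le_right.trans inf_le_left)) hq
      (tendsto_comap.mono_left (inf_le_right.trans inf_le_right)) t

/-- Coverage: on the scale `√n`, the error of `h(θ̂_n)` and the bootstrap quantiles refer to the same
Gaussian law. -/
theorem tendsto_coverage (hM : M.Standing) (hN : M.NormalDelta V h) {b : ℕ → ℕ}
    (hm : Tendsto M.m atTop atTop) (hb : Tendsto b atTop atTop)
    (hlog : Tendsto (fun n => Real.log (M.m n) / (b n : ℝ)) atTop (𝓝 0)) {c : Consts}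
    (hcA : c.Admissible M.γ) (hc : ∀ n, ∀ x ∈ M.S n, M.CouplingAt 2 c x (M.Hhat x)⁻¹)
    (hH : c.lamH ≤ c.LamH) (hP : c.lamP ≤ c.LamP) (hSigma : M.SigmaRegular)
    (hchar : M.CharFunExpansion) {α : ℝ} (h0 : 0 < α) (h1 : α < 1) :
    Tendsto (fun n => (M.P n).real
        {x | M.critValue h x (b n) (α / 2) ≤ h M.θdag - h (M.θhat n x) ∧
          h M.θdag - h (M.θhat n x) ≤ M.critValue h x (b n) (1 - α / 2)})
        atTop (𝓝 (1 - α)) := by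
  obtain ⟨l, L, hl, hV⟩ := exists_VN_bounds hM hcA hc hH hSigma
  have hVb := hN.eigBounds hM hV
  have hq : 0 < quad V (gradient h M.θdag) := lt_of_lt_of_le
    (mul_pos hl (pow_pos (norm_pos_iff.2 hN.h_grad) 2)) (hVb.2 _).1
  have hv0 : (quad V (gradient h M.θdag)).toNNReal ≠ 0 := by simpa using hq
  obtain ⟨z₁, hz₁⟩ := exists_gaussianReal_real_Iic_eq hv0 (α := α / 2) (by linarith) (by linarith)
  obtain ⟨z₂, hz₂⟩ := exists_gaussianReal_real_Iic_eq hv0 (α := 1 - α / 2) (by linarith)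
    (by linarith)
  have hz : z₁ < z₂ := (gaussianReal_real_Iic_strictMono hv0).lt_iff_lt.1
    (by simp only [hz₁, hz₂]; linarith)
  have hcrit := tendsto_sqrt_mul_critValue hM hN hm hb hlog hcA hc hH hP hSigma hchar hq
  have hc₁ := hcrit z₁
  have hc₂ := hcrit z₂
  rw [hz₁] at hc₁
  rw [hz₂] at hc₂
  have hm' : ∀ᶠ n in atTop, AEMeasurable (fun x : Fin n → Z =>
      √n * (h M.θdag - h (M.θhat n x))) (M.P n) := by
    filter_upwards [eventually_ge_atTop 1] with n hn
    have hn0 : √(n : ℝ) ≠ 0 := (Real.sqrt_pos.2 (by exact_mod_cast hn)).ne'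
    have h2 : AEMeasurable (fun x => M.θhat n x) (M.P n) := by
      refine (((hN.clt.forall_aemeasurable n).const_smul (√(n : ℝ))⁻¹).add_const M.θdag).congr
        (Eventually.of_forall fun x => ?_)
      simp [smul_smul, inv_mul_cancel₀ hn0]
    exact ((hN.h_meas.comp_aemeasurable h2).const_sub _).const_mul _
  have hd₁ := tendsto_real_of_tendsto_whpFilter hc₁
  have hd₂ := tendsto_real_of_tendsto_whpFilter hc₂
  have hT := hN.tendsto_real_le (posSemidef_of_quad hVb.1 (hVb.quad_nonneg hl)) hq
    (hN.hasStrictFDerivAt hM)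
  have key := tendsto_real_between (μ := M.P) (gaussianReal_real_Iic_continuous hv0) hm' hz hT
    hd₁ hd₂
  rw [hz₁, hz₂, show 1 - α / 2 - α / 2 = 1 - α by ring] at key
  refine key.congr' ?_
  filter_upwards [eventually_ge_atTop 1] with n hn
  have hn0 : 0 < √(n : ℝ) := Real.sqrt_pos.2 (by exact_mod_cast hn)
  simp only [mul_le_mul_iff_right₀ hn0]

end Setting

end ResampledOpt

theorem theorem2 {d : ℕ} {Z Ωs : Type*} [MeasurableSpace Z] [MeasurableSpace Ωs]
    (M : ResampledOpt.Setting d Z Ωs) [∀ n, IsProbabilityMeasure (M.P n)] (hM : M.Standing)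
    (V : Matrix (Fin d) (Fin d) ℝ) (h : ResampledOpt.Vec d → ℝ) (b : ℕ → ℕ)
    (hm : Tendsto M.m atTop atTop) (hb : Tendsto b atTop atTop)
    (hlog : Tendsto (fun n => Real.log (M.m n) / (b n : ℝ)) atTop (𝓝 0))
    (hcoupling : M.CouplingConditions 2 (fun _ x => (M.Hhat x)⁻¹))
    (hSigma : M.SigmaRegular) (hchar : M.CharFunExpansion) (hnormal : M.NormalDelta V h) :
    (∀ α : ℝ, 0 < α → α < 1 →
      Tendsto (fun n => (M.P n).real
        {x | M.critValue h x (b n) (α / 2) ≤ h M.θdag - h (M.θhat n x) ∧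
          h M.θdag - h (M.θhat n x) ≤ M.critValue h x (b n) (1 - α / 2)})
        atTop (𝓝 (1 - α))) ∧
    (M.CouplingConditions 4 (fun _ x => (M.Hhat x)⁻¹) →
      ∀ ε : ℝ, 0 < ε → ∀ᶠ n in atTop, ∀ x ∈ M.S n,
        |(M.m n : ℝ) / ResampledOpt.phi M.γ * Var[fun ω => h (M.draw x (b n) ω); M.Pstar x]
          - ResampledOpt.quad (M.VN x) (gradient h (M.θhat n x))| ≤ ε) := by
  obtain ⟨c, hcA, hc⟩ := hcoupling
  obtain ⟨n, x, hx⟩ := ResampledOpt.Setting.exists_mem_S hM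
  obtain ⟨hH, hP⟩ := (hc n x hx).lower_le_upper hM hx hnormal.dim_pos
  refine ⟨fun α h0 h1 => ResampledOpt.Setting.tendsto_coverage hM hnormal hm hb hlog hcA hc hH hP
    hSigma hchar h0 h1, fun ⟨c₄, hcA₄, hc₄⟩ ε hε => ?_⟩
  obtain ⟨hH₄, hP₄⟩ := (hc₄ n x hx).lower_le_upper hM hx hnormal.dim_pos
  obtain ⟨K, hK⟩ := hnormal.h_lip
  exact ResampledOpt.Setting.eventually_abs_variance_sub_quad_le hM hm hb hlog hc
    (ResampledOpt.Setting.exists_VN_bounds hM hcA hc hH hSigma) hcA₄ hc₄ hH₄ hP₄ hnormal.h_meas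
    (fun θ hθ => (hnormal.h_C1 θ hθ).differentiableAt one_ne_zero) hK hε
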